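/- **Setting.** Let $0<q<1$. Let $\mathcal{A}=\mathcal{O}(S^7_q)$ be the unital complex $*$-algebra generated by $x_1,\dots,x_4$ with relations $x_1x_2=qx_2x_1$, $x_1x_3=qx_3x_1$, $x_1x_4=q^2x_4x_1$, $x_2x_3=q^2x_3x_2+q^2(q-q^{-1})x_4x_1$, $x_2x_4=qx_4x_2$, $x_3x_4=qx_4x_3$, $x_1^*x_1=x_1x_1^*$, $x_1^*x_2=qx_2x_1^*$, $x_1^*x_3=qx_3x_1^*$, $x_1^*x_4=q^2x_4x_1^*$, $x_2^*x_2=x_2x_2^*+(1-q^2)x_1x_1^*$, $x_2^*x_3=q^2x_3x_2^*$, $x_2^*x_4=qx_4x_2^*+q^2(q-q^{-1})x_3x_1^*$, $x_3^*x_3=x_3x_3^*+(1-q^4)x_2x_2^*+(1-q^2)x_1x_1^*$, $x_3^*x_4=qx_4x_3^*-q^4(q-q^{-1})x_2x_1^*$, $\sum_i x_ix_i^*=1$, $q^8x_1^*x_1+q^6x_2^*x_2+q^2x_3^*x_3+x_4^*x_4=1$, and their adjoints. Let $\mathcal{H}=\mathcal{O}(SU_q(2))$ be the $*$-algebra generated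 by $\alpha,\gamma$ such that the matrix $t_{(1)}=\begin{pmatrix}\alpha&-q\gamma^*\\ \gamma&\alpha^*\end{pmatrix}$ is unitary, let $t_{(n)}$ be the $(n+1)\times(n+1)$ unitary matrix of its irreducible corepresentation $V_n$ of dimension $n+1$ (in the basis $e_0,\dots,e_n$ specified below), and let $$u=(u^0,u^1)=\begin{pmatrix} qx_1&qx_2\\ -q^2x_2^*&q^3x_1^*\\ -x_3&x_4\\ x_4^*&qx_3^*\end{pmatrix}.$$ Let $\delta_R:\mathcal{A}\to\mathcal{A}\otimes\mathcal{H}$ be the $*$-homomorphism with $\delta_R(u_i^k)=\sum_j u_i^j\otimes (t_{(1)})_j^k$, $\mathcal{B}=\mathcal{O}(S^4_q)=\{b\in\mathcal{A}:\delta_R(b)=b\otimes1\}$, and $$\mathcal{E}_n=\mathcal{A}\,\Box^{\mathcal{H}}V_n=\Big\{(a_0,\dots,a_n)\in\mathcal{A}^{n+1}:\delta_R(a_j)=\sum_i a_i\otimes (t_{(n)})_i^j\Big\},\qquad \mathcal{E}_n'=\mathcal{A}\,\Box^{\mathcal{H}}V_n^\vee=\Big\{(a_j):\delta_R(a_j)=\sum_i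 a_i\otimes ((t_{(n)})_i^j)^*\Big\},$$ which are $\mathcal{B}$-bimodules. Put $[n]=\frac{1-q^{2n}}{1-q^2}$. For column vectors $v,w$ let $v\bullet w$ be the column with entries $v_iw_j$. Let $U_{(1)}=u$ and, for $n\ge2$, let $U_{(n)}$ be the $4^n\times(n+1)$ matrix with columns $$U_{(n)}^k=[n]^{-1/2}\big(q^k[n-k]^{1/2}\,u^0\bullet U_{(n-1)}^k+[k]^{1/2}\,u^1\bullet U_{(n-1)}^{k-1}\big),\qquad 0\le k\le n$$ (terms with coefficient $[0]^{1/2}$ are $0$). For $n\ge0$ let $W_{(n)}$ be the $4^{n+2}\times(n+1)$ matrix with columns $$W_{(n)}^k=[n+2]^{-1/2}\big([k+1]^{1/2}\,u^0\bullet U_{(n+1)}^{k+1}-q^{k+1}[n+1-k]^{1/2}\,u^1\bullet U_{(n+1)}^k\big),\qquad 0\le k\le n.$$ Put $P_{(n)}=U_{(n)}U_{(n)}^*$ and $Q_{(n)}=W_{(n)}W_{(n)}^*$. The basis of $V_{n+1}$ is the one for which the isometry $e_k\mapsto[n+1]^{-1/2}\big(q^k[n+1-k]^{1/2}e_0\otimes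 e_k+[k]^{1/2}e_1\otimes e_{k-1}\big)$ identifies $V_{n+1}$ with a subcomodule of $V_1\otimes V_n$. **Proposition.** Let $n\ge1$. 1. $P_{(n+1)}+Q_{(n-1)}$ is a self-adjoint idempotent with entries in $\mathcal{B}$, and it equals $P_{(n,1)}:=U_{(n,1)}U_{(n,1)}^*$, where $U_{(n,1)}=(u^0\bullet U_{(n)},\,u^1\bullet U_{(n)})$. Explicitly, its entry in row $(j_1,j_2)$ and column $(k_1,k_2)$, with $j_1,k_1\in\{1,\dots,4\}$ and $j_2,k_2\in\{1,\dots,4\}^n$, is $\sum_{i}u_{j_1}^i\,(P_{(n)})_{j_2}^{k_2}\,(u_{k_1}^i)^*$. The formula $(b\otimes a)\mapsto\big(\sum_{i,k}u_{j_1}^i\,(U_{(n)})_{j_2}^k\,b_ka_i\big)_{(j_1,j_2)}$ defines an isomorphism of right $\mathcal{B}$-modules $\mathcal{E}_n'\otimes_{\mathcal{B}}\mathcal{E}_1'\cong(P_{(n+1)}+Q_{(n-1)})\mathcal{B}^{4^{n+1}}$. 2. There is an isomorphism of right $\mathcal{B}$-modules $$\mathcal{E}_1\otimes_{\mathcal{B}}\mathcal{E}_n\;\cong\;(P_{(n+1)}+Q_{(n-1)})\,\mathcal{B}^{4^{n+1}},\qquad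 a\otimes b\mapsto\sum_{k=0}^{n+1}(-q)^k\,U_{(n+1)}^k\,c_{n+1-k}+\sum_{k=0}^{n-1}(-q)^k\,W_{(n-1)}^k\,d_{n-1-k},$$ where $c_k=[n+1]^{-1/2}\big(q^k[n+1-k]^{1/2}a_0b_k+[k]^{1/2}a_1b_{k-1}\big)$ and $d_k=[n+1]^{-1/2}\big([k+1]^{1/2}a_0b_{k+1}-q^{k+1}[n-k]^{1/2}a_1b_k\big)$. 3. $P_{(n)}$ is a self-adjoint idempotent with entries in $\mathcal{B}$, and $P_{(n)}\mathcal{B}^{4^n}\cong\mathcal{E}_n$ as right $\mathcal{B}$-modules. Let $\varepsilon:\mathcal{A}\to\mathbb{C}$ be the character with $\varepsilon(x_4)=1$ and $\varepsilon(x_i)=0$ for $i\ne4$. There is a $*$-representation $\pi$ of $\mathcal{A}$ by bounded operators on $\ell^2(\mathbb{N}^2)$ with $\pi(x_1)=0$, $\pi(x_2)|k_1,k_2\rangle=q^{k_1+2k_2}|k_1,k_2\rangle$, $\pi(x_3)|k_1,k_2\rangle=q^{k_1}\sqrt{1-q^{4(k_2+1)}}\,|k_1,k_2+1\rangle$, $\pi(x_4)|k_1,k_2\rangle=\sqrt{1-q^{2(k_1+1)}}\,|k_1+1,k_2\rangle$,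 and for it $\pi(\mathrm{Tr}\,P_{(n)})-\varepsilon(\mathrm{Tr}\,P_{(n)})$ is of trace class, with $$\mathrm{ch}_1(\mathcal{E}_n)=\mathrm{Tr}\big(\pi(\mathrm{Tr}\,P_{(n)})-\varepsilon(\mathrm{Tr}\,P_{(n)})\big)=-\tfrac16\,n(n+1)(n+2).$$ -/

import Mathlib

open scoped TensorProduct

noncomputable section

/-! ## Unital *-algebras over `ℂ` given by generators and relations -/

/-- The free unital complex *-algebra on `ι`: the free algebra on symbols `x i` (`Sum.inl i`)
and `(x i)^*` (`Sum.inr i`). -/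
def FreeStar (ι : Type) : Type := FreeAlgebra ℂ (ι ⊕ ι)

namespace FreeStar

variable {ι : Type}

instance : Ring (FreeStar ι) := inferInstanceAs (Ring (FreeAlgebra ℂ (ι ⊕ ι)))
instance : Algebra ℂ (FreeStar ι) := inferInstanceAs (Algebra ℂ (FreeAlgebra ℂ (ι ⊕ ι)))

/-- The symbols `x i` and `(x i)^*`. -/
def sym (s : ι ⊕ ι) : FreeStar ι := FreeAlgebra.ι ℂ s

/-- The generators. -/
def gen (i : ι) : FreeStar ι := sym (Sum.inl i)

/-- The conjugate-linear anti-multiplicative map exchanging `x i` and `(x i)^*`. -/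
def starHom : FreeStar ι →+* (FreeStar ι)ᵐᵒᵖ :=
  let _ : Algebra ℂ (FreeStar ι)ᵐᵒᵖ :=
    Algebra.compHom (R := ℂ) (FreeStar ι)ᵐᵒᵖ (starRingEnd ℂ)
  (FreeAlgebra.lift ℂ (A := (FreeStar ι)ᵐᵒᵖ)
    (fun s : ι ⊕ ι => MulOpposite.op (sym s.swap))).toRingHom

theorem starHom_sym (s : ι ⊕ ι) : starHom (sym s) = MulOpposite.op (sym s.swap) := by
  let _ : Algebra ℂ (FreeStar ι)ᵐᵒᵖ :=
    Algebra.compHom (R := ℂ) (FreeStar ι)ᵐᵒᵖ (starRingEnd ℂ)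
  exact FreeAlgebra.lift_ι_apply (R := ℂ) (A := (FreeStar ι)ᵐᵒᵖ) _ s

theorem starHom_algebraMap (c : ℂ) :
    starHom (algebraMap ℂ (FreeStar ι) c)
      = MulOpposite.op (algebraMap ℂ (FreeStar ι) (starRingEnd ℂ c)) := by
  let _ : Algebra ℂ (FreeStar ι)ᵐᵒᵖ :=
    Algebra.compHom (R := ℂ) (FreeStar ι)ᵐᵒᵖ (starRingEnd ℂ)
  exact (FreeAlgebra.lift ℂ (A := (FreeStar ι)ᵐᵒᵖ)
    (fun s : ι ⊕ ι => MulOpposite.op (sym s.swap))).commutes c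

theorem induct {C : FreeStar ι → Prop} (h1 : ∀ c, C (algebraMap ℂ _ c)) (h2 : ∀ s, C (sym s))
    (h3 : ∀ a b, C a → C b → C (a * b)) (h4 : ∀ a b, C a → C b → C (a + b)) (a : FreeStar ι) :
    C a :=
  FreeAlgebra.induction ℂ (ι ⊕ ι) h1 h2 h3 h4 a

instance : StarRing (FreeStar ι) where
  star a := (starHom a).unop
  star_involutive a := by
    induction a using induct with
    | h1 c => simp [starHom_algebraMap]
    | h2 s => simp [starHom_sym]
    | h3 a b ha hb => simp only [map_mul, MulOpposite.unop_mul, ha, hb]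
    | h4 a b ha hb => simp only [map_add, MulOpposite.unop_add, ha, hb]
  star_mul a b := by simp
  star_add a b := by simp

theorem star_sym (s : ι ⊕ ι) : star (sym s) = sym s.swap := by
  change (starHom (sym s)).unop = _
  rw [starHom_sym]; rfl

theorem star_algebraMap (c : ℂ) :
    star (algebraMap ℂ (FreeStar ι) c) = algebraMap ℂ (FreeStar ι) (star c) := by
  change (starHom _).unop = _
  rw [starHom_algebraMap]; rfl

instance : StarModule ℂ (FreeStar ι) where
  star_smul c a := by
    rw [Algebra.smul_def, star_mul, star_algebraMap, Algebra.smul_def, Algebra.commutes]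

variable {C : Type*} [Ring C] [Algebra ℂ C] [StarRing C] [StarModule ℂ C]

/-- The *-homomorphism determined by the images of the generators. -/
def lift (f : ι → C) : FreeStar ι →⋆ₐ[ℂ] C :=
  let g : FreeStar ι →ₐ[ℂ] C :=
    FreeAlgebra.lift ℂ (Sum.elim f (fun i => star (f i)))
  { g with
    map_star' := by
      have hs : ∀ s, g (sym s) = Sum.elim f (fun i => star (f i)) s :=
        fun s => FreeAlgebra.lift_ι_apply _ s
      intro a
      change g (star a) = star (g a)
      induction a using induct with
      | h1 c => rw [star_algebraMap, AlgHom.commutes, AlgHom.commutes, algebraMap_star_comm]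
      | h2 s => rw [star_sym, hs, hs]; cases s <;> simp
      | h3 a b ha hb => rw [star_mul, map_mul, map_mul, star_mul, ha, hb]
      | h4 a b ha hb => rw [star_add, map_add, map_add, star_add, ha, hb] }

@[simp] theorem lift_gen (f : ι → C) (i : ι) : lift f (gen i) = f i :=
  FreeAlgebra.lift_ι_apply (R := ℂ) (Sum.elim f (fun i => star (f i))) (Sum.inl i)

end FreeStar

/-- The unital complex *-algebra with generators `ι` and relations `a = b` for `r a b`, together
with the relations `a^* = b^*` obtained by applying the involution. -/
def StarAlg {ι : Type} (r : FreeStar ι → FreeStar ι → Prop) : Type :=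
  RingQuot (fun a b => r a b ∨ r (star a) (star b))

namespace StarAlg

variable {ι : Type} {r : FreeStar ι → FreeStar ι → Prop}

instance : Ring (StarAlg r) := inferInstanceAs (Ring (RingQuot _))
instance : Algebra ℂ (StarAlg r) := inferInstanceAs (Algebra ℂ (RingQuot _))
instance : StarRing (StarAlg r) :=
  RingQuot.starRing (fun a b => r a b ∨ r (star a) (star b))
    (fun a b h => by rwa [star_star, star_star, or_comm])

/-- The quotient map. -/
def mk : FreeStar ι →ₐ[ℂ] StarAlg r := RingQuot.mkAlgHom ℂ _

theorem mk_surjective : Function.Surjective (mk (r := r)) := RingQuot.mkAlgHom_surjective ℂ _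

theorem mk_star (a : FreeStar ι) : mk (r := r) (star a) = star (mk (r := r) a) := by
  have h : ∀ b : FreeStar ι, mk (r := r) b
      = RingQuot.mkRingHom (fun a b => r a b ∨ r (star a) (star b)) b := fun b => by
    rw [← RingQuot.mkAlgHom_coe ℂ]; rfl
  rw [h, h, RingQuot.mkRingHom_def]
  rfl

instance : StarModule ℂ (StarAlg r) where
  star_smul c a := by
    obtain ⟨a, rfl⟩ := mk_surjective a
    rw [← map_smul, ← mk_star, star_smul, map_smul, mk_star]

/-- The generators. -/
def gen (i : ι) : StarAlg r := mk (FreeStar.gen i)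

theorem mk_gen (i : ι) : mk (r := r) (FreeStar.gen i) = gen i := rfl

theorem mk_eq {a b : FreeStar ι} (h : r a b) : mk (r := r) a = mk b :=
  RingQuot.mkAlgHom_rel ℂ (Or.inl h)

variable {C : Type*} [Ring C] [Algebra ℂ C] [StarRing C] [StarModule ℂ C]

/-- The *-homomorphism determined by images of the generators that satisfy the relations. -/
def lift (f : ι → C) (h : ∀ a b, r a b → FreeStar.lift f a = FreeStar.lift f b) :
    StarAlg r →⋆ₐ[ℂ] C :=
  have h' : ∀ ⦃a b⦄, (r a b ∨ r (star a) (star b)) →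
      (FreeStar.lift f).toAlgHom a = (FreeStar.lift f).toAlgHom b := by
    rintro a b (hab | hab)
    · exact h a b hab
    · have := h _ _ hab
      rw [map_star, map_star] at this
      exact star_injective this
  let g : StarAlg r →ₐ[ℂ] C := RingQuot.liftAlgHom ℂ ⟨(FreeStar.lift f).toAlgHom, h'⟩
  { g with
    map_star' := by
      have hg : ∀ a, g (mk a) = FreeStar.lift f a := fun a =>
        RingQuot.liftAlgHom_mkAlgHom_apply ℂ _ _ a
      intro a
      obtain ⟨a, rfl⟩ := mk_surjective a
      change g (star _) = star (g _)
      rw [← mk_star, hg, hg, map_star] }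

@[simp] theorem lift_gen (f : ι → C) (h : ∀ a b, r a b → FreeStar.lift f a = FreeStar.lift f b)
    (i : ι) : lift f h (gen i) = f i :=
  (RingQuot.liftAlgHom_mkAlgHom_apply ℂ (FreeStar.lift f).toAlgHom _ _).trans
    (FreeStar.lift_gen f i)

end StarAlg

/-! ## The quantum group `SU_q(2)` and the quantum symplectic 7-sphere -/

/-- The deformation parameter `0 < q < 1`. -/
abbrev QParam : Type := Set.Ioo (0 : ℝ) 1

namespace QParam

/-- `q` as a complex number. -/
def c (q : QParam) : ℂ := ((q : ℝ) : ℂ)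

theorem c_ne_zero (q : QParam) : q.c ≠ 0 := Complex.ofReal_ne_zero.2 q.2.1.ne'

@[simp] theorem star_c (q : QParam) : star q.c = q.c := Complex.conj_ofReal _

end QParam

namespace SUq2

/-- The fundamental matrix `((α, -q γ^*), (γ, α^*))` on generators `a`, `g`. -/
def fund {H : Type} [Ring H] [Algebra ℂ H] [Star H] (q : QParam) (a g : H) :
    Matrix (Fin 2) (Fin 2) H :=
  !![a, -(q.c • star g); g, star a]

/-- The fundamental matrix over the free *-algebra on `α = gen 0`, `γ = gen 1`. -/
def freeFund (q : QParam) : Matrix (Fin 2) (Fin 2) (FreeStar (Fin 2)) := fund q (.gen 0) (.gen 1)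

/-- The relations of `O(SU_q(2))`: the fundamental matrix is unitary. -/
inductive Rel (q : QParam) : FreeStar (Fin 2) → FreeStar (Fin 2) → Prop
  | mul_star (i j : Fin 2) :
      Rel q ((freeFund q * (freeFund q).conjTranspose : Matrix (Fin 2) (Fin 2) _) i j)
        ((1 : Matrix (Fin 2) (Fin 2) _) i j)
  | star_mul (i j : Fin 2) :
      Rel q (((freeFund q).conjTranspose * freeFund q : Matrix (Fin 2) (Fin 2) _) i j)
        ((1 : Matrix (Fin 2) (Fin 2) _) i j)

end SUq2

/-- The *-algebra `O(SU_q(2))`. -/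
abbrev OSU2 (q : QParam) : Type := StarAlg (SUq2.Rel q)

namespace OSU2

variable (q : QParam)

/-- The generator `α`. -/
def α : OSU2 q := StarAlg.gen 0

/-- The generator `γ`. -/
def γ : OSU2 q := StarAlg.gen 1

/-- The fundamental corepresentation matrix, rows and columns counted from `0`. -/
def t₁ : Matrix (Fin 2) (Fin 2) (OSU2 q) := SUq2.fund q (α q) (γ q)

end OSU2

namespace S7q

/-- The relations of `O(S^7_q)`; the generator `x_i` is `x (i - 1)`. Their adjoints are added in
`StarAlg`. -/
inductive Rel (q : QParam) : FreeStar (Fin 4) → FreeStar (Fin 4) → Prop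
  | r12 : Rel q (.gen 0 * .gen 1) (q.c • (.gen 1 * .gen 0))
  | r13 : Rel q (.gen 0 * .gen 2) (q.c • (.gen 2 * .gen 0))
  | r14 : Rel q (.gen 0 * .gen 3) (q.c ^ 2 • (.gen 3 * .gen 0))
  | r23 : Rel q (.gen 1 * .gen 2)
      (q.c ^ 2 • (.gen 2 * .gen 1) + (q.c ^ 2 * (q.c - q.c⁻¹)) • (.gen 3 * .gen 0))
  | r24 : Rel q (.gen 1 * .gen 3) (q.c • (.gen 3 * .gen 1))
  | r34 : Rel q (.gen 2 * .gen 3) (q.c • (.gen 3 * .gen 2))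
  | s11 : Rel q (star (.gen 0) * .gen 0) (.gen 0 * star (.gen 0))
  | s14 : Rel q (star (.gen 0) * .gen 3) (q.c ^ 2 • (.gen 3 * star (.gen 0)))
  | s24 : Rel q (star (.gen 1) * .gen 3)
      (q.c • (.gen 3 * star (.gen 1)) + (q.c ^ 2 * (q.c - q.c⁻¹)) • (.gen 2 * star (.gen 0)))
  | s12 : Rel q (star (.gen 0) * .gen 1) (q.c • (.gen 1 * star (.gen 0)))
  | s22 : Rel q (star (.gen 1) * .gen 1)
      (.gen 1 * star (.gen 1) + (1 - q.c ^ 2) • (.gen 0 * star (.gen 0)))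
  | s33 : Rel q (star (.gen 2) * .gen 2)
      (.gen 2 * star (.gen 2) + (1 - q.c ^ 4) • (.gen 1 * star (.gen 1))
        + (1 - q.c ^ 2) • (.gen 0 * star (.gen 0)))
  | s13 : Rel q (star (.gen 0) * .gen 2) (q.c • (.gen 2 * star (.gen 0)))
  | s23 : Rel q (star (.gen 1) * .gen 2) (q.c ^ 2 • (.gen 2 * star (.gen 1)))
  | s34 : Rel q (star (.gen 2) * .gen 3)
      (q.c • (.gen 3 * star (.gen 2)) - (q.c ^ 4 * (q.c - q.c⁻¹)) • (.gen 1 * star (.gen 0)))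
  | sphere : Rel q (.gen 0 * star (.gen 0) + .gen 1 * star (.gen 1) + .gen 2 * star (.gen 2)
      + .gen 3 * star (.gen 3)) 1
  | sphere' : Rel q (q.c ^ 8 • (star (.gen 0) * .gen 0) + q.c ^ 6 • (star (.gen 1) * .gen 1)
      + q.c ^ 2 • (star (.gen 2) * .gen 2) + star (.gen 3) * .gen 3) 1

end S7q

/-- The *-algebra `O(S^7_q)`. -/
abbrev OS7 (q : QParam) : Type := StarAlg (S7q.Rel q)

namespace OS7

variable (q : QParam)

/-- The generators `x_1, …, x_4`, numbered from `0`. -/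
def x (i : Fin 4) : OS7 q := StarAlg.gen i

/-- The `4 × 2` matrix of generators (columns counted from `0`). -/
def u : Matrix (Fin 4) (Fin 2) (OS7 q) :=
  !![q.c • x q 0, q.c • x q 1;
     -(q.c ^ 2 • star (x q 1)), q.c ^ 3 • star (x q 0);
     -(x q 2), x q 3;
     star (x q 3), q.c • star (x q 2)]

/-- The character `ε`, with `ε(x_4) = 1` and `ε(x_i) = 0` for `i ≠ 4`. -/
def counit : OS7 q →⋆ₐ[ℂ] ℂ :=
  StarAlg.lift (fun i : Fin 4 => if i = 3 then 1 else 0) (by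
    intro a b h
    cases h <;> simp [map_star])

/-- The images of the generators under the coaction. -/
def coactGen (i : Fin 4) : OS7 q ⊗[ℂ] OSU2 q :=
  ![x q 0 ⊗ₜ OSU2.α q + x q 1 ⊗ₜ OSU2.γ q,
    x q 1 ⊗ₜ star (OSU2.α q) - q.c • x q 0 ⊗ₜ star (OSU2.γ q),
    x q 2 ⊗ₜ OSU2.α q - x q 3 ⊗ₜ OSU2.γ q,
    x q 3 ⊗ₜ star (OSU2.α q) + q.c • x q 2 ⊗ₜ star (OSU2.γ q)] i

end OS7

namespace OSU2

variable (q : QParam)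

theorem α_mul_star_α : α q * star (α q) = 1 - q.c ^ 2 • (γ q * star (γ q)) := by
  have h := StarAlg.mk_eq (SUq2.Rel.star_mul (q := q) 1 1)
  simp [Matrix.mul_apply, Fin.sum_univ_two, SUq2.fund, SUq2.freeFund, StarAlg.mk_star,
    StarAlg.mk_gen, smul_smul, Matrix.conjTranspose_apply] at h
  rw [eq_sub_iff_add_eq, add_comm, pow_two]
  exact h

theorem star_α_mul_α : star (α q) * α q = 1 - γ q * star (γ q) := by
  have h := StarAlg.mk_eq (SUq2.Rel.mul_star (q := q) 1 1)
  simp [Matrix.mul_apply, Fin.sum_univ_two, SUq2.fund, SUq2.freeFund, StarAlg.mk_star,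
    StarAlg.mk_gen, Matrix.conjTranspose_apply] at h
  rw [eq_sub_iff_add_eq, add_comm]
  exact h

theorem star_γ_mul_γ : star (γ q) * γ q = γ q * star (γ q) := by
  have h := StarAlg.mk_eq (SUq2.Rel.star_mul (q := q) 0 0)
  simp [Matrix.mul_apply, Fin.sum_univ_two, SUq2.fund, SUq2.freeFund, StarAlg.mk_star,
    StarAlg.mk_gen, Matrix.conjTranspose_apply] at h
  have h' : star (α q) * α q + star (γ q) * γ q = 1 := h
  rw [star_α_mul_α, sub_add_eq_add_sub, sub_eq_iff_eq_add, add_right_inj] at h'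
  exact h'

theorem α_mul_γ : α q * γ q = q.c • (γ q * α q) := by
  have h := StarAlg.mk_eq (SUq2.Rel.star_mul (q := q) 1 0)
  simp [Matrix.mul_apply, Fin.sum_univ_two, SUq2.fund, SUq2.freeFund,
    StarAlg.mk_gen, Matrix.conjTranspose_apply] at h
  exact (neg_add_eq_zero.1 h).symm

theorem α_mul_star_γ : α q * star (γ q) = q.c • (star (γ q) * α q) := by
  have h := StarAlg.mk_eq (SUq2.Rel.mul_star (q := q) 0 1)
  simp [Matrix.mul_apply, Fin.sum_univ_two, SUq2.fund, SUq2.freeFund, StarAlg.mk_star,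
    StarAlg.mk_gen, Matrix.conjTranspose_apply] at h
  exact add_neg_eq_zero.1 h

theorem γ_mul_star_α : γ q * star (α q) = q.c • (star (α q) * γ q) := by
  simpa using congrArg star (α_mul_star_γ q)

theorem star_γ_mul_star_α : star (γ q) * star (α q) = q.c • (star (α q) * star (γ q)) := by
  simpa using congrArg star (α_mul_γ q)

end OSU2

namespace OS7

variable (q : QParam)

theorem r12 : x q 0 * x q 1 = q.c • (x q 1 * x q 0) := by
  simpa [x, StarAlg.mk_star, StarAlg.mk_gen] using StarAlg.mk_eq (S7q.Rel.r12 (q := q))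
theorem r13 : x q 0 * x q 2 = q.c • (x q 2 * x q 0) := by
  simpa [x, StarAlg.mk_star, StarAlg.mk_gen] using StarAlg.mk_eq (S7q.Rel.r13 (q := q))
theorem r14 : x q 0 * x q 3 = q.c ^ 2 • (x q 3 * x q 0) := by
  simpa [x, StarAlg.mk_star, StarAlg.mk_gen] using StarAlg.mk_eq (S7q.Rel.r14 (q := q))
theorem r23 : x q 1 * x q 2
    = q.c ^ 2 • (x q 2 * x q 1) + (q.c ^ 2 * (q.c - q.c⁻¹)) • (x q 3 * x q 0) := by
  simpa [x, StarAlg.mk_star, StarAlg.mk_gen] using StarAlg.mk_eq (S7q.Rel.r23 (q := q))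
theorem r24 : x q 1 * x q 3 = q.c • (x q 3 * x q 1) := by
  simpa [x, StarAlg.mk_star, StarAlg.mk_gen] using StarAlg.mk_eq (S7q.Rel.r24 (q := q))
theorem r34 : x q 2 * x q 3 = q.c • (x q 3 * x q 2) := by
  simpa [x, StarAlg.mk_star, StarAlg.mk_gen] using StarAlg.mk_eq (S7q.Rel.r34 (q := q))
theorem s11 : star (x q 0) * x q 0 = x q 0 * star (x q 0) := by
  simpa [x, StarAlg.mk_star, StarAlg.mk_gen] using StarAlg.mk_eq (S7q.Rel.s11 (q := q))
theorem s14 : star (x q 0) * x q 3 = q.c ^ 2 • (x q 3 * star (x q 0)) := by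
  simpa [x, StarAlg.mk_star, StarAlg.mk_gen] using StarAlg.mk_eq (S7q.Rel.s14 (q := q))
theorem s24 : star (x q 1) * x q 3 = q.c • (x q 3 * star (x q 1))
    + (q.c ^ 2 * (q.c - q.c⁻¹)) • (x q 2 * star (x q 0)) := by
  simpa [x, StarAlg.mk_star, StarAlg.mk_gen] using StarAlg.mk_eq (S7q.Rel.s24 (q := q))
theorem s12 : star (x q 0) * x q 1 = q.c • (x q 1 * star (x q 0)) := by
  simpa [x, StarAlg.mk_star, StarAlg.mk_gen] using StarAlg.mk_eq (S7q.Rel.s12 (q := q))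
theorem s22 : star (x q 1) * x q 1
    = x q 1 * star (x q 1) + (1 - q.c ^ 2) • (x q 0 * star (x q 0)) := by
  simpa [x, StarAlg.mk_star, StarAlg.mk_gen] using StarAlg.mk_eq (S7q.Rel.s22 (q := q))
theorem s33 : star (x q 2) * x q 2 = x q 2 * star (x q 2)
    + (1 - q.c ^ 4) • (x q 1 * star (x q 1)) + (1 - q.c ^ 2) • (x q 0 * star (x q 0)) := by
  simpa [x, StarAlg.mk_star, StarAlg.mk_gen] using StarAlg.mk_eq (S7q.Rel.s33 (q := q))
theorem s13 : star (x q 0) * x q 2 = q.c • (x q 2 * star (x q 0)) := by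
  simpa [x, StarAlg.mk_star, StarAlg.mk_gen] using StarAlg.mk_eq (S7q.Rel.s13 (q := q))
theorem s23 : star (x q 1) * x q 2 = q.c ^ 2 • (x q 2 * star (x q 1)) := by
  simpa [x, StarAlg.mk_star, StarAlg.mk_gen] using StarAlg.mk_eq (S7q.Rel.s23 (q := q))
theorem s34 : star (x q 2) * x q 3 = q.c • (x q 3 * star (x q 2))
    - (q.c ^ 4 * (q.c - q.c⁻¹)) • (x q 1 * star (x q 0)) := by
  simpa [x, StarAlg.mk_star, StarAlg.mk_gen] using StarAlg.mk_eq (S7q.Rel.s34 (q := q))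
theorem s21 : star (x q 1) * x q 0 = q.c • (x q 0 * star (x q 1)) := by
  simpa using congrArg star (s12 q)
theorem s43 : star (x q 3) * x q 2 = q.c • (x q 2 * star (x q 3))
    - (q.c ^ 4 * (q.c - q.c⁻¹)) • (x q 0 * star (x q 1)) := by
  simpa using congrArg star (s34 q)
theorem sphere : x q 3 * star (x q 3)
    = 1 - x q 0 * star (x q 0) - x q 1 * star (x q 1) - x q 2 * star (x q 2) := by
  have h := StarAlg.mk_eq (S7q.Rel.sphere (q := q))
  simp only [map_add, map_mul, map_one, StarAlg.mk_star, StarAlg.mk_gen] at h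
  change x q 0 * star (x q 0) + x q 1 * star (x q 1) + x q 2 * star (x q 2)
    + x q 3 * star (x q 3) = 1 at h
  rw [← h]; abel
theorem sphere' : star (x q 3) * x q 3
    = 1 - q.c ^ 8 • (star (x q 0) * x q 0) - q.c ^ 6 • (star (x q 1) * x q 1)
      - q.c ^ 2 • (star (x q 2) * x q 2) := by
  have h := StarAlg.mk_eq (S7q.Rel.sphere' (q := q))
  simp only [map_add, map_mul, map_one, map_smul, StarAlg.mk_star, StarAlg.mk_gen] at h
  change q.c ^ 8 • (star (x q 0) * x q 0) + q.c ^ 6 • (star (x q 1) * x q 1)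
      + q.c ^ 2 • (star (x q 2) * x q 2) + star (x q 3) * x q 3 = 1 at h
  rw [← h]; abel

/-- The coaction `δ_R : O(S^7_q) → O(S^7_q) ⊗ O(SU_q(2))`. -/
def coaction : OS7 q →⋆ₐ[ℂ] OS7 q ⊗[ℂ] OSU2 q :=
  StarAlg.lift (coactGen q) (by
    have hq := q.c_ne_zero
    intro a b h
    cases h <;>
      simp only [map_add, map_sub, map_mul, map_star, map_smul, map_one, FreeStar.lift_gen,
        coactGen, Matrix.cons_val, star_add, star_sub, star_smul, QParam.star_c,
        TensorProduct.star_tmul, star_star, mul_add, add_mul, mul_sub, sub_mul,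
        smul_mul_assoc, mul_smul_comm, Algebra.TensorProduct.tmul_mul_tmul,
        OSU2.α_mul_star_α, OSU2.star_α_mul_α, OSU2.star_γ_mul_γ, OSU2.α_mul_γ,
        OSU2.α_mul_star_γ, OSU2.γ_mul_star_α, OSU2.star_γ_mul_star_α,
        r12, r13, r14, r23, r24, r34, s11, s14, s24, s12, s22, s33, s13, s23, s34,
        s21, s43, sphere, sphere',
        TensorProduct.add_tmul, TensorProduct.sub_tmul,
        TensorProduct.tmul_sub, ← TensorProduct.smul_tmul', TensorProduct.tmul_smul,
        Algebra.TensorProduct.one_def] <;>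
      match_scalars <;> field_simp <;> ring)

/-- The coaction on the matrix `u` is `u ⊗̇ t₁`. -/
theorem coaction_u (i : Fin 4) (k : Fin 2) :
    coaction q (u q i k) = ∑ j, u q i j ⊗ₜ OSU2.t₁ q j k := by
  have hx : ∀ i, coaction q (x q i) = coactGen q i := fun i => StarAlg.lift_gen _ _ i
  fin_cases i <;> fin_cases k <;>
    simp [u, OSU2.t₁, SUq2.fund, Fin.sum_univ_two, hx, coactGen, map_star, map_smul, map_neg,
      TensorProduct.star_tmul, ← TensorProduct.smul_tmul', TensorProduct.tmul_smul,
      TensorProduct.neg_tmul, TensorProduct.tmul_neg, smul_sub, smul_add, smul_smul] <;>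
    module

end OS7

/-! ## The quantum 4-sphere and its modules -/

/-- `O(S^4_q)`: the *-subalgebra of coinvariant elements, `δ_R(b) = b ⊗ 1`. -/
def OS4 (q : QParam) : StarSubalgebra ℂ (OS7 q) where
  carrier := {b | OS7.coaction q b = b ⊗ₜ 1}
  mul_mem' {a b} ha hb := by
    simp only [Set.mem_ofPred_eq] at *
    rw [map_mul, ha, hb, Algebra.TensorProduct.tmul_mul_tmul, one_mul]
  add_mem' {a b} ha hb := by
    simp only [Set.mem_ofPred_eq] at *
    rw [map_add, ha, hb, TensorProduct.add_tmul]
  algebraMap_mem' c := by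
    simp only [Set.mem_ofPred_eq]
    rw [AlgHomClass.commutes, Algebra.TensorProduct.algebraMap_apply]
  star_mem' {a} ha := by
    simp only [Set.mem_ofPred_eq] at *
    rw [map_star, ha, TensorProduct.star_tmul, star_one]

/-- The right `O(S^4_q)`-module structure of `O(S^7_q)` given by multiplication on the right. -/
instance OS7.rightModule (q : QParam) : Module (OS4 q)ᵐᵒᵖ (OS7 q) :=
  Module.compHom (OS7 q) (RingHom.op (OS4 q).subtype.toRingHom)

theorem OS7.op_smul (q : QParam) (b : OS4 q) (a : OS7 q) : MulOpposite.op b • a = a * b := rfl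
theorem OS7.smul_def (q : QParam) (b : OS4 q) (a : OS7 q) : b • a = (b : OS7 q) * a := rfl

namespace OS7

variable (q : QParam)

/-- The cotensor product `O(S^7_q) □ V`, as a right `O(S^4_q)`-module, where `V` is the left
`O(SU_q(2))`-comodule with basis `e_i` and coaction `e_i ↦ ∑_j T i j ⊗ e_j`: the family `a`
stands for `∑_j a_j ⊗ e_j`. -/
def cotensor {r : ℕ} (T : Matrix (Fin r) (Fin r) (OSU2 q)) :
    Submodule (OS4 q)ᵐᵒᵖ (Fin r → OS7 q) where
  carrier := {a | ∀ j, coaction q (a j) = ∑ i, a i ⊗ₜ T i j}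
  add_mem' {a b} ha hb j := by
    rw [Pi.add_apply, map_add, ha j, hb j, ← Finset.sum_add_distrib]
    simp only [Pi.add_apply, TensorProduct.add_tmul]
  zero_mem' j := by simp
  smul_mem' b a ha j := by
    have hb : coaction q b.unop.1 = b.unop.1 ⊗ₜ 1 := b.unop.2
    change coaction q (a j * b.unop.1) = ∑ i, (a i * b.unop.1) ⊗ₜ T i j
    rw [map_mul, ha j, hb, Finset.sum_mul]
    simp only [Algebra.TensorProduct.tmul_mul_tmul, mul_one]

/-- Left multiplication by `O(S^4_q)` on the cotensor product. -/
instance cotensor.leftSMul {r : ℕ} (T : Matrix (Fin r) (Fin r) (OSU2 q)) :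
    SMul (OS4 q) (cotensor q T) where
  smul b a := ⟨fun j => (b : OS7 q) * a.1 j, fun j => by
    have hb : coaction q (b : OS7 q) = (b : OS7 q) ⊗ₜ 1 := b.2
    rw [map_mul, a.2 j, hb, Finset.mul_sum]
    simp only [Algebra.TensorProduct.tmul_mul_tmul, one_mul]⟩

theorem cotensor.coe_smul {r : ℕ} (T : Matrix (Fin r) (Fin r) (OSU2 q)) (b : OS4 q)
    (a : cotensor q T) (j : Fin r) : (b • a).1 j = (b : OS7 q) * a.1 j := rfl

/-- The left `O(S^4_q)`-module structure of the cotensor product. -/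
instance cotensor.leftModule {r : ℕ} (T : Matrix (Fin r) (Fin r) (OSU2 q)) :
    Module (OS4 q) (cotensor q T) :=
  Function.Injective.module (OS4 q) (cotensor q T).toAddSubgroup.subtype
    Subtype.val_injective (fun _ _ => rfl)

/-- The two actions make the cotensor product a bimodule. -/
instance cotensor.bimodule {r : ℕ} (T : Matrix (Fin r) (Fin r) (OSU2 q)) :
    SMulCommClass (OS4 q) (OS4 q)ᵐᵒᵖ (cotensor q T) where
  smul_comm b c a := Subtype.ext (funext fun j =>
    (mul_assoc (b : OS7 q) (a.1 j) (c.unop : OS7 q)).symm)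

end OS7

section Balanced

variable (B M N : Type*) [Ring B] [AddCommGroup M] [Module Bᵐᵒᵖ M]
  [AddCommGroup N] [Module B N] [Module Bᵐᵒᵖ N] [SMulCommClass B Bᵐᵒᵖ N]

/-- The tensor product `M ⊗_B N` of a right `B`-module `M` and a `B`-bimodule `N`, as a right
`B`-module: the quotient of the tensor product of abelian groups by `m b ⊗ n = m ⊗ b n`.
(The factors are stored in the opposite order, so that the action of `B` is on the first one.) -/
def BalTensor : Type _ :=
  (N ⊗[ℤ] M) ⧸ Submodule.span Bᵐᵒᵖ
    {z : N ⊗[ℤ] M | ∃ (m : M) (b : B) (n : N), z = n ⊗ₜ (MulOpposite.op b • m) - (b • n) ⊗ₜ m}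

instance : AddCommGroup (BalTensor B M N) := inferInstanceAs (AddCommGroup (_ ⧸ _))
instance : Module Bᵐᵒᵖ (BalTensor B M N) := inferInstanceAs (Module Bᵐᵒᵖ (_ ⧸ _))

variable {M N}

/-- The elementary tensor `m ⊗_B n`. -/
def BalTensor.tmul (m : M) (n : N) : BalTensor B M N := Submodule.Quotient.mk (n ⊗ₜ m)

end Balanced

/-! ## Corepresentations, partial isometries and projections -/

namespace QS4

variable (q : QParam)

/-- The `q²`-number `[n] = (1 - q^{2n}) / (1 - q²)`. -/
def qnum (n : ℕ) : ℝ := (1 - (q : ℝ) ^ (2 * n)) / (1 - (q : ℝ) ^ 2)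

/-- `[n]^{1/2}` as a complex number. -/
def qsqrt (n : ℕ) : ℂ := ((Real.sqrt (qnum q n) : ℝ) : ℂ)

theorem qsqrt_zero : qsqrt q 0 = 0 := by simp [qsqrt, qnum]

theorem qsqrt_one : qsqrt q 1 = 1 := by
  have : (1 - (q : ℝ) ^ 2) ≠ 0 := by
    have := q.2.1; have := q.2.2
    simp only [ne_eq, sub_eq_zero]; intro h; nlinarith
  simp [qsqrt, qnum, div_self this]

/-- The coefficient of `e_b ⊗ e_{k-b}` in the image of the basis vector `e_k` of `V_n` under the
isometric inclusion `V_n ⊂ V_1 ⊗ V_{n-1}` as the `q`-symmetric part: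
`e_k = [n]^{-1/2} (q^k [n-k]^{1/2} e_0 ⊗ e_k + [k]^{1/2} e_1 ⊗ e_{k-1})`. -/
def qsym (n : ℕ) (b : Fin 2) (k : ℕ) : ℂ :=
  (qsqrt q n)⁻¹ * ![q.c ^ k * qsqrt q (n - k), qsqrt q k] b

/-- Matrix elements of the irreducible corepresentation `V_n` of dimension `n + 1`, realized as the
`q`-symmetric part of `V_1 ⊗ V_{n-1}`. They vanish for indices larger than `n`. -/
def tcoef : ℕ → ℕ → ℕ → OSU2 q
  | 0, i, j => if i = 0 ∧ j = 0 then 1 else 0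
  | n + 1, i, j => ∑ b : Fin 2, ∑ c : Fin 2, (qsym q (n + 1) b i * qsym q (n + 1) c j) •
      (OSU2.t₁ q b c * tcoef n (i - b.1) (j - c.1))

/-- The unitary matrix `t_n` of the irreducible corepresentation `V_n`. -/
def tmat (n : ℕ) : Matrix (Fin (n + 1)) (Fin (n + 1)) (OSU2 q) := fun i j => tcoef q n i.1 j.1

/-- The recursion gives the fundamental matrix for `n = 1`. -/
theorem tmat_one : tmat q 1 = OSU2.t₁ q := by
  ext i j
  fin_cases i <;> fin_cases j <;>
    simp [tmat, tcoef, qsym, qsqrt_zero, qsqrt_one, Fin.sum_univ_two]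

/-- The bimodule `E_n = O(S^7_q) □ V_n`. -/
abbrev E (n : ℕ) : Submodule (OS4 q)ᵐᵒᵖ (Fin (n + 1) → OS7 q) := OS7.cotensor q (tmat q n)

/-- The bimodule `O(S^7_q) □ V_n^∨` of the dual comodule; since `t_n` is unitary, the matrix of the
dual is `S(t_n)^T`, with entries `(t_n i j)^*`. -/
abbrev Edual (n : ℕ) : Submodule (OS4 q)ᵐᵒᵖ (Fin (n + 1) → OS7 q) :=
  OS7.cotensor q ((tmat q n).map star)

/-- Entries of the `k`-th column of `U_n`, rows being indexed by multi-indices. -/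
def Ucol : (n : ℕ) → (Fin n → Fin 4) → ℕ → OS7 q
  | 0, _, k => if k = 0 then 1 else 0
  | n + 1, I, k => (qsqrt q (n + 1))⁻¹ •
      ((q.c ^ k * qsqrt q (n + 1 - k)) • (OS7.u q (I 0) 0 * Ucol n (fun l => I l.succ) k)
        + qsqrt q k • (OS7.u q (I 0) 1 * Ucol n (fun l => I l.succ) (k - 1)))

/-- The `4^n × (n+1)` matrix `U_n`. -/
def U (n : ℕ) : Matrix (Fin n → Fin 4) (Fin (n + 1)) (OS7 q) := fun I k => Ucol q n I k.1

/-- The recursion gives `U_1 = u`. -/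
theorem U_one (I : Fin 1 → Fin 4) (k : Fin 2) : U q 1 I k = OS7.u q (I 0) k := by
  fin_cases k <;> simp [U, Ucol, qsqrt_zero, qsqrt_one]

/-- The `4^{n+2} × (n+1)` matrix `W_n`. -/
def W (n : ℕ) : Matrix (Fin (n + 2) → Fin 4) (Fin (n + 1)) (OS7 q) := fun I k =>
  (qsqrt q (n + 2))⁻¹ •
    (qsqrt q (k.1 + 1) • (OS7.u q (I 0) 0 * Ucol q (n + 1) (fun l => I l.succ) (k.1 + 1))
      - (q.c ^ (k.1 + 1) * qsqrt q (n + 1 - k.1)) •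
        (OS7.u q (I 0) 1 * Ucol q (n + 1) (fun l => I l.succ) k.1))

/-- `P_n = U_n U_n^*`. -/
def P (n : ℕ) : Matrix (Fin n → Fin 4) (Fin n → Fin 4) (OS7 q) := U q n * (U q n).conjTranspose

/-- `Q_n = W_n W_n^*`. -/
def Q (n : ℕ) : Matrix (Fin (n + 2) → Fin 4) (Fin (n + 2) → Fin 4) (OS7 q) :=
  W q n * (W q n).conjTranspose

/-- The `4^{n+1} × 2(n+1)` matrix with columns `u^i • U_n^k`. -/
def Uprod (n : ℕ) : Matrix (Fin (n + 1) → Fin 4) (Fin 2 × Fin (n + 1)) (OS7 q) := fun I k =>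
  OS7.u q (I 0) k.1 * U q n (fun l => I l.succ) k.2

/-- The projection of a tensor product of modules, where `p` is the projection of the first one and
`(u', v')` is a trivializing pair of the second one: its entry in row `(j₁, j₂)` and column
`(k₁, k₂)` is `∑ i, u' j₂ i * p j₁ k₁ * v' i k₂`. -/
def tensorProj {A ι κ : Type*} [Ring A] {r : ℕ} (p : Matrix ι ι A) (u' : Matrix κ (Fin r) A)
    (v' : Matrix (Fin r) κ A) : Matrix (ι × κ) (ι × κ) A :=
  fun j k => ∑ i, u' j.2 i * p j.1 k.1 * v' i k.2

/-- The coefficient of `e_b ⊗ e_{k+1-b}` in the image of the basis vector `e_k` of `V_{n-1}` under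
the isometric inclusion `V_{n-1} ⊂ V_1 ⊗ V_n`, orthogonal to `V_{n+1}`. -/
def qasym (n : ℕ) (b : Fin 2) (k : ℕ) : ℂ :=
  (qsqrt q (n + 1))⁻¹ * ![qsqrt q (k + 1), -(q.c ^ (k + 1) * qsqrt q (n - k))] b

/-- The `V_{n+1}`-component of the product of families `a` and `b` indexed by the bases of `V_1` and
`V_n`. -/
def symPart {n : ℕ} (a : Fin 2 → OS7 q) (b : Fin (n + 1) → OS7 q) (k : Fin (n + 2)) : OS7 q :=
  ∑ i, ∑ l, if i.1 + l.1 = k.1 then qsym q (n + 1) i k.1 • (a i * b l) else 0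

/-- The `V_{n-1}`-component of the product of families `a` and `b` indexed by the bases of `V_1` and
`V_n`. -/
def asymPart {n : ℕ} (a : Fin 2 → OS7 q) (b : Fin (n + 1) → OS7 q) (k : Fin n) : OS7 q :=
  ∑ i, ∑ l, if i.1 + l.1 = k.1 + 1 then qasym q n i k.1 • (a i * b l) else 0

/-- The multi-index `(j_1, j_2)`, with `j_2` itself a multi-index. -/
def consIdx {n : ℕ} (j : Fin 4 × (Fin n → Fin 4)) : Fin (n + 1) → Fin 4 := Fin.cons j.1 j.2

/-- The right `O(S^4_q)`-module `p O(S^4_q)^ι`. -/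
def projModule {ι : Type} [Fintype ι] (p : Matrix ι ι (OS7 q)) :
    Submodule (OS4 q)ᵐᵒᵖ (ι → OS7 q) where
  carrier := {v | ∃ b : ι → OS4 q, v = p.mulVec (fun i => (b i : OS7 q))}
  add_mem' := by
    rintro _ _ ⟨b, rfl⟩ ⟨c, rfl⟩
    exact ⟨b + c, by rw [← Matrix.mulVec_add]; rfl⟩
  zero_mem' := ⟨0, (Matrix.mulVec_zero p).symm⟩
  smul_mem' := by
    rintro c _ ⟨b, rfl⟩
    refine ⟨fun i => b i * c.unop, funext fun i => ?_⟩
    change (∑ j, p i j * (b j : OS7 q)) * (c.unop : OS7 q)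
      = ∑ j, p i j * ((b j : OS7 q) * (c.unop : OS7 q))
    rw [Finset.sum_mul]
    simp only [mul_assoc]

end QS4

/-! ## The Chern number -/

section Trace

variable {𝓗 : Type*} [NormedAddCommGroup 𝓗] [InnerProductSpace ℂ 𝓗]

/-- `T` is of trace class: `T = ∑ ⟨y_k, ·⟩ z_k` with `∑ ‖y_k‖ ‖z_k‖ < ∞`. -/
def IsTraceClass (T : 𝓗 →L[ℂ] 𝓗) : Prop :=
  ∃ y z : ℕ → 𝓗, Summable (fun k => ‖y k‖ * ‖z k‖) ∧
    ∀ v, HasSum (fun k => inner ℂ (y k) v • z k) (T v)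

/-- `T` is of trace class with trace `t`, computed in the Hilbert basis `e`. -/
def HasTrace {ι : Type*} (e : HilbertBasis ι ℂ 𝓗) (T : 𝓗 →L[ℂ] 𝓗) (t : ℂ) : Prop :=
  IsTraceClass T ∧ HasSum (fun i => inner ℂ (e i) (T (e i))) t

end Trace

/-- `ℓ²(ℕ²)`. -/
abbrev L2 : Type := lp (fun _ : ℕ × ℕ => ℂ) 2

/-- The canonical orthonormal basis `|k₁, k₂⟩`. -/
def ketBasis : HilbertBasis (ℕ × ℕ) ℂ L2 := HilbertBasis.ofRepr (LinearIsometryEquiv.refl ℂ _)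

/-- The vector `|k₁, k₂⟩`. -/
def ket (k₁ k₂ : ℕ) : L2 := lp.single 2 (k₁, k₂) (1 : ℂ)

theorem ketBasis_apply (k₁ k₂ : ℕ) : ketBasis (k₁, k₂) = ket k₁ k₂ := by
  rw [← HilbertBasis.repr_symm_single]; rfl

/-- `π` is the bounded *-representation of `O(S^7_q)` on `ℓ²(ℕ²)` that on generators is
`x_1 ↦ 0`, `x_2 |k₁,k₂⟩ = q^{k₁+2k₂} |k₁,k₂⟩`,
`x_3 |k₁,k₂⟩ = q^{k₁} (1 - q^{4(k₂+1)})^{1/2} |k₁,k₂+1⟩`,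
`x_4 |k₁,k₂⟩ = (1 - q^{2(k₁+1)})^{1/2} |k₁+1,k₂⟩`. -/
structure IsRepPi (q : QParam) (π : OS7 q →⋆ₐ[ℂ] (L2 →L[ℂ] L2)) : Prop where
  x1 : π (OS7.x q 0) = 0
  x2 : ∀ k₁ k₂, π (OS7.x q 1) (ket k₁ k₂) = q.c ^ (k₁ + 2 * k₂) • ket k₁ k₂
  x3 : ∀ k₁ k₂, π (OS7.x q 2) (ket k₁ k₂)
    = (q.c ^ k₁ * ((Real.sqrt (1 - (q : ℝ) ^ (4 * (k₂ + 1))) : ℝ) : ℂ)) • ket k₁ (k₂ + 1)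
  x4 : ∀ k₁ k₂, π (OS7.x q 3) (ket k₁ k₂)
    = ((Real.sqrt (1 - (q : ℝ) ^ (2 * (k₁ + 1))) : ℝ) : ℂ) • ket (k₁ + 1) k₂

/-- The first Chern number of the class of `p` is `c`: the operator
`π(Tr p) - ε(Tr p)` is of trace class with trace `c`. -/
def HasCh1 (q : QParam) (π : OS7 q →⋆ₐ[ℂ] (L2 →L[ℂ] L2)) {ι : Type} [Fintype ι]
    (p : Matrix ι ι (OS7 q)) (c : ℂ) : Prop :=
  HasTrace ketBasis (π p.trace - OS7.counit q p.trace • 1) c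

end

open QS4

/-! ## The isometries `V_{n+1} → V_1 ⊗ V_n` and `V_{n-1} → V_1 ⊗ V_n` -/

noncomputable section

namespace QS4

variable (q : QParam)

/-! Let S (`symMat`) and A (`asymMat`) be the scalar matrices of V_{n+1} and V_{n-1} inside V_1 ⊗
V_n. Two facts carry the algebra: the block matrix (S | A) is unitary (`symMat_add_asymMat`,
`symMat_isometry`), and S, A intertwine t_1 ⊗ t_n with t_{n+1}, t_{n-1}
(`tmat_isometry_and_intertwine`, `kron_mul_asymMat'`).

The matrix u satisfies u^*u = 1 and its rows transform under t_1. With Uprod the matrix of products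
of entries of u and U_n, the recursions read U_{n+1} = Uprod S and W_{n-1} = Uprod A. So U and W
inherit orthonormal columns and covariant rows, the entries of P and Q are coinvariant because the
t_n are unitary, and P_{n+1} + Q_{n-1} = Uprod (SS^* + AA^*) Uprod^* = Uprod Uprod^*.

For the modules, U_n^* and U_n provide dual bases: a covariant vector is a combination of columns of
U_n^* with coefficients in B = O(S^4_q). Hence a balanced tensor product of cotensor products is the
space of covariant vectors for the tensor product corepresentation (`exists_balTensor_equiv`), which
Uprod identifies with the module of the projection. Rows of U_n pair directly with the dual
comodule; for E_n itself one inserts the isomorphism of V_n with its dual, of matrix (-q)^k on the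
antidiagonal (`star_tmat`).

For the Chern number, x_1 and x_2 are of trace class under π, and modulo them O(S^7_q) becomes
O(SU_q(2)), where coinvariant elements are scalars. So π(b) - ε(b) is of trace class on B, and its
trace τ is a tracial functional (`chTrace_mul_comm`). Applying τ to the trace of P_{m+2} + Q_m =
Uprod Uprod^*, with τ(Tr Q_m) = τ(Tr P_m) by equivalence of projections and τ(Tr P_1) = -1 by a
geometric series, gives the recursion f(m+2) = 2 f(m+1) - (m+2) - f(m), solved by -m(m+1)(m+2)/6. -/

theorem one_sub_sq_pos : 0 < 1 - (q : ℝ) ^ 2 := by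
  have := q.2.1; have := q.2.2
  nlinarith

theorem qnum_nonneg (n : ℕ) : 0 ≤ qnum q n :=
  div_nonneg (sub_nonneg.2 (pow_le_one₀ q.2.1.le q.2.2.le)) (one_sub_sq_pos q).le

theorem qnum_succ_pos (n : ℕ) : 0 < qnum q (n + 1) :=
  div_pos (sub_pos.2 (pow_lt_one₀ q.2.1.le q.2.2 (by omega))) (one_sub_sq_pos q)

/-- The only identity between q-numbers that is needed: it yields the diagonal entries of SS^* +
AA^*. -/
theorem qnum_add (a b : ℕ) : qnum q (a + b) = (q : ℝ) ^ (2 * a) * qnum q b + qnum q a := by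
  have := (one_sub_sq_pos q).ne'
  unfold qnum
  field_simp
  ring

theorem qsqrt_mul_self (n : ℕ) : qsqrt q n * qsqrt q n = (qnum q n : ℂ) := by
  rw [qsqrt, ← Complex.ofReal_mul, Real.mul_self_sqrt (qnum_nonneg q n)]

theorem qsqrt_succ_ne_zero (n : ℕ) : qsqrt q (n + 1) ≠ 0 :=
  Complex.ofReal_ne_zero.2 (Real.sqrt_ne_zero'.2 (qnum_succ_pos q n))

@[simp] theorem star_qsqrt (n : ℕ) : star (qsqrt q n) = qsqrt q n := Complex.conj_ofReal _

theorem star_qsym (n : ℕ) (b : Fin 2) (k : ℕ) : star (qsym q n b k) = qsym q n b k := by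
  fin_cases b <;> simp [qsym, -RCLike.star_def]

theorem star_qasym (n : ℕ) (b : Fin 2) (k : ℕ) : star (qasym q n b k) = qasym q n b k := by
  fin_cases b <;> simp [qasym, -RCLike.star_def]

/-- The matrix of the inclusion `V_{n+1} ⊂ V_1 ⊗ V_n`. -/
def symMat (n : ℕ) : Matrix (Fin 2 × Fin (n + 1)) (Fin (n + 2)) ℂ := fun i k =>
  if i.1.1 + i.2.1 = k.1 then qsym q (n + 1) i.1 k.1 else 0

/-- The matrix of the inclusion `V_{n-1} ⊂ V_1 ⊗ V_n`. -/
def asymMat (n : ℕ) : Matrix (Fin 2 × Fin (n + 1)) (Fin n) ℂ := fun i k =>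
  if i.1.1 + i.2.1 = k.1 + 1 then qasym q n i.1 k.1 else 0

theorem qsym_one_zero (n : ℕ) : qsym q n 1 0 = 0 := by simp [qsym, qsqrt_zero]

theorem qsym_zero_self (n : ℕ) : qsym q n 0 n = 0 := by simp [qsym, qsqrt_zero]

/-- Only `l = k - b` contributes. Where this is not an admissible index (`b = 1`, `k = 0`, where
subtraction truncates, or `b = 0`, `k = n + 1`) the coefficient `qsym` vanishes, so no case
distinction survives. -/
theorem sum_symMat_smul {M : Type*} [AddCommGroup M] [Module ℂ M] (n : ℕ) (f : ℕ → M)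
    (b : Fin 2) (k : Fin (n + 2)) :
    ∑ l : Fin (n + 1), symMat q n (b, l) k • f l.1 = qsym q (n + 1) b k.1 • f (k.1 - b.1) := by
  by_cases h : b.1 ≤ k.1 ∧ k.1 - b.1 < n + 1
  · rw [Finset.sum_eq_single (⟨k.1 - b.1, h.2⟩ : Fin (n + 1))]
    · rw [symMat, if_pos (by simp only []; omega)]
    · intro l _ hl
      rw [symMat, if_neg, zero_smul]
      intro h'
      exact hl (Fin.ext (by simp only [] at h' ⊢; omega))
    · simp
  · have h0 : qsym q (n + 1) b k.1 = 0 := by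
      have hk := k.2
      have hb := b.2
      by_cases hb1 : b.1 = 1
      · have hk0 : k.1 = 0 := by omega
        rw [hk0, show b = 1 from Fin.ext hb1, qsym_one_zero]
      · have hk0 : k.1 = n + 1 := by omega
        rw [hk0, show b = 0 from Fin.ext (by simp; omega), qsym_zero_self]
    rw [h0, zero_smul]
    refine Finset.sum_eq_zero fun l _ => ?_
    rw [symMat]
    split_ifs <;> simp [h0]

theorem sum_asymMat_smul {M : Type*} [AddCommGroup M] [Module ℂ M] (n : ℕ) (f : ℕ → M)
    (b : Fin 2) (k : Fin n) :
    ∑ l : Fin (n + 1), asymMat q n (b, l) k • f l.1 = qasym q n b k.1 • f (k.1 + 1 - b.1) := by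
  rw [Finset.sum_eq_single (⟨k.1 + 1 - b.1, by omega⟩ : Fin (n + 1))]
  · rw [asymMat, if_pos (by simp only []; omega)]
  · intro l _ hl
    rw [asymMat, if_neg, zero_smul]
    intro h'
    exact hl (Fin.ext (by simp only [] at h' ⊢; omega))
  · simp

theorem sum_symMat_smul_right {M : Type*} [AddCommGroup M] [Module ℂ M] (n : ℕ)
    (f : Fin (n + 2) → M) (i : Fin 2 × Fin (n + 1)) :
    ∑ k, symMat q n i k • f k = qsym q (n + 1) i.1 (i.1.1 + i.2.1) •
      f ⟨i.1.1 + i.2.1, by omega⟩ := by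
  rw [Finset.sum_eq_single (⟨i.1.1 + i.2.1, by omega⟩ : Fin (n + 2))]
  · rw [symMat, if_pos rfl]
  · intro l _ hl
    rw [symMat, if_neg, zero_smul]
    intro h'
    exact hl (Fin.ext h'.symm)
  · simp

/-- The copy of V_{n-1} misses the extreme degrees 0 and n + 1 of V_1 ⊗ V_n, whence the case
distinction. -/
theorem sum_asymMat_smul_right {M : Type*} [AddCommGroup M] [Module ℂ M] (n : ℕ)
    (f : ℕ → M) (i : Fin 2 × Fin (n + 1)) :
    ∑ k : Fin n, asymMat q n i k • f k.1 =
      if i.1.1 + i.2.1 = 0 ∨ i.1.1 + i.2.1 = n + 1 then 0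
      else qasym q n i.1 (i.1.1 + i.2.1 - 1) • f (i.1.1 + i.2.1 - 1) := by
  have h1 := i.1.2
  have h2 := i.2.2
  split_ifs with h
  · refine Finset.sum_eq_zero fun k _ => ?_
    rw [asymMat, if_neg (by omega), zero_smul]
  · rw [Finset.sum_eq_single (⟨i.1.1 + i.2.1 - 1, by omega⟩ : Fin n)]
    · rw [asymMat, if_pos (by simp only []; omega)]
    · intro l _ hl
      rw [asymMat, if_neg, zero_smul]
      intro h'
      exact hl (Fin.ext (by simp only []; omega))
    · simp

/-- Both inclusions preserve the degree b + l up to the shift by one, so only entries of equal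
degree matter. The off-diagonal ones cancel between S and A; the diagonal ones are `qnum_add`. In
the extreme degrees S alone gives 1. -/
theorem symMat_add_asymMat (n : ℕ) :
    symMat q n * (symMat q n).conjTranspose + asymMat q n * (asymMat q n).conjTranspose = 1 := by
  have hn := qsqrt_succ_ne_zero q n
  have hnn := qsqrt_mul_self q (n + 1)
  ext ⟨b, l⟩ ⟨c, m⟩
  have hA : ∀ k : Fin n, star (asymMat q n (c, m) k) =
      (fun k : ℕ => if c.1 + m.1 = k + 1 then qasym q n c k else 0) k.1 := by
    intro k
    simp only [asymMat]
    split_ifs <;> simp [star_qasym, -RCLike.star_def]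
  have hS : ∀ k : Fin (n + 2), star (symMat q n (c, m) k) =
      if c.1 + m.1 = k.1 then qsym q (n + 1) c k.1 else 0 := by
    intro k
    simp only [symMat]
    split_ifs <;> simp [star_qsym, -RCLike.star_def]
  simp only [Matrix.add_apply, Matrix.mul_apply, Matrix.conjTranspose_apply, hA, hS]
  simp only [← smul_eq_mul]
  rw [sum_symMat_smul_right q n (fun k => if c.1 + m.1 = k.1 then qsym q (n + 1) c k.1 else 0),
    sum_asymMat_smul_right q n (fun k => if c.1 + m.1 = k + 1 then qasym q n c k else 0)]
  simp only [Matrix.one_apply, Prod.mk.injEq, smul_eq_mul]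
  have hl := l.2
  have hm := m.2
  have hadd := fun a b => congrArg (fun x : ℝ => (x : ℂ)) (qnum_add q a b)
  simp only [Complex.ofReal_add, Complex.ofReal_mul, Complex.ofReal_pow] at hadd
  have hqc : ((q : ℝ) : ℂ) = q.c := rfl
  by_cases h : c.1 + m.1 = b.1 + l.1
  · rw [if_pos h]
    fin_cases b <;> fin_cases c <;> simp [qsym, qasym] at h ⊢
    · obtain rfl : m = l := Fin.ext h
      have h3 := hadd m.1 (n + 1 - m.1)
      rw [show m.1 + (n + 1 - m.1) = n + 1 by omega, ← hnn, ← qsqrt_mul_self, ← qsqrt_mul_self, hqc]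
        at h3
      rw [if_pos rfl]
      by_cases h0 : (m : ℕ) = 0
      · rw [if_pos (Or.inl (Fin.ext h0)), h0, Nat.sub_zero]
        field_simp
        simp
      · rw [if_neg (by simp only [Fin.ext_iff, Fin.val_zero]; omega),
          Nat.sub_add_cancel (by omega), if_pos rfl]
        field_simp
        linear_combination -h3
    · rw [if_neg (by simp only [Fin.ext_iff, Fin.val_zero]; omega), if_pos (by omega), ← h,
        show n - (1 + m.1 - 1) = n + 1 - (1 + m.1) by omega, Nat.sub_add_cancel (by omega)]
      ring
    · rw [if_neg (by omega), h, if_pos (by omega), add_comm 1 l.1,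
        show n + 1 - (l.1 + 1) = n - l.1 by omega]
      ring
    · obtain rfl : m = l := Fin.ext h
      have h3 := hadd (m.1 + 1) (n - m.1)
      rw [show m.1 + 1 + (n - m.1) = n + 1 by omega, ← hnn, ← qsqrt_mul_self, ← qsqrt_mul_self, hqc]
        at h3
      rw [if_pos rfl]
      by_cases h0 : 1 + (m : ℕ) = n + 1
      · rw [if_pos h0, h0]
        field_simp
        simp
      · rw [if_neg h0, if_pos (by omega), add_comm 1 m.1]
        field_simp
        linear_combination -h3
  · have hbc : ¬(b = c ∧ l = m) := fun h' => h (by rw [h'.1, h'.2])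
    rw [if_neg h, if_neg hbc, mul_zero, zero_add]
    split_ifs with h1 h2
    · rfl
    · omega
    · simp

/-- Since 2(n + 1) = (n + 2) + n, the matrix (S | A) is square and its right inverse is also a left
inverse; the blocks of that identity are the three relations. -/
theorem symMat_isometry (n : ℕ) :
    (symMat q n).conjTranspose * symMat q n = 1 ∧ (asymMat q n).conjTranspose * asymMat q n = 1 ∧
    (symMat q n).conjTranspose * asymMat q n = 0 := by
  have h : (Matrix.fromCols (symMat q n) (asymMat q n)) *
      (Matrix.fromRows (symMat q n).conjTranspose (asymMat q n).conjTranspose) = 1 := by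
    rw [Matrix.fromCols_mul_fromRows, symMat_add_asymMat]
  have h' := (Matrix.mul_eq_one_comm_of_card_eq _ _ _
    (by simp only [Fintype.card_prod, Fintype.card_sum, Fintype.card_fin]; omega)).1 h
  rw [Matrix.fromRows_mul_fromCols, ← Matrix.fromBlocks_one, Matrix.fromBlocks_inj] at h'
  exact ⟨h'.1, h'.2.2.2, h'.2.1⟩

end QS4

end

noncomputable section

/-! ## Matrices over a noncommutative algebra -/

namespace Matrix

variable {R : Type*} [Ring R] {m n p r k l : Type*}

section
variable [Algebra ℂ R]

/-- A scalar matrix as a matrix over an algebra. -/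
def emb (R : Type*) [Ring R] [Algebra ℂ R] (M : Matrix m n ℂ) : Matrix m n R :=
  M.map (algebraMap ℂ R)

@[simp] theorem emb_apply (M : Matrix m n ℂ) (i : m) (j : n) :
    emb R M i j = algebraMap ℂ R (M i j) := rfl

theorem emb_mul [Fintype n] (M : Matrix m n ℂ) (N : Matrix n p ℂ) :
    emb R (M * N) = emb R M * emb R N := Matrix.map_mul

theorem emb_add (M N : Matrix m n ℂ) : emb R (M + N) = emb R M + emb R N :=
  Matrix.map_add _ (map_add _) M N

theorem emb_one [DecidableEq n] : emb R (1 : Matrix n n ℂ) = 1 :=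
  Matrix.map_one _ (map_zero _) (map_one _)

theorem emb_zero : emb R (0 : Matrix m n ℂ) = 0 := Matrix.map_zero _ (map_zero _)

theorem emb_conjTranspose [StarRing R] [StarModule ℂ R] (M : Matrix m n ℂ) :
    emb R M.conjTranspose = (emb R M).conjTranspose := by
  ext i j
  simp only [emb_apply, conjTranspose_apply, algebraMap_star_comm]

end

/-- The Kronecker product over a possibly noncommutative ring. -/
def kron (A : Matrix m n R) (B : Matrix p r R) : Matrix (m × p) (n × r) R :=
  Matrix.of fun i j => A i.1 j.1 * B i.2 j.2

@[simp] theorem kron_apply (A : Matrix m n R) (B : Matrix p r R) (i : m × p) (j : n × r) :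
    kron A B i j = A i.1 j.1 * B i.2 j.2 := rfl

/-- Over a noncommutative ring `kron` is not multiplicative, but here the factors of `A` sit next to
each other, so their sum collapses to 0 or 1 before those of `B` are summed. -/
theorem kron_conjTranspose_mul_kron [StarRing R] [Fintype m] [Fintype p] [DecidableEq n]
    [DecidableEq r] {A : Matrix m n R} {B : Matrix p r R} (hA : A.conjTranspose * A = 1)
    (hB : B.conjTranspose * B = 1) : (kron A B).conjTranspose * kron A B = 1 := by
  ext ⟨i, k⟩ ⟨j, l⟩
  have h1 := congrFun (congrFun hA i) j
  have h2 := congrFun (congrFun hB k) l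
  simp only [mul_apply, conjTranspose_apply] at h1 h2
  simp only [mul_apply, conjTranspose_apply, kron_apply, star_mul, Fintype.sum_prod_type]
  rw [Finset.sum_comm]
  calc ∑ y, ∑ x, star (B y k) * star (A x i) * (A x j * B y l)
      = ∑ y, star (B y k) * (∑ x, star (A x i) * A x j) * B y l := by
        simp only [Finset.mul_sum, Finset.sum_mul, mul_assoc]
    _ = _ := by
        rw [h1]
        by_cases hij : i = j
        · subst hij
          simp only [one_apply_eq, mul_one, h2]
          simp [one_apply]
        · simp [hij]

theorem kron_mul_kron_conjTranspose [StarRing R] [Fintype n] [Fintype r] [DecidableEq m]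
    [DecidableEq p] {A : Matrix m n R} {B : Matrix p r R} (hA : A * A.conjTranspose = 1)
    (hB : B * B.conjTranspose = 1) : kron A B * (kron A B).conjTranspose = 1 := by
  ext ⟨i, k⟩ ⟨j, l⟩
  have h1 := congrFun (congrFun hA i) j
  have h2 := congrFun (congrFun hB k) l
  simp only [mul_apply, conjTranspose_apply] at h1 h2
  simp only [mul_apply, conjTranspose_apply, kron_apply, star_mul, Fintype.sum_prod_type]
  calc ∑ x, ∑ y, A i x * B k y * (star (B l y) * star (A j x))
      = ∑ x, A i x * (∑ y, B k y * star (B l y)) * star (A j x) := by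
        simp only [Finset.mul_sum, Finset.sum_mul, mul_assoc]
    _ = _ := by
        rw [h2]
        by_cases hkl : k = l
        · subst hkl
          simp only [one_apply_eq, mul_one, h1]
          simp [one_apply]
        · simp [hkl]

/-- Adjoints of intertwiners of unitaries are intertwiners: take the adjoint of `h` and move `K` and
`T` across. -/
theorem conjTranspose_intertwine [StarRing R] [Fintype m] [Fintype n] [DecidableEq m]
    [DecidableEq n] {K : Matrix m m R} {S : Matrix m n R} {T : Matrix n n R} (h : K * S = S * T)
    (hT : T * T.conjTranspose = 1) (hK : K.conjTranspose * K = 1) :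
    S.conjTranspose * K = T * S.conjTranspose := by
  have h1 := congrArg conjTranspose h
  rw [conjTranspose_mul, conjTranspose_mul] at h1
  calc _ = T * (T.conjTranspose * S.conjTranspose) * K := by
        rw [← Matrix.mul_assoc T, hT, Matrix.one_mul]
    _ = _ := by rw [← h1, Matrix.mul_assoc, Matrix.mul_assoc, hK, Matrix.mul_one]

end Matrix

/-! ## The corepresentation matrices -/

namespace OSU2

variable (q : QParam)

theorem t₁_mul_conjTranspose : t₁ q * (t₁ q).conjTranspose = 1 := by
  ext i j
  have h1 := α_mul_star_γ q
  have h2 := γ_mul_star_α q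
  fin_cases i <;> fin_cases j <;>
    simp [t₁, SUq2.fund, Matrix.mul_apply, Fin.sum_univ_two, α_mul_star_α, star_α_mul_α,
      star_γ_mul_γ, α_mul_star_γ, γ_mul_star_α, smul_smul, ← pow_two]

theorem t₁_conjTranspose_mul : (t₁ q).conjTranspose * t₁ q = 1 := by
  ext i j
  fin_cases i <;> fin_cases j <;>
    simp [t₁, SUq2.fund, Matrix.mul_apply, Fin.sum_univ_two, α_mul_star_α, star_α_mul_α,
      star_γ_mul_γ, star_γ_mul_star_α, α_mul_γ, smul_smul, ← pow_two]

end OSU2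

namespace QS4

variable (q : QParam)

open Matrix

theorem tmat_zero_eq_one : tmat q 0 = 1 := by
  ext i j
  fin_cases i; fin_cases j
  simp [tmat, tcoef]

theorem tmat_succ (n : ℕ) : tmat q (n + 1) =
    (emb (OSU2 q) (symMat q n)).conjTranspose * kron (OSU2.t₁ q) (tmat q n) *
      emb (OSU2 q) (symMat q n) := by
  ext i j
  have hstar : ∀ x k, star (symMat q n x k) = symMat q n x k := fun x k => by
    simp only [symMat]
    split_ifs
    · exact star_qsym _ _ _ _
    · exact star_zero _
  simp only [mul_apply, ← emb_conjTranspose, emb_apply, conjTranspose_apply, hstar, kron_apply,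
    ← Algebra.commutes, ← Algebra.smul_def, Fintype.sum_prod_type]
  have h1 : ∀ c m, ∑ b, ∑ l, symMat q n (b, l) i • (OSU2.t₁ q b c * tmat q n l m) =
      ∑ b, qsym q (n + 1) b i.1 • (OSU2.t₁ q b c * tcoef q n (i.1 - b.1) m.1) := fun c m =>
    Finset.sum_congr rfl fun b _ =>
      sum_symMat_smul q n (fun l => OSU2.t₁ q b c * tcoef q n l m.1) b i
  simp only [h1]
  have h2 : ∀ c, ∑ m, symMat q n (c, m) j •
      ∑ b, qsym q (n + 1) b i.1 • (OSU2.t₁ q b c * tcoef q n (i.1 - b.1) m.1) =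
      qsym q (n + 1) c j.1 •
      ∑ b, qsym q (n + 1) b i.1 • (OSU2.t₁ q b c * tcoef q n (i.1 - b.1) (j.1 - c.1)) := fun c =>
    sum_symMat_smul q n (fun m => 
      ∑ b, qsym q (n + 1) b i.1 • (OSU2.t₁ q b c * tcoef q n (i.1 - b.1) m)) c j
  simp only [h2]
  change tcoef q (n + 1) i.1 j.1 = _
  rw [tcoef, Finset.sum_comm]
  simp only [Finset.smul_sum, smul_smul, mul_comm]

/-- The quantum determinant relation: the vector e_0 ⊗ e_1 - q e_1 ⊗ e_0 of V_1 ⊗ V_1 is invariant,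
and the scalar matrix lists its coefficients. -/
theorem fund_quadratic (a e : Fin 2) : OSU2.t₁ q a 0 * OSU2.t₁ q e 1 =
    q.c • (OSU2.t₁ q a 1 * OSU2.t₁ q e 0) +
      algebraMap ℂ (OSU2 q) ((!![0, 1; -q.c, 0] : Matrix (Fin 2) (Fin 2) ℂ) a e) := by
  fin_cases a <;> fin_cases e <;>
    simp [OSU2.t₁, SUq2.fund, OSU2.α_mul_star_α, OSU2.star_α_mul_α,
      OSU2.star_γ_mul_γ, OSU2.α_mul_star_γ, OSU2.γ_mul_star_α, smul_smul, ← pow_two,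
      Algebra.algebraMap_eq_smul_one, sub_eq_neg_add]

/-- Up to a constant, the inclusion of V_m in V_1 ⊗ V_{m+1} factors as V_m → V_1 ⊗ V_1 ⊗ V_m → V_1 ⊗
V_{m+1}, where the first map inserts the invariant vector of `fund_quadratic` and the second applies
S^* to the last two factors. It is therefore an intertwiner once S^* is one, which is the
hypothesis. -/
theorem kron_mul_asymMat (m : ℕ)
    (h : tmat q (m + 1) * (emb (OSU2 q) (symMat q m)).conjTranspose =
      (emb (OSU2 q) (symMat q m)).conjTranspose * kron (OSU2.t₁ q) (tmat q m)) :
    kron (OSU2.t₁ q) (tmat q (m + 1)) * emb (OSU2 q) (asymMat q (m + 1)) =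
      emb (OSU2 q) (asymMat q (m + 1)) * tmat q m := by
  have hstar : ∀ x k, star (symMat q m x k) = symMat q m x k := fun x k => by
    simp only [symMat]
    split_ifs
    · exact star_qsym _ _ _ _
    · exact star_zero _
  ext ⟨a, p⟩ k
  have hX : ∀ d : Fin 2, qsym q (m + 1) d (d.1 + k.1) • tcoef q (m + 1) p.1 (d.1 + k.1) =
      ∑ e, qsym q (m + 1) e p.1 • (OSU2.t₁ q e d * tcoef q m (p.1 - e.1) k.1) := by
    intro d
    have h1 := congrFun (congrFun h p) (d, k)
    simp only [mul_apply, ← emb_conjTranspose, emb_apply, conjTranspose_apply, hstar, kron_apply,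
      ← Algebra.commutes, ← Algebra.smul_def, Fintype.sum_prod_type] at h1
    rw [sum_symMat_smul_right q m (fun r => tmat q (m + 1) p r) (d, k)] at h1
    refine h1.trans (Finset.sum_congr rfl fun e _ => ?_)
    exact sum_symMat_smul q m (fun l => OSU2.t₁ q e d * tcoef q m l k.1) e p
  simp only [mul_apply, emb_apply, kron_apply,
    ← Algebra.commutes, ← Algebra.smul_def, Fintype.sum_prod_type]
  have h2 : ∀ b : Fin 2, ∑ l, asymMat q (m + 1) (b, l) k • (OSU2.t₁ q a b * tmat q (m + 1) p l) =
      qasym q (m + 1) b k.1 • (OSU2.t₁ q a b * tcoef q (m + 1) p.1 (k.1 + 1 - b.1)) := fun b =>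
    sum_asymMat_smul q (m + 1) (fun l => OSU2.t₁ q a b * tcoef q (m + 1) p.1 l) b k
  simp only [h2]
  have h3 := sum_asymMat_smul_right q (m + 1) (fun l => tcoef q m l k.1) (a, p)
  refine Eq.trans ?_ h3.symm
  have hN := qsqrt_succ_ne_zero q (m + 1)
  have hM := qsqrt_succ_ne_zero q m
  have h0 := hX 0
  have h1 := hX 1
  -- `e0` and `e1` express this factorization on coefficients, with common constant [m+2]^{-1/2}
  -- [m+1]^{1/2}; the factors 1 and -q come from the invariant vector.
  have e0 : ∀ X Y : OSU2 q, qasym q (m + 1) 0 k.1 • (X * Y) =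
      ((qsqrt q (m + 2))⁻¹ * qsqrt q (m + 1)) • (X * (qsym q (m + 1) 1 (k.1 + 1) • Y)) :=
    fun X Y => by
      rw [mul_smul_comm, smul_smul]; congr 1
      simp only [qasym, qsym, Matrix.cons_val]
      field_simp
  have e1 : ∀ X Y : OSU2 q, qasym q (m + 1) 1 k.1 • (X * Y) =
      ((qsqrt q (m + 2))⁻¹ * qsqrt q (m + 1)) • ((-q.c) • (X * (qsym q (m + 1) 0 k.1 • Y))) :=
    fun X Y => by
      rw [mul_smul_comm, smul_smul, smul_smul]; congr 1
      simp only [qasym, qsym, Matrix.cons_val]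
      field_simp
      ring
  rw [Fin.sum_univ_two, e0, e1]
  simp only [Fin.val_zero, Fin.val_one, Nat.sub_zero, Nat.add_sub_cancel, zero_add,
    add_comm 1 k.1] at h0 h1 ⊢
  rw [h0, h1]
  simp only [Fin.sum_univ_two, mul_add, mul_smul_comm, ← mul_assoc, fund_quadratic q a]
  have hp := p.2
  fin_cases a
  · simp only [Fin.zero_eta, Fin.val_zero, zero_add, Fin.isValue, Matrix.cons_val', of_apply,
      Matrix.cons_val, map_zero, map_one, add_zero, add_mul, one_mul, Fin.val_one]
    -- In the extreme degree, where V_m has no vector, the coefficient `qsym` left by the invariant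
    -- vector is zero as well; the same happens for `a = 1` below.
    split_ifs with hc
    · have : p.1 = 0 := by omega
      rw [this, qsym_one_zero]
      simp only [zero_smul, smul_mul_assoc]
      module
    · have hq : qasym q (m + 1) 0 (p.1 - 1) =
          ((qsqrt q (m + 2))⁻¹ * qsqrt q (m + 1)) * qsym q (m + 1) 1 p.1 := by
        simp only [qasym, qsym, Matrix.cons_val, Nat.sub_add_cancel (show 1 ≤ p.1 by omega)]
        field_simp
      rw [hq]
      simp only [smul_mul_assoc]
      module
  · simp only [Fin.mk_one, Fin.val_zero, Fin.isValue, Matrix.cons_val', of_apply,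
      Matrix.cons_val, map_zero, add_zero, add_mul, Fin.val_one]
    simp only [← Algebra.smul_def, Nat.sub_zero]
    split_ifs with hc
    · have : p.1 = m + 1 := by omega
      rw [this, qsym_zero_self]
      simp only [zero_smul, smul_mul_assoc]
      module
    · have hq : qasym q (m + 1) 1 (1 + p.1 - 1) =
          ((qsqrt q (m + 2))⁻¹ * qsqrt q (m + 1)) * (-q.c * qsym q (m + 1) 0 p.1) := by
        simp only [qasym, qsym, Matrix.cons_val, Nat.add_sub_cancel_left]
        field_simp
        ring
      rw [hq, Nat.add_sub_cancel_left]
      simp only [smul_mul_assoc]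
      module

/-- The matrix t_{n+1} is the compression S^*KS of the unitary K = t_1 ⊗ t_n. It is unitary, and S
intertwines, as soon as SS^* commutes with K. As SS^* = 1 - AA^*, it suffices that A intertwines,
which `kron_mul_asymMat` derives from the intertwining one level below. The induction thus has to
carry unitarity at two consecutive levels together with the intertwining relation. -/
theorem tmat_isometry_and_intertwine (n : ℕ) :
    (tmat q n * (tmat q n).conjTranspose = 1 ∧ (tmat q n).conjTranspose * tmat q n = 1) ∧
    (tmat q (n + 1) * (tmat q (n + 1)).conjTranspose = 1 ∧
      (tmat q (n + 1)).conjTranspose * tmat q (n + 1) = 1) ∧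
    kron (OSU2.t₁ q) (tmat q n) * emb (OSU2 q) (symMat q n) =
      emb (OSU2 q) (symMat q n) * tmat q (n + 1) := by
  set_option maxRecDepth 2000 in
  have key : ∀ n, (tmat q n * (tmat q n).conjTranspose = 1 ∧
      (tmat q n).conjTranspose * tmat q n = 1) → 
      (kron (OSU2.t₁ q) (tmat q n) *
        (emb (OSU2 q) (symMat q n) * (emb (OSU2 q) (symMat q n)).conjTranspose) =
      (emb (OSU2 q) (symMat q n) * (emb (OSU2 q) (symMat q n)).conjTranspose) *
        kron (OSU2.t₁ q) (tmat q n)) → 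
      (tmat q (n + 1) * (tmat q (n + 1)).conjTranspose = 1 ∧
        (tmat q (n + 1)).conjTranspose * tmat q (n + 1) = 1) ∧
      kron (OSU2.t₁ q) (tmat q n) * emb (OSU2 q) (symMat q n) =
        emb (OSU2 q) (symMat q n) * tmat q (n + 1) := by
    intro n hu hc
    have hK1 := kron_mul_kron_conjTranspose (OSU2.t₁_mul_conjTranspose q) hu.1
    have hK2 := kron_conjTranspose_mul_kron (OSU2.t₁_conjTranspose_mul q) hu.2
    have hS : (emb (OSU2 q) (symMat q n)).conjTranspose * emb (OSU2 q) (symMat q n) = 1 := by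
      rw [← emb_conjTranspose, ← emb_mul, (symMat_isometry q n).1, emb_one]
    rw [tmat_succ]
    generalize emb (OSU2 q) (symMat q n) = S at *
    generalize kron (OSU2.t₁ q) (tmat q n) = K at *
    have hi : K * S = S * (Sᴴ * K * S) := by
      calc K * S = K * (S * Sᴴ) * S := by
            rw [Matrix.mul_assoc, Matrix.mul_assoc S, hS, Matrix.mul_one]
        _ = _ := by rw [hc]; simp only [Matrix.mul_assoc]
    refine ⟨⟨?_, ?_⟩, hi⟩
    · calc Sᴴ * K * S * (Sᴴ * K * S)ᴴ = Sᴴ * (K * (S * Sᴴ)) * Kᴴ * S := by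
            simp only [conjTranspose_mul, conjTranspose_conjTranspose, Matrix.mul_assoc]
        _ = (Sᴴ * S) * Sᴴ * (K * Kᴴ) * S := by
            rw [hc]; simp only [Matrix.mul_assoc]
        _ = 1 := by rw [hS, hK1, Matrix.one_mul, Matrix.mul_one, hS]
    · calc (Sᴴ * K * S)ᴴ * (Sᴴ * K * S) = Sᴴ * Kᴴ * (S * (Sᴴ * K * S)) := by
            simp only [conjTranspose_mul, conjTranspose_conjTranspose, Matrix.mul_assoc]
        _ = Sᴴ * (Kᴴ * K) * S := by
            rw [← hi]; simp only [Matrix.mul_assoc]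
        _ = 1 := by rw [hK2, Matrix.mul_one, hS]
  have hSA : ∀ n, emb (OSU2 q) (symMat q n) * (emb (OSU2 q) (symMat q n)).conjTranspose =
      1 - emb (OSU2 q) (asymMat q n) * (emb (OSU2 q) (asymMat q n)).conjTranspose := by
    intro n
    rw [eq_sub_iff_add_eq, ← emb_conjTranspose, ← emb_conjTranspose, ← emb_mul, ← emb_mul,
      ← emb_add, symMat_add_asymMat, emb_one]
  induction n with
  | zero =>
    have h0 : tmat q 0 * (tmat q 0)ᴴ = 1 ∧ (tmat q 0)ᴴ * tmat q 0 = 1 := by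
      simp [tmat_zero_eq_one]
    refine ⟨h0, key 0 h0 ?_⟩
    -- For n = 0 the matrix A has no columns.
    have hA : emb (OSU2 q) (asymMat q 0) * (emb (OSU2 q) (asymMat q 0)).conjTranspose = 0 := by
      ext; simp [mul_apply]
    rw [hSA, hA, sub_zero, Matrix.mul_one, Matrix.one_mul]
  | succ m ih =>
    obtain ⟨hm, hm1, hi⟩ := ih
    refine ⟨hm1, key (m + 1) hm1 ?_⟩
    have hK := fun n h => kron_conjTranspose_mul_kron (OSU2.t₁_conjTranspose_mul q)
      (B := tmat q n) h
    have hKA := kron_mul_asymMat q m (conjTranspose_intertwine hi hm1.1 (hK m hm.2)).symm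
    have hAK := conjTranspose_intertwine hKA hm.1 (hK _ hm1.2)
    -- Commutation with AA^*: both K A A^* and A A^* K equal A t_m A^*.
    rw [hSA, mul_sub, sub_mul, Matrix.mul_one, Matrix.one_mul, ← Matrix.mul_assoc, hKA,
      Matrix.mul_assoc, ← hAK, Matrix.mul_assoc]

theorem tmat_mul_conjTranspose (n : ℕ) : tmat q n * (tmat q n).conjTranspose = 1 :=
  (tmat_isometry_and_intertwine q n).1.1

theorem tmat_conjTranspose_mul (n : ℕ) : (tmat q n).conjTranspose * tmat q n = 1 :=
  (tmat_isometry_and_intertwine q n).1.2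

theorem kron_mul_symMat (n : ℕ) : kron (OSU2.t₁ q) (tmat q n) * emb (OSU2 q) (symMat q n) =
      emb (OSU2 q) (symMat q n) * tmat q (n + 1) :=
  (tmat_isometry_and_intertwine q n).2.2

theorem kron_tmat_mul_conjTranspose (n : ℕ) :
    kron (OSU2.t₁ q) (tmat q n) * (kron (OSU2.t₁ q) (tmat q n)).conjTranspose = 1 :=
  kron_mul_kron_conjTranspose (OSU2.t₁_mul_conjTranspose q) (tmat_mul_conjTranspose q n)

theorem kron_tmat_conjTranspose_mul (n : ℕ) :
    (kron (OSU2.t₁ q) (tmat q n)).conjTranspose * kron (OSU2.t₁ q) (tmat q n) = 1 :=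
  kron_conjTranspose_mul_kron (OSU2.t₁_conjTranspose_mul q) (tmat_conjTranspose_mul q n)

theorem symMat_mul_kron (n : ℕ) :
    (emb (OSU2 q) (symMat q n)).conjTranspose * kron (OSU2.t₁ q) (tmat q n) =
      tmat q (n + 1) * (emb (OSU2 q) (symMat q n)).conjTranspose :=
  conjTranspose_intertwine (kron_mul_symMat q n) (tmat_mul_conjTranspose q _)
    (kron_tmat_conjTranspose_mul q n)

theorem kron_mul_asymMat' (m : ℕ) :
    kron (OSU2.t₁ q) (tmat q (m + 1)) * emb (OSU2 q) (asymMat q (m + 1)) =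
      emb (OSU2 q) (asymMat q (m + 1)) * tmat q m :=
  kron_mul_asymMat q m (symMat_mul_kron q m).symm

theorem asymMat_mul_kron (m : ℕ) :
    (emb (OSU2 q) (asymMat q (m + 1))).conjTranspose * kron (OSU2.t₁ q) (tmat q (m + 1)) =
      tmat q m * (emb (OSU2 q) (asymMat q (m + 1))).conjTranspose :=
  conjTranspose_intertwine (kron_mul_asymMat' q m) (tmat_mul_conjTranspose q _)
    (kron_tmat_conjTranspose_mul q _)

/-! ## The conjugate corepresentations -/

/-- The coefficient of `e_{k-b} ⊗ e_b` in the image of `e_k` under `V_n ⊂ V_{n-1} ⊗ V_1`. -/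
def qsymRight (n : ℕ) (b : Fin 2) (k : ℕ) : ℂ :=
  (qsqrt q n)⁻¹ * ![qsqrt q (n - k), q.c ^ (n - k) * qsqrt q k] b

/-- Both sides are the coefficient of e_b ⊗ e_{i-b-d} ⊗ e_d under V_{n+2} ⊂ V_1 ⊗ V_n ⊗ V_1,
splitting off the left or the right factor first. -/
theorem qsym_mul_qsymRight (n : ℕ) (b d : Fin 2) {i : ℕ} (hi : i ≤ n + 2) :
    qsym q (n + 2) b i * qsymRight q (n + 1) d (i - b) =
      qsymRight q (n + 2) d i * qsym q (n + 1) b (i - d) := by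
  have h0 := qsqrt_zero q
  fin_cases b <;> fin_cases d <;> simp [qsym, qsymRight]
  · rcases hi.lt_or_eq with h | rfl
    · ring
    · simp [h0]
  · rcases i with _ | i
    · simp [h0]
    · rcases hi.lt_or_eq with h | h
      · obtain ⟨k, hk⟩ : ∃ k, n = i + k := ⟨n - i, by omega⟩
        subst hk
        rw [show i + k + 1 - (i + 1) = k by omega, show i + k + 2 - (i + 1) = k + 1 by omega,
          Nat.add_sub_cancel, show i + k + 1 - i = k + 1 by omega]
        ring
      · have : n = i - 1 := by omega
        have h1 : i = n + 1 := by omega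
        subst h1
        simp [h0]
  · rcases i with _ | i
    · simp [h0]
    · rw [Nat.add_sub_cancel, show n + 2 - (i + 1) = n + 1 - i by omega]
      ring
  · rcases i with _ | i
    · simp [h0]
    · rw [Nat.add_sub_cancel, show n + 2 - (i + 1) = n + 1 - i by omega]
      ring

/-- The involution reverses products, so computing adjoints of the t_n requires the recursion with
t_1 on the right. Expanding one factor on each side, the two recursions agree by
`qsym_mul_qsymRight`. -/
theorem tcoef_succ_right (n : ℕ) : ∀ i j : ℕ, i ≤ n + 1 → j ≤ n + 1 →
    tcoef q (n + 1) i j = ∑ b : Fin 2, ∑ c : Fin 2,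
      (qsymRight q (n + 1) b i * qsymRight q (n + 1) c j) •
        (tcoef q n (i - b.1) (j - c.1) * OSU2.t₁ q b c) := by
  induction n with
  | zero =>
    intro i j hi hj
    rw [tcoef]
    interval_cases i <;> interval_cases j <;>
      simp [Fin.sum_univ_two, qsym, qsymRight, qsqrt_zero, qsqrt_one, tcoef]
  | succ n ih =>
    intro i j hi hj
    have hL : tcoef q (n + 1 + 1) i j = ∑ b : Fin 2, ∑ c : Fin 2, ∑ d : Fin 2, ∑ e : Fin 2,
        (qsym q (n + 2) b i * qsymRight q (n + 1) d (i - b) *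
          (qsym q (n + 2) c j * qsymRight q (n + 1) e (j - c))) •
          (OSU2.t₁ q b c * tcoef q n (i - b - d) (j - c - e) * OSU2.t₁ q d e) := by
      rw [tcoef]
      refine Finset.sum_congr rfl fun b _ => Finset.sum_congr rfl fun c _ => ?_
      have hz : ∀ b : Fin 2, ∀ i ≤ n + 2, ¬ i - b.1 ≤ n + 1 → qsym q (n + 2) b i = 0 := by
        intro b i hi h
        have hb := b.2
        rw [show b = 0 from Fin.ext (by rw [Fin.val_zero]; omega), show i = n + 2 by omega]
        exact qsym_zero_self q (n + 2)
      by_cases h1 : i - b.1 ≤ n + 1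
      · by_cases h2 : j - c.1 ≤ n + 1
        · rw [ih _ _ h1 h2]
          simp only [Finset.mul_sum, Finset.smul_sum]
          refine Finset.sum_congr rfl fun d _ => Finset.sum_congr rfl fun e _ => ?_
          rw [mul_smul_comm, smul_smul, mul_assoc (OSU2.t₁ q b c)]
          congr 1
          ring
        · simp [hz c j hj h2]
      · simp [hz b i hi h1]
    rw [hL]
    have hu : ∀ i j, tcoef q (n + 1) i j = ∑ b : Fin 2, ∑ c : Fin 2,
        (qsym q (n + 1) b i * qsym q (n + 1) c j) •
          (OSU2.t₁ q b c * tcoef q n (i - b.1) (j - c.1)) := fun i j => by rw [tcoef]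
    simp only [hu, qsym_mul_qsymRight q n _ _ hi, qsym_mul_qsymRight q n _ _ hj, Finset.sum_mul,
      Finset.smul_sum, smul_mul_assoc, smul_smul]
    have hs : ∀ (k l m : ℕ), k - l - m = k - m - l := fun k l m => Nat.sub_right_comm k l m
    rw [Finset.sum_congr rfl fun b _ => Finset.sum_comm, Finset.sum_comm]
    refine Finset.sum_congr rfl fun d _ => ?_
    rw [Finset.sum_congr rfl fun b _ => Finset.sum_comm, Finset.sum_comm]
    refine Finset.sum_congr rfl fun e _ => Finset.sum_congr rfl fun b _ =>
      Finset.sum_congr rfl fun c _ => ?_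
    rw [hs i, hs j]
    congr 1
    ring

/-- Self-duality of V_n. For t_1 it is read off the matrix; in the induction the adjoint of the left
recursion becomes the right recursion with reversed indices, because `qsymRight` at reversed indices
is `qsym`. -/
theorem star_tcoef (n : ℕ) : ∀ i j : ℕ, i ≤ n → j ≤ n →
    (-q.c) ^ i • star (tcoef q n i j) = (-q.c) ^ j • tcoef q n (n - i) (n - j) := by
  induction n with
  | zero =>
    intro i j hi hj
    obtain rfl : i = 0 := by omega
    obtain rfl : j = 0 := by omega
    simp [tcoef]
  | succ n ih =>
    intro i j hi hj
    have ht : ∀ b c : Fin 2, (-q.c) ^ b.1 • star (OSU2.t₁ q b c) =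
        (-q.c) ^ c.1 • OSU2.t₁ q b.rev c.rev := by
      intro b c
      fin_cases b <;> fin_cases c <;> simp [OSU2.t₁, SUq2.fund]
    have hs : ∀ (b : Fin 2) (i : ℕ), i ≤ n + 1 →
        qsymRight q (n + 1) b.rev (n + 1 - i) = qsym q (n + 1) b i := by
      intro b i hi
      fin_cases b <;> simp [qsymRight, qsym, Nat.sub_sub_self hi]
    -- Terms whose indices leave the range of the induction hypothesis have coefficient zero.
    have hz : ∀ (b : Fin 2) (i : ℕ), i ≤ n + 1 → ¬ (b.1 ≤ i ∧ i ≤ n + b) →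
        qsym q (n + 1) b i = 0 := by
      intro b i hi h
      have hb := b.2
      by_cases h1 : b.1 = 1
      · rw [show b = 1 from Fin.ext h1, show i = 0 by omega]
        exact qsym_one_zero q (n + 1)
      · rw [show b = 0 from Fin.ext (by rw [Fin.val_zero]; omega), show i = n + 1 by omega]
        exact qsym_zero_self q (n + 1)
    have hr : ∀ f : Fin 2 → Fin 2 → OSU2 q, ∑ b, ∑ c, f b c = ∑ b, ∑ c, f (Fin.rev b) (Fin.rev c) := by
      intro f
      simp [Fin.sum_univ_two]
      abel
    rw [tcoef_succ_right q n (n + 1 - i) (n + 1 - j) (by omega) (by omega), hr, tcoef]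
    simp only [star_sum, Finset.smul_sum]
    refine Finset.sum_congr rfl fun b _ => Finset.sum_congr rfl fun c _ => ?_
    simp only [hs b i hi, hs c j hj]
    by_cases h1 : b.1 ≤ i ∧ i ≤ n + b
    · by_cases h2 : c.1 ≤ j ∧ j ≤ n + c
      · have hb := b.2
        have hc := c.2
        have e1 := ih (i - b) (j - c) (by omega) (by omega)
        have e2 := ht b c
        rw [show n + 1 - i - b.rev.1 = n - (i - b) by rw [Fin.val_rev]; omega,
          show n + 1 - j - c.rev.1 = n - (j - c) by rw [Fin.val_rev]; omega]
        rw [star_smul, star_mul, star_mul, star_qsym, star_qsym]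
        calc _ = (qsym q (n + 1) b i * qsym q (n + 1) c j) •
              (((-q.c) ^ (i - b.1) • star (tcoef q n (i - b) (j - c))) *
                ((-q.c) ^ b.1 • star (OSU2.t₁ q b c))) := by
              rw [smul_mul_smul_comm, ← pow_add, Nat.sub_add_cancel h1.1, smul_smul, smul_smul,
                mul_comm, mul_comm (qsym q (n + 1) c j)]
          _ = _ := by
              rw [e1, e2, smul_mul_smul_comm, ← pow_add, Nat.sub_add_cancel h2.1, smul_smul,
                smul_smul, mul_comm]
      · simp [hz c j hj h2]
    · simp [hz b i hi h1]

theorem star_tmat (n : ℕ) (i j : Fin (n + 1)) :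
    (-q.c) ^ i.1 • star (tmat q n i j) = (-q.c) ^ j.1 • tmat q n i.rev j.rev := by
  have h := star_tcoef q n i j (by omega) (by omega)
  rw [tmat, h, tmat, Fin.val_rev, Fin.val_rev, Nat.add_sub_add_right, Nat.add_sub_add_right]

end QS4
end

noncomputable section

/-! ## Balanced tensor products -/

namespace BalTensor

variable {B M N P : Type*} [Ring B] [AddCommGroup M] [Module Bᵐᵒᵖ M]
  [AddCommGroup N] [Module B N] [Module Bᵐᵒᵖ N]
  [AddCommGroup P]

theorem smul_tmul (m : M) (b : B) (n : N) :
    tmul B (MulOpposite.op b • m) n = tmul B m (b • n) := by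
  refine (Submodule.Quotient.eq _).2 (Submodule.subset_span ⟨m, b, n, rfl⟩)

theorem add_tmul (m m' : M) (n : N) : tmul B (m + m') n = tmul B m n + tmul B m' n :=
  congrArg Submodule.Quotient.mk (TensorProduct.tmul_add n m m')

theorem tmul_add (m : M) (n n' : N) : tmul B m (n + n') = tmul B m n + tmul B m n' :=
  congrArg Submodule.Quotient.mk (TensorProduct.add_tmul n n' m)

/-- `tmul` as a biadditive map. -/
def tmulHom : M →+ N →+ BalTensor B M N :=
  AddMonoidHom.mk' (fun m => AddMonoidHom.mk' (tmul B m) (tmul_add m))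
    fun m m' => AddMonoidHom.ext fun n => add_tmul m m' n

theorem sum_tmul {ι : Type*} (s : Finset ι) (m : ι → M) (n : N) :
    tmul B (∑ i ∈ s, m i) n = ∑ i ∈ s, tmul B (m i) n := by
  change tmulHom (∑ i ∈ s, m i) n = ∑ i ∈ s, tmulHom (m i) n
  rw [map_sum, AddMonoidHom.finsetSum_apply]

/-- Additive maps suffice here: the inverse in `exists_balTensor_equiv` is built only as an additive
map. -/
theorem hom_ext {f g : BalTensor B M N →+ P} (h : ∀ m n, f (tmul B m n) = g (tmul B m n)) :
    f = g := by
  ext z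
  obtain ⟨z, rfl⟩ := Submodule.Quotient.mk_surjective _ z
  induction z with
  | zero => exact (map_zero f).trans (map_zero g).symm
  | add x y hx hy =>
    have hxy : (Submodule.Quotient.mk (x + y) : BalTensor B M N) =
        (Submodule.Quotient.mk x : BalTensor B M N) + (Submodule.Quotient.mk y : BalTensor B M N) :=
      rfl
    exact (congrArg f hxy).trans ((map_add f _ _).trans ((congrArg₂ (· + ·) hx hy).trans
      ((map_add g _ _).symm.trans (congrArg g hxy.symm))))
  | tmul n m => exact h m n

variable [Module Bᵐᵒᵖ P]

/-- The additive map on the tensor product of abelian groups determined by a biadditive map. -/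
def liftAddHom (f : M →+ N →+ P) : N ⊗[ℤ] M →+ P :=
  TensorProduct.liftAddHom f.flip (fun c n m => by simp)

theorem liftAddHom_tmul (f : M →+ N →+ P) (m : M) (n : N) : liftAddHom f (n ⊗ₜ m) = f m n := rfl

/-- The linear map determined by a balanced biadditive map. -/
def lift (f : M →+ N →+ P) (hb : ∀ m (b : B) n, f (MulOpposite.op b • m) n = f m (b • n))
    (hr : ∀ m n (b : Bᵐᵒᵖ), f m (b • n) = b • f m n) : BalTensor B M N →ₗ[Bᵐᵒᵖ] P :=
  Submodule.liftQ _
    ({ liftAddHom f with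
       map_smul' := fun b z => by
        change liftAddHom f (b • z) = b • liftAddHom f z
        induction z with
        | zero => rw [smul_zero, map_zero, smul_zero]
        | add x y hx hy => rw [smul_add, map_add, map_add, smul_add, hx, hy]
        | tmul n m =>
          rw [TensorProduct.smul_tmul', liftAddHom_tmul, liftAddHom_tmul]
          exact hr m n b } : N ⊗[ℤ] M →ₗ[Bᵐᵒᵖ] P) (by
    rw [Submodule.span_le]
    rintro _ ⟨m, b, n, rfl⟩
    refine LinearMap.mem_ker.2 ?_
    change liftAddHom f (n ⊗ₜ (MulOpposite.op b • m) - (b • n) ⊗ₜ m) = 0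
    rw [map_sub, liftAddHom_tmul, liftAddHom_tmul, sub_eq_zero]
    exact hb m b n)

@[simp] theorem lift_tmul (f : M →+ N →+ P)
    (hb : ∀ m (b : B) n, f (MulOpposite.op b • m) n = f m (b • n))
    (hr : ∀ m n (b : Bᵐᵒᵖ), f m (b • n) = b • f m n) (m : M) (n : N) :
    lift f hb hr (tmul B m n) = f m n := rfl

end BalTensor

/-! ## Covariant vectors -/

namespace OS7

variable (q : QParam) {κ κ' l : Type*} [Fintype κ] [Fintype κ'] [Fintype l]

open Matrix

/-- `a` is a row vector with `δ(a) = a T`. -/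
def Cov (T : Matrix κ κ (OSU2 q)) (a : κ → OS7 q) : Prop :=
  ∀ j, coaction q (a j) = ∑ i, a i ⊗ₜ T i j

variable {q}

theorem mem_OS4 {b : OS7 q} : b ∈ OS4 q ↔ coaction q b = b ⊗ₜ 1 := Iff.rfl

theorem Cov.sum {T : Matrix κ κ (OSU2 q)} {ι : Type*} (s : Finset ι) {a : ι → κ → OS7 q}
    (h : ∀ i, Cov q T (a i)) : Cov q T (fun k => ∑ i ∈ s, a i k) := by
  intro j
  simp only [map_sum, h _ j, TensorProduct.sum_tmul]
  rw [Finset.sum_comm]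

theorem Cov.add {T : Matrix κ κ (OSU2 q)} {a b : κ → OS7 q} (ha : Cov q T a) (hb : Cov q T b) :
    Cov q T (fun k => a k + b k) := by
  intro j
  simp only [map_add, ha j, hb j, TensorProduct.add_tmul, Finset.sum_add_distrib]

theorem Cov.mul_right {T : Matrix κ κ (OSU2 q)} {a : κ → OS7 q} (ha : Cov q T a) {b : OS7 q}
    (hb : b ∈ OS4 q) : Cov q T (fun k => a k * b) := by
  intro j
  rw [map_mul, ha j, mem_OS4.1 hb, Finset.sum_mul]
  simp only [Algebra.TensorProduct.tmul_mul_tmul, mul_one]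

theorem Cov.star {T : Matrix κ κ (OSU2 q)} {a : κ → OS7 q} (ha : Cov q T a) :
    Cov q (T.map star) (fun k => star (a k)) := by
  intro j
  simp only [map_star, ha j, star_sum, TensorProduct.star_tmul, map_apply]

theorem Cov.vecMul {K : Matrix κ κ (OSU2 q)} {T : Matrix κ' κ' (OSU2 q)} {S : Matrix κ κ' ℂ}
    (h : K * emb (OSU2 q) S = emb (OSU2 q) S * T) {a : κ → OS7 q} (ha : Cov q K a) :
    Cov q T (fun j => ∑ i, S i j • a i) := by
  intro j
  have h1 : ∀ k, ∑ i, S i j • K k i = ∑ l, S k l • T l j := by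
    intro k
    have := congrFun (congrFun h k) j
    simpa only [mul_apply, emb_apply, ← Algebra.commutes, ← Algebra.smul_def] using this
  simp only [map_sum, map_smul, ha _]
  calc ∑ i, S i j • ∑ k, a k ⊗ₜ[ℂ] K k i = ∑ k, a k ⊗ₜ[ℂ] ∑ i, S i j • K k i := by
        simp only [Finset.smul_sum, TensorProduct.tmul_sum, TensorProduct.tmul_smul]
        rw [Finset.sum_comm]
    _ = _ := by
        simp only [h1, TensorProduct.tmul_sum, TensorProduct.sum_tmul, TensorProduct.tmul_smul,
          TensorProduct.smul_tmul']
        rw [Finset.sum_comm]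

theorem Cov.kron {T : Matrix κ κ (OSU2 q)} {R : Matrix l l (OSU2 q)} {a : κ → OS7 q}
    {b : l → OS7 q} (ha : Cov q T a) (hb : Cov q R b) :
    Cov q (kron T R) (fun k => a k.1 * b k.2) := by
  intro j
  simp only [map_mul, ha _, hb _, Finset.sum_mul, Finset.mul_sum, Fintype.sum_prod_type,
    Algebra.TensorProduct.tmul_mul_tmul, kron_apply]
  rw [Finset.sum_comm]

/-- The hypothesis `hT` says that `T'` is contragredient to `T`. As `a` stands to the left of `c`,
the entries of `T'` and `T` are adjacent and cancel, leaving `R`. -/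
theorem Cov.contract [DecidableEq κ] {T T' : Matrix κ κ (OSU2 q)} {R : Matrix l l (OSU2 q)}
    (hT : T' * T.transpose = 1)
    {a : κ → OS7 q} (ha : Cov q T' a) {c : κ × l → OS7 q} (hc : Cov q (Matrix.kron T R) c) :
    Cov q R (fun i => ∑ k, a k * c (k, i)) := by
  intro j
  have h1 : ∀ i i', ∑ k, T' i k * T i' k = if i = i' then 1 else 0 := fun i i' => by
    have := congrFun (congrFun hT i) i'
    simpa only [mul_apply, transpose_apply, one_apply] using this
  have h2 : ∀ i i' l, ∑ k, T' i k * (T i' k * R l j) = if i = i' then R l j else 0 := by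
    intro i i' l
    simp only [← mul_assoc]
    rw [← Finset.sum_mul, h1]
    split_ifs <;> simp
  simp only [map_sum, map_mul, ha _, hc _, Finset.sum_mul, Finset.mul_sum, Fintype.sum_prod_type,
    Algebra.TensorProduct.tmul_mul_tmul, kron_apply, TensorProduct.sum_tmul]
  calc ∑ k, ∑ i', ∑ l, ∑ i, (a i * c (i', l)) ⊗ₜ[ℂ] (T' i k * (T i' k * R l j))
      = ∑ l, ∑ i', ∑ i, (a i * c (i', l)) ⊗ₜ[ℂ] (∑ k, T' i k * (T i' k * R l j)) := by
        simp only [TensorProduct.tmul_sum]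
        rw [Finset.sum_comm, Finset.sum_comm (s := (Finset.univ : Finset l))]
        refine Finset.sum_congr rfl fun i' _ => ?_
        rw [Finset.sum_comm]
        refine Finset.sum_congr rfl fun l _ => ?_
        rw [Finset.sum_comm]
    _ = _ := by
        simp only [h2, TensorProduct.tmul_ite, Finset.sum_ite_eq', Finset.mem_univ, if_true]

theorem Cov.dot_mem [DecidableEq κ] {T T' : Matrix κ κ (OSU2 q)} (hT : T' * T.transpose = 1)
    {a c : κ → OS7 q} (ha : Cov q T' a) (hc : Cov q T c) : ∑ k, a k * c k ∈ OS4 q := by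
  -- Contraction with the trivial one-dimensional corepresentation as second factor.
  have hc' : Cov q (Matrix.kron T (1 : Matrix Unit Unit (OSU2 q))) (fun k => c k.1) := fun j => by
    simp [hc j.1, Fintype.sum_prod_type]
  have h := Cov.contract hT ha hc' ()
  rwa [Fintype.sum_unique, one_apply_eq] at h

/-! ## Modules of covariant vectors as projective modules -/

theorem cov_mul_sum {T : Matrix κ κ (OSU2 q)} {ι : Type*} [Fintype ι] {Y : Matrix κ ι (OS7 q)}
    (hY : ∀ I, Cov q T (fun k => Y k I)) (b : ι → OS4 q) :
    Cov q T (Y *ᵥ fun i => (b i : OS7 q)) :=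
  Cov.sum _ fun i => (hY i).mul_right (b i).2

/-- The vector `Z *ᵥ c` is its own witness, being fixed by the idempotent. With `projModule_spec`,
this makes `Z` and `Z'` inverse to each other between covariant vectors and the module. -/
theorem mulVec_mem_projModule {ι : Type} [Fintype ι] [DecidableEq κ] {Z : Matrix ι κ (OS7 q)}
    {Z' : Matrix κ ι (OS7 q)} (hZ : Z' * Z = 1) {c : κ → OS7 q}
    (hc : ∀ J, (Z *ᵥ c) J ∈ OS4 q) : Z *ᵥ c ∈ projModule q (Z * Z') := by
  refine ⟨fun J => ⟨_, hc J⟩, ?_⟩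
  change Z *ᵥ c = (Z * Z') *ᵥ (Z *ᵥ c)
  rw [mulVec_mulVec, Matrix.mul_assoc, hZ, Matrix.mul_one]

theorem projModule_spec {ι : Type} [Fintype ι] [DecidableEq κ] {T : Matrix κ κ (OSU2 q)}
    {Z : Matrix ι κ (OS7 q)} {Z' : Matrix κ ι (OS7 q)} (hZ : Z' * Z = 1)
    (hZ' : ∀ J, Cov q T (fun k => Z' k J)) {v : ι → OS7 q} (hv : v ∈ projModule q (Z * Z')) :
    Cov q T (Z' *ᵥ v) ∧ Z *ᵥ (Z' *ᵥ v) = v := by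
  obtain ⟨b, rfl⟩ := hv
  constructor
  · rw [mulVec_mulVec, ← Matrix.mul_assoc, hZ, Matrix.one_mul]
    exact cov_mul_sum hZ' b
  · rw [mulVec_mulVec, mulVec_mulVec, Matrix.mul_assoc, ← Matrix.mul_assoc Z', hZ, Matrix.one_mul]

/-- The module of a projection `Z Z'` is the cotensor product. -/
def cotensorEquivProjModule {r : ℕ} {ι : Type} [Fintype ι] {T : Matrix (Fin r) (Fin r) (OSU2 q)}
    {Z : Matrix ι (Fin r) (OS7 q)} {Z' : Matrix (Fin r) ι (OS7 q)} (hZ'Z : Z' * Z = 1)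
    (hZ : ∀ c, Cov q T c → ∀ J, (Z *ᵥ c) J ∈ OS4 q) (hZ' : ∀ J, Cov q T (fun k => Z' k J)) :
    cotensor q T ≃ₗ[(OS4 q)ᵐᵒᵖ] projModule q (Z * Z') where
  toFun c := ⟨Z *ᵥ c.1, mulVec_mem_projModule hZ'Z (hZ _ c.2)⟩
  map_add' c d := Subtype.ext (mulVec_add Z c.1 d.1)
  map_smul' b c := Subtype.ext (by
    ext J
    change ∑ k, Z J k * (c.1 k * (b.unop : OS7 q)) = (∑ k, Z J k * c.1 k) * (b.unop : OS7 q)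
    simp only [Finset.sum_mul, mul_assoc])
  invFun v := ⟨Z' *ᵥ v.1, (projModule_spec hZ'Z hZ' v.2).1⟩
  left_inv c := Subtype.ext (by
    change Z' *ᵥ (Z *ᵥ c.1) = c.1
    rw [mulVec_mulVec, hZ'Z, one_mulVec])
  right_inv v := Subtype.ext (projModule_spec hZ'Z hZ' v.2).2

/-- The columns Y_I of `Y` and the rows X_I of `X` are dual bases of the first module over B: m = ∑
Y_I (X_I · m), where X_I · m is coinvariant because `T'` is contragredient to `T`. Hence m ⊗ n = ∑
Y_I ⊗ (X_I · m) n depends only on the products m_k n_i, and c ↦ ∑ Y_I ⊗ (X_I · c) inverts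
multiplication onto the covariant vectors for `kron T R`. The matrices `Z`, `Z'` then pass to the
projective module. -/
theorem exists_balTensor_equiv {r s : ℕ} {ι ι' : Type} [Fintype ι] [Fintype ι']
    {T T' : Matrix (Fin r) (Fin r) (OSU2 q)} {R : Matrix (Fin s) (Fin s) (OSU2 q)}
    {X : Matrix ι (Fin r) (OS7 q)} {Y : Matrix (Fin r) ι (OS7 q)} (hYX : Y * X = 1)
    (hT : T' * T.transpose = 1) (hX : ∀ I, Cov q T' (X I)) (hY : ∀ I, Cov q T (fun k => Y k I))
    {Z : Matrix ι' (Fin r × Fin s) (OS7 q)} {Z' : Matrix (Fin r × Fin s) ι' (OS7 q)}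
    (hZ'Z : Z' * Z = 1) (hZ : ∀ c, Cov q (Matrix.kron T R) c → ∀ J, (Z *ᵥ c) J ∈ OS4 q)
    (hZ' : ∀ J, Cov q (Matrix.kron T R) (fun k => Z' k J)) {p : Matrix ι' ι' (OS7 q)}
    (hp : p = Z * Z') :
    ∃ Ψ : BalTensor (OS4 q) (cotensor q T) (cotensor q R) ≃ₗ[(OS4 q)ᵐᵒᵖ] projModule q p,
      ∀ m n, (Ψ (BalTensor.tmul (OS4 q) m n)).1 = Z *ᵥ fun k => m.1 k.1 * n.1 k.2 := by
  subst hp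
  let f : cotensor q T →+ cotensor q R →+ projModule q (Z * Z') :=
    AddMonoidHom.mk' (fun m => AddMonoidHom.mk'
      (fun n => ⟨Z *ᵥ fun k => m.1 k.1 * n.1 k.2,
        mulVec_mem_projModule hZ'Z (hZ _ (Cov.kron m.2 n.2))⟩)
      fun n n' => Subtype.ext (by
        change Z *ᵥ _ = Z *ᵥ _ + Z *ᵥ _
        rw [← mulVec_add]
        congr 1
        ext k
        exact mul_add _ _ _))
      fun m m' => AddMonoidHom.ext fun n => Subtype.ext (by
        change Z *ᵥ _ = Z *ᵥ _ + Z *ᵥ _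
        rw [← mulVec_add]
        congr 1
        ext k
        exact add_mul _ _ _)
  let F := BalTensor.lift (B := OS4 q) f
    (fun m b n => Subtype.ext (by
      change Z *ᵥ _ = Z *ᵥ _
      congr 1
      ext k
      exact mul_assoc _ _ _))
    (fun m n b => Subtype.ext (by
      ext J
      change ∑ k, Z J k * (m.1 k.1 * (n.1 k.2 * (b.unop : OS7 q))) =
        (∑ k, Z J k * (m.1 k.1 * n.1 k.2)) * (b.unop : OS7 q)
      simp only [Finset.sum_mul, mul_assoc]))
  have hF : ∀ m n, (F (BalTensor.tmul (OS4 q) m n)).1 = Z *ᵥ fun k => m.1 k.1 * n.1 k.2 :=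
    fun m n => rfl
  let e : ι → cotensor q T := fun I => ⟨fun k => Y k I, hY I⟩
  let g : projModule q (Z * Z') →+ BalTensor (OS4 q) (cotensor q T) (cotensor q R) :=
    AddMonoidHom.mk' (fun v => ∑ I, BalTensor.tmul (OS4 q) (e I)
      (⟨fun i => ∑ k, X I k * (Z' *ᵥ v.1) (k, i),
        Cov.contract hT (hX I) (projModule_spec hZ'Z hZ' v.2).1⟩ : cotensor q R))
      fun v w => by
        rw [← Finset.sum_add_distrib]
        refine Finset.sum_congr rfl fun I _ => ?_
        rw [← BalTensor.tmul_add]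
        congr 1
        refine Subtype.ext (funext fun i => ?_)
        change ∑ k, X I k * (Z' *ᵥ (v.1 + w.1)) (k, i) =
          ∑ k, X I k * (Z' *ᵥ v.1) (k, i) + ∑ k, X I k * (Z' *ᵥ w.1) (k, i)
        rw [mulVec_add, ← Finset.sum_add_distrib]
        exact Finset.sum_congr rfl fun k _ => mul_add _ _ _
  have hgF : g.comp F.toAddMonoidHom = AddMonoidHom.id _ := by
    refine BalTensor.hom_ext fun m n => ?_
    change ∑ I, BalTensor.tmul (OS4 q) (e I) _ = BalTensor.tmul (OS4 q) m n
    -- The dual basis expansion, whose coefficients are then moved across the balanced tensor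
    -- product.
    have hm : m = ∑ I, MulOpposite.op (⟨∑ k, X I k * m.1 k, Cov.dot_mem hT (hX I) m.2⟩ : OS4 q) •
        e I := by
      refine Subtype.ext ?_
      rw [Submodule.coe_sum]
      ext k
      rw [Finset.sum_apply]
      change m.1 k = ∑ I, Y k I * ∑ k, X I k * m.1 k
      have := congrFun (mulVec_mulVec m.1 Y X) k
      rw [hYX, one_mulVec] at this
      exact this.symm
    conv_rhs => rw [hm]
    rw [BalTensor.sum_tmul]
    refine Finset.sum_congr rfl fun I _ => ?_
    rw [BalTensor.smul_tmul]
    congr 1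
    refine Subtype.ext (funext fun i => ?_)
    change ∑ k, X I k * (Z' *ᵥ (Z *ᵥ fun k => m.1 k.1 * n.1 k.2)) (k, i) =
      (∑ k, X I k * m.1 k) * n.1 i
    rw [mulVec_mulVec, hZ'Z, one_mulVec, Finset.sum_mul]
    simp only [mul_assoc]
  have hFg : ∀ v, F (g v) = v := by
    intro v
    obtain ⟨hc, hv⟩ := projModule_spec hZ'Z hZ' v.2
    refine Subtype.ext ?_
    conv_rhs => rw [← hv]
    change (F (∑ I, BalTensor.tmul (OS4 q) (e I) _)).1 = _
    rw [map_sum, Submodule.coe_sum]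
    simp only [hF]
    rw [← mulVec_sum]
    congr 1
    ext ⟨k, i⟩
    rw [Finset.sum_apply]
    have h1 := congrFun (mulVec_mulVec (fun k => (Z' *ᵥ v.1) (k, i)) Y X) k
    rw [hYX, one_mulVec] at h1
    exact h1
  exact ⟨{ F with
    invFun := g
    left_inv := fun z => DFunLike.congr_fun hgF z
    right_inv := hFg }, hF⟩

end OS7
end

noncomputable section

/-! ### Isometry and covariance of `u`, `U` and `W`; the projections -/

namespace OS7

open Matrix

variable (q : QParam)

/-- The two diagonal entries reduce to the two sphere relations, the off-diagonal ones to
commutation relations. -/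
theorem u_conjTranspose_mul : (u q).conjTranspose * u q = 1 := by
  have hq := q.c_ne_zero
  ext i j
  fin_cases i <;> fin_cases j <;>
    simp [u, Matrix.mul_apply, Fin.sum_univ_four, smul_smul, s33, s22, s11, s12, s34, s21, s43,
      sphere, sphere', -RCLike.star_def] <;>
    match_scalars <;> field_simp <;> ring

theorem cov_u (j : Fin 4) : Cov q (OSU2.t₁ q) (u q j) := coaction_u q j

variable {q} {κ κ' : Type*} [Fintype κ] [Fintype κ']

theorem Cov.emb_mulVec {K : Matrix κ κ (OSU2 q)} {T : Matrix κ' κ' (OSU2 q)} {S : Matrix κ' κ ℂ}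
    (h : K * emb (OSU2 q) S.transpose = emb (OSU2 q) S.transpose * T) {a : κ → OS7 q}
    (ha : Cov q K a) : Cov q T (emb (OS7 q) S *ᵥ a) := by
  have := ha.vecMul h
  convert this using 2 with j
  simp only [mulVec, dotProduct, emb_apply, transpose_apply, ← Algebra.smul_def]

theorem Cov.mul_emb {K : Matrix κ κ (OSU2 q)} {T : Matrix κ' κ' (OSU2 q)} {S : Matrix κ κ' ℂ}
    (h : K * emb (OSU2 q) S = emb (OSU2 q) S * T) {ι : Type*} {X : Matrix ι κ (OS7 q)} {I : ι}
    (ha : Cov q K (X I)) : Cov q T ((X * emb (OS7 q) S : Matrix ι κ' (OS7 q)) I) := by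
  have := ha.vecMul h
  intro j
  have h1 : ∀ j, (X * emb (OS7 q) S) I j = ∑ i, S i j • X I i := fun j => by
    simp only [mul_apply, emb_apply, ← Algebra.commutes, ← Algebra.smul_def]
  simp only [h1]
  exact this j

theorem Cov.submatrix {T : Matrix κ κ (OSU2 q)} {a : κ → OS7 q} (ha : Cov q T a) (e : κ' ≃ κ) :
    Cov q (T.submatrix e e) (fun k => a (e k)) := by
  intro j
  rw [ha (e j), ← e.sum_comp]
  rfl

theorem map_star_unitary [DecidableEq κ] {T : Matrix κ κ (OSU2 q)} (h : T * T.conjTranspose = 1) :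
    T * (T.map star).transpose = 1 := h

theorem Cov.mul_conjTranspose_mem [DecidableEq κ] {T : Matrix κ κ (OSU2 q)}
    (hT : T * T.conjTranspose = 1) {ι : Type*} {X Y : Matrix ι κ (OS7 q)}
    (hX : ∀ I, Cov q T (X I)) (hY : ∀ I, Cov q T (Y I)) (I J : ι) :
    (X * Y.conjTranspose : Matrix ι ι (OS7 q)) I J ∈ OS4 q :=
  Cov.dot_mem (map_star_unitary hT) (hX I) (hY J).star

end OS7

namespace QS4

open Matrix OS7

variable (q : QParam)

theorem symMat_conjTranspose (n : ℕ) : (symMat q n).conjTranspose = (symMat q n).transpose := by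
  ext i k
  simp only [conjTranspose_apply, transpose_apply, symMat]
  split_ifs
  · exact star_qsym _ _ _ _
  · exact star_zero _

theorem asymMat_conjTranspose (n : ℕ) :
    (asymMat q n).conjTranspose = (asymMat q n).transpose := by
  ext i k
  simp only [conjTranspose_apply, transpose_apply, asymMat]
  split_ifs
  · exact star_qasym _ _ _ _
  · exact star_zero _

theorem Uprod_apply (n : ℕ) (I : Fin (n + 1) → Fin 4) (k : Fin 2 × Fin (n + 1)) :
    Uprod q n I k = u q (I 0) k.1 * U q n (fun l => I l.succ) k.2 := rfl

theorem Uprod_eq_submatrix (n : ℕ) : Uprod q n =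
    (kron (u q) (U q n)).submatrix (Fin.consEquiv fun _ : Fin (n + 1) => Fin 4).symm id := rfl

/-- With `W_eq`, this reduces orthonormality and covariance of `U` and `W` to the corresponding
properties of S and A. -/
theorem U_succ (n : ℕ) : U q (n + 1) = Uprod q n * emb (OS7 q) (symMat q n) := by
  ext I k
  have h : ∀ b, ∑ l, symMat q n (b, l) k • (u q (I 0) b * U q n (fun l => I l.succ) l) =
      qsym q (n + 1) b k.1 • (u q (I 0) b * Ucol q n (fun l => I l.succ) (k.1 - b.1)) := fun b =>
    sum_symMat_smul q n (fun l => u q (I 0) b * Ucol q n (fun l => I l.succ) l) b k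
  simp only [mul_apply, emb_apply, ← Algebra.commutes, ← Algebra.smul_def,
    Fintype.sum_prod_type, Uprod_apply, h]
  simp [U, Ucol, qsym, Fin.sum_univ_two, smul_smul]

theorem W_eq (m : ℕ) : W q m = Uprod q (m + 1) * emb (OS7 q) (asymMat q (m + 1)) := by
  ext I k
  have h : ∀ b, ∑ l, asymMat q (m + 1) (b, l) k •
      (u q (I 0) b * U q (m + 1) (fun l => I l.succ) l) = qasym q (m + 1) b k.1 •
        (u q (I 0) b * Ucol q (m + 1) (fun l => I l.succ) (k.1 + 1 - b.1)) := fun b =>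
    sum_asymMat_smul q (m + 1) (fun l => u q (I 0) b * Ucol q (m + 1) (fun l => I l.succ) l) b k
  simp only [mul_apply, emb_apply, ← Algebra.commutes, ← Algebra.smul_def,
    Fintype.sum_prod_type, Uprod_apply, h]
  simp [W, qasym, Fin.sum_univ_two, smul_smul, sub_eq_add_neg]

/-- Stated conditionally because it serves as the inductive step of `U_isometry`; `cov_Uprod_of`
plays the same role for `cov_U`. -/
theorem Uprod_isometry_of (n : ℕ) (h : (U q n).conjTranspose * U q n = 1) :
    (Uprod q n).conjTranspose * Uprod q n = 1 := by
  rw [Uprod_eq_submatrix, conjTranspose_submatrix, submatrix_mul_equiv,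
    kron_conjTranspose_mul_kron (u_conjTranspose_mul q) h, submatrix_id_id]

theorem U_isometry (n : ℕ) : (U q n).conjTranspose * U q n = 1 := by
  induction n with
  | zero =>
    ext i j
    fin_cases i; fin_cases j
    simp [mul_apply, U, Ucol]
  | succ n ih =>
    rw [U_succ, conjTranspose_mul, Matrix.mul_assoc, ← Matrix.mul_assoc (Uprod q n)ᴴ,
      Uprod_isometry_of q n ih, Matrix.one_mul, ← emb_conjTranspose, ← emb_mul,
      (symMat_isometry q n).1, emb_one]

theorem Uprod_isometry (n : ℕ) : (Uprod q n).conjTranspose * Uprod q n = 1 :=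
  Uprod_isometry_of q n (U_isometry q n)

theorem W_isometry (m : ℕ) : (W q m).conjTranspose * W q m = 1 := by
  rw [W_eq, conjTranspose_mul, Matrix.mul_assoc, ← Matrix.mul_assoc (Uprod q _)ᴴ,
    Uprod_isometry, Matrix.one_mul, ← emb_conjTranspose, ← emb_mul,
    (symMat_isometry q _).2.1, emb_one]

theorem U_conjTranspose_mul_W (m : ℕ) : (U q (m + 2)).conjTranspose * W q m = 0 := by
  rw [W_eq, U_succ, conjTranspose_mul, Matrix.mul_assoc, ← Matrix.mul_assoc (Uprod q _)ᴴ,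
    Uprod_isometry, Matrix.one_mul, ← emb_conjTranspose, ← emb_mul,
    (symMat_isometry q _).2.2, emb_zero]

theorem W_conjTranspose_mul_U (m : ℕ) : (W q m).conjTranspose * U q (m + 2) = 0 := by
  rw [← conjTranspose_conjTranspose (U q (m + 2)), ← conjTranspose_mul, U_conjTranspose_mul_W,
    conjTranspose_zero]

theorem cov_Uprod_of (n : ℕ) (h : ∀ I, Cov q (tmat q n) (U q n I)) (I : Fin (n + 1) → Fin 4) :
    Cov q (kron (OSU2.t₁ q) (tmat q n)) (Uprod q n I) :=
  Cov.kron (cov_u q (I 0)) (h fun l => I l.succ)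

theorem cov_U (n : ℕ) : ∀ I, Cov q (tmat q n) (U q n I) := by
  induction n with
  | zero =>
    intro I j
    fin_cases j
    simp [U, Ucol, tmat, tcoef, Algebra.TensorProduct.one_def]
  | succ n ih =>
    intro I
    rw [U_succ]
    exact Cov.mul_emb (kron_mul_symMat q n) (cov_Uprod_of q n ih I)

theorem cov_Uprod (n : ℕ) (I : Fin (n + 1) → Fin 4) :
    Cov q (kron (OSU2.t₁ q) (tmat q n)) (Uprod q n I) := cov_Uprod_of q n (cov_U q n) I

theorem cov_W (m : ℕ) (I : Fin (m + 2) → Fin 4) : Cov q (tmat q m) (W q m I) := by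
  rw [W_eq]
  exact Cov.mul_emb (kron_mul_asymMat' q m) (cov_Uprod q (m + 1) I)

/-- Completeness SS^* + AA^* = 1 of the decomposition of V_1 ⊗ V_{m+1}, conjugated by `Uprod`. -/
theorem P_add_Q (m : ℕ) :
    P q (m + 2) + Q q m = Uprod q (m + 1) * (Uprod q (m + 1)).conjTranspose := by
  have h := congrArg (emb (OS7 q)) (symMat_add_asymMat q (m + 1))
  rw [emb_add, emb_mul, emb_mul, emb_one, emb_conjTranspose, emb_conjTranspose] at h
  rw [P, Q, W_eq, U_succ, conjTranspose_mul, conjTranspose_mul]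
  calc _ = Uprod q (m + 1) * (emb (OS7 q) (symMat q (m + 1)) * (emb (OS7 q) (symMat q (m + 1)))ᴴ +
        emb (OS7 q) (asymMat q (m + 1)) * (emb (OS7 q) (asymMat q (m + 1)))ᴴ) *
          (Uprod q (m + 1))ᴴ := by
        simp only [Matrix.mul_add, Matrix.add_mul, Matrix.mul_assoc]
    _ = _ := by rw [h, Matrix.mul_one]

theorem isStarProjection_mul_conjTranspose {R ι κ : Type*} [Ring R] [StarRing R] [Fintype ι]
    [Fintype κ] [DecidableEq κ] {X : Matrix ι κ R} (h : X.conjTranspose * X = 1) :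
    IsStarProjection (X * X.conjTranspose) where
  isIdempotentElem := by
    rw [IsIdempotentElem, Matrix.mul_assoc, ← Matrix.mul_assoc Xᴴ, h, Matrix.one_mul]
  isSelfAdjoint := by
    rw [IsSelfAdjoint, star_eq_conjTranspose, conjTranspose_mul, conjTranspose_conjTranspose]

theorem P_apply_mem (n : ℕ) (I J : Fin n → Fin 4) : P q n I J ∈ OS4 q :=
  Cov.mul_conjTranspose_mem (tmat_mul_conjTranspose q n) (cov_U q n) (cov_U q n) I J

theorem Uprod_mul_conjTranspose_mem (n : ℕ) (I J : Fin (n + 1) → Fin 4) :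
    (Uprod q n * (Uprod q n).conjTranspose : Matrix _ _ (OS7 q)) I J ∈ OS4 q :=
  Cov.mul_conjTranspose_mem (kron_tmat_mul_conjTranspose q n) (cov_Uprod q n) (cov_Uprod q n) I J

/-- `tensorProj` lists the index of P first whereas `consIdx` puts that of u first; hence the two
swaps. -/
theorem submatrix_P_add_Q (m : ℕ) :
    (P q (m + 2) + Q q m).submatrix consIdx consIdx =
      (tensorProj (P q (m + 1)) (u q) (u q).conjTranspose).submatrix Prod.swap Prod.swap := by
  rw [P_add_Q]
  ext j k
  simp only [submatrix_apply, tensorProj, mul_apply, conjTranspose_apply, Uprod_apply, consIdx,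
    Fin.cons_zero, Fin.cons_succ, star_mul, P, Fintype.sum_prod_type, Prod.fst_swap,
    Prod.snd_swap, Finset.mul_sum, Finset.sum_mul, mul_assoc]

/-- An instance of `exists_balTensor_equiv` with dual bases U^*, U. The involution reverses
products, so the conjugate of t_1 ⊗ t_{m+1} is, after exchanging the indices, conj(t_{m+1}) ⊗
conj(t_1); this explains the order of the factors and the reindexing `e`. -/
theorem exists_dual_equiv (m : ℕ) :
    ∃ Ψ : BalTensor (OS4 q) (Edual q (m + 1)) (Edual q 1) ≃ₗ[(OS4 q)ᵐᵒᵖ]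
        projModule q (P q (m + 2) + Q q m),
      ∀ (b : Edual q (m + 1)) (a : Edual q 1) (j : Fin 4 × (Fin (m + 1) → Fin 4)),
        (Ψ (BalTensor.tmul (OS4 q) b a)).1 (consIdx j) =
          ∑ i, ∑ k, u q j.1 i * U q (m + 1) j.2 k * b.1 k * a.1 i := by
  let e : Fin (m + 2) × Fin 2 ≃ Fin 2 × Fin (m + 2) := Equiv.prodComm _ _
  let Z := (Uprod q (m + 1)).submatrix id e
  let T := (kron (OSU2.t₁ q) (tmat q (m + 1))).submatrix e e
  have hZ : Zᴴ * Z = 1 := by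
    rw [conjTranspose_submatrix, ← submatrix_mul _ _ _ id _ Function.bijective_id, Uprod_isometry]
    exact submatrix_one_equiv e
  have hT : T * Tᴴ = 1 := by
    rw [conjTranspose_submatrix, submatrix_mul_equiv, kron_tmat_mul_conjTranspose]
    simp
  have hcov : ∀ J, Cov q T (Z J) := fun J => (cov_Uprod q (m + 1) J).submatrix e
  have hTk : T.map star = kron ((tmat q (m + 1)).map star) ((tmat q 1).map star) := by
    ext i j
    rw [tmat_one]
    exact star_mul _ _
  obtain ⟨Ψ, hΨ⟩ := exists_balTensor_equiv (T := (tmat q (m + 1)).map star)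
    (T' := tmat q (m + 1)) (R := (tmat q 1).map star) (X := U q (m + 1)) (Z := Z) (Z' := Zᴴ)
    (U_isometry q (m + 1)) (map_star_unitary (tmat_mul_conjTranspose q _)) (cov_U q (m + 1))
    (fun I => (cov_U q (m + 1) I).star) hZ
    (fun c hc J => Cov.dot_mem (map_star_unitary hT) (hcov J) (hTk ▸ hc))
    (fun J => hTk ▸ (hcov J).star) (p := P q (m + 2) + Q q m) (by
      rw [P_add_Q, conjTranspose_submatrix, submatrix_mul_equiv, submatrix_id_id])
  refine ⟨Ψ, fun b a j => ?_⟩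
  rw [hΨ]
  simp only [mulVec, dotProduct, Fintype.sum_prod_type]
  rw [Finset.sum_comm]
  refine Finset.sum_congr rfl fun i _ => Finset.sum_congr rfl fun k _ => ?_
  rw [mul_assoc, mul_assoc]
  change u q (consIdx j 0) i * U q (m + 1) (fun l => consIdx j l.succ) k * (b.1 k * a.1 i) = _
  simp only [consIdx, Fin.cons_zero, Fin.cons_succ, mul_assoc]

/-! ## Comparison of `E_n` with its dual -/

/-- The matrix of the isomorphism of `V_n` with its dual. -/
def flipMat (n : ℕ) : Matrix (Fin (n + 1)) (Fin (n + 1)) ℂ := fun k l =>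
  if l = k.rev then (-q.c) ^ k.1 else 0

/-- The inverse of `flipMat`. -/
def flipInv (n : ℕ) : Matrix (Fin (n + 1)) (Fin (n + 1)) ℂ := fun k l =>
  if l = k.rev then ((-q.c) ^ l.1)⁻¹ else 0

theorem flipMat_mul_flipInv (n : ℕ) : flipMat q n * flipInv q n = 1 := by
  have hq : -q.c ≠ 0 := neg_ne_zero.2 q.c_ne_zero
  ext i j
  simp only [mul_apply, flipMat, flipInv, ite_mul, zero_mul, Finset.sum_ite_eq', Finset.mem_univ, if_true, Fin.rev_rev,
    one_apply, eq_comm (a := j)]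
  split_ifs with h
  · subst h
    field_simp
  · simp

theorem flipInv_mul_flipMat (n : ℕ) : flipInv q n * flipMat q n = 1 :=
  mul_eq_one_comm.1 (flipMat_mul_flipInv q n)

theorem tmat_mul_flipMat (n : ℕ) :
    tmat q n * emb (OSU2 q) (flipMat q n).transpose =
      emb (OSU2 q) (flipMat q n).transpose * (tmat q n).map star := by
  ext i j
  have h := star_tmat q n i.rev j
  simp only [mul_apply, emb_apply, transpose_apply, flipMat, map_apply, ← Algebra.commutes,
    ← Algebra.smul_def, ite_smul, zero_smul, Finset.sum_ite_eq', Finset.mem_univ, if_true]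
  rw [Fin.rev_rev] at h
  rw [← h]
  simp only [← Fin.rev_eq_iff (i := i), eq_comm (a := i.rev)]
  simp

theorem tmat_star_mul_flipInv (n : ℕ) :
    (tmat q n).map star * emb (OSU2 q) (flipInv q n).transpose =
      emb (OSU2 q) (flipInv q n).transpose * tmat q n := by
  have h1 : emb (OSU2 q) (flipInv q n).transpose * emb (OSU2 q) (flipMat q n).transpose = 1 := by
    rw [← emb_mul, ← transpose_mul, flipMat_mul_flipInv, transpose_one, emb_one]
  have h2 : emb (OSU2 q) (flipMat q n).transpose * emb (OSU2 q) (flipInv q n).transpose = 1 := by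
    rw [← emb_mul, ← transpose_mul, flipInv_mul_flipMat, transpose_one, emb_one]
  calc _ = emb (OSU2 q) (flipInv q n).transpose * (emb (OSU2 q) (flipMat q n).transpose *
        (tmat q n).map star) * emb (OSU2 q) (flipInv q n).transpose := by
        rw [← Matrix.mul_assoc, h1, Matrix.one_mul]
    _ = _ := by
        rw [← tmat_mul_flipMat, Matrix.mul_assoc, Matrix.mul_assoc, h2, Matrix.mul_one]


theorem cov_flipMat_mulVec {n : ℕ} {a : Fin (n + 1) → OS7 q} (ha : Cov q (tmat q n) a) :
    Cov q ((tmat q n).map star) (emb (OS7 q) (flipMat q n) *ᵥ a) :=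
  ha.emb_mulVec (tmat_mul_flipMat q n)

theorem cov_flipInv_mulVec {n : ℕ} {a : Fin (n + 1) → OS7 q}
    (ha : Cov q ((tmat q n).map star) a) :
    Cov q (tmat q n) (emb (OS7 q) (flipInv q n) *ᵥ a) :=
  ha.emb_mulVec (tmat_star_mul_flipInv q n)

theorem flipMat_mulVec (n : ℕ) (a : Fin (n + 1) → OS7 q) (k : Fin (n + 1)) :
    (emb (OS7 q) (flipMat q n) *ᵥ a) k = (-q.c) ^ k.1 • a k.rev := by
  simp only [mulVec, dotProduct, emb_apply, ← Algebra.smul_def, flipMat, ite_smul, zero_smul,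
    Finset.sum_ite_eq', Finset.mem_univ, if_true]

theorem mul_flipMat_mulVec {n : ℕ} {ι : Type*} (X : Matrix ι (Fin (n + 1)) (OS7 q))
    (a : Fin (n + 1) → OS7 q) (I : ι) : ((X * emb (OS7 q) (flipMat q n)) *ᵥ a) I =
      ∑ k, (-q.c) ^ k.1 • (X I k * a k.rev) := by
  rw [← mulVec_mulVec]
  change ∑ k, X I k * (emb (OS7 q) (flipMat q n) *ᵥ a) k = _
  simp only [flipMat_mulVec, mul_smul_comm]

/-- A row covariant for t_n pairs into B with vectors covariant for the conjugate of t_n, and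
`flipMat` turns `c` into such a vector. -/
theorem dot_flipMat_mem {n : ℕ} {ι : Type*} {X : Matrix ι (Fin (n + 1)) (OS7 q)}
    (hX : ∀ I, Cov q (tmat q n) (X I)) {c : Fin (n + 1) → OS7 q} (hc : Cov q (tmat q n) c) (I : ι) :
    ((X * emb (OS7 q) (flipMat q n)) *ᵥ c) I ∈ OS4 q := by
  rw [← mulVec_mulVec]
  exact Cov.dot_mem (map_star_unitary (tmat_mul_conjTranspose q n)) (hX I)
    (cov_flipMat_mulVec q hc)

theorem cov_flipInv_mul_conjTranspose {n : ℕ} {ι : Type*} {X : Matrix ι (Fin (n + 1)) (OS7 q)}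
    (hX : ∀ I, Cov q (tmat q n) (X I)) (I : ι) :
    Cov q (tmat q n) (fun k => (emb (OS7 q) (flipInv q n) * X.conjTranspose) k I) :=
  cov_flipInv_mulVec q (hX I).star

theorem flipInv_conjTranspose_mul_flipMat {n : ℕ} {ι : Type*} [Fintype ι]
    {X : Matrix ι (Fin (n + 1)) (OS7 q)} (hX : X.conjTranspose * X = 1) :
    emb (OS7 q) (flipInv q n) * X.conjTranspose * (X * emb (OS7 q) (flipMat q n)) = 1 := by
  rw [Matrix.mul_assoc, ← Matrix.mul_assoc Xᴴ, hX, Matrix.one_mul, ← emb_mul,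
    flipInv_mul_flipMat, emb_one]

theorem mul_flipMat_mul_flipInv {n : ℕ} {ι : Type*} (X : Matrix ι (Fin (n + 1)) (OS7 q)) :
    X * emb (OS7 q) (flipMat q n) * (emb (OS7 q) (flipInv q n) * X.conjTranspose) =
      X * X.conjTranspose := by
  rw [Matrix.mul_assoc, ← Matrix.mul_assoc (emb _ _), ← emb_mul, flipMat_mul_flipInv, emb_one,
    Matrix.one_mul]

/-- The module of `P_n` is `E_n`. -/
def projModuleEquivE (n : ℕ) : projModule q (P q n) ≃ₗ[(OS4 q)ᵐᵒᵖ] E q n :=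
  (LinearEquiv.ofEq _ _ (by rw [mul_flipMat_mul_flipInv, P])).trans
    (cotensorEquivProjModule (flipInv_conjTranspose_mul_flipMat q (U_isometry q n))
      (fun _ hc => dot_flipMat_mem q (cov_U q n) hc)
      (cov_flipInv_mul_conjTranspose q (cov_U q n))).symm

/-- Supplies the contragredience hypothesis of `exists_balTensor_equiv` for E_1: t_n conjugated by
`flipMat` is contragredient to t_n. The intertwining relation may be transposed because one factor
of each product is scalar. -/
theorem flip_contragredient (n : ℕ) :
    emb (OSU2 q) (flipInv q n) * tmat q n * emb (OSU2 q) (flipMat q n) * (tmat q n).transpose =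
      1 := by
  have h : emb (OSU2 q) (flipMat q n) * (tmat q n).transpose =
      (tmat q n).conjTranspose * emb (OSU2 q) (flipMat q n) := by
    ext i j
    have := congrFun (congrFun (tmat_mul_flipMat q n) j) i
    simp only [mul_apply, emb_apply, transpose_apply, map_apply, conjTranspose_apply] at this ⊢
    simp only [Algebra.commutes, this]
  rw [Matrix.mul_assoc, h, ← Matrix.mul_assoc, Matrix.mul_assoc (emb _ _),
    tmat_mul_conjTranspose, Matrix.mul_one, ← emb_mul, flipInv_mul_flipMat, emb_one]

theorem symPart_eq {n : ℕ} (a : Fin 2 → OS7 q) (b : Fin (n + 1) → OS7 q) (k : Fin (n + 2)) :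
    symPart q a b k =
      (emb (OS7 q) (symMat q n).conjTranspose *ᵥ fun i => a i.1 * b i.2) k := by
  rw [symMat_conjTranspose]
  simp only [mulVec, dotProduct, emb_apply, ← Algebra.smul_def, transpose_apply, symMat, ite_smul,
    zero_smul, Fintype.sum_prod_type, symPart]

theorem asymPart_eq {n : ℕ} (a : Fin 2 → OS7 q) (b : Fin (n + 1) → OS7 q) (k : Fin n) :
    asymPart q a b k =
      (emb (OS7 q) (asymMat q n).conjTranspose *ᵥ fun i => a i.1 * b i.2) k := by
  rw [asymMat_conjTranspose]
  simp only [mulVec, dotProduct, emb_apply, ← Algebra.smul_def, transpose_apply, asymMat, ite_smul,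
    zero_smul, Fintype.sum_prod_type, asymPart]

/-- Two mutually orthogonal pairs `(X₁, Y₁)`, `(X₂, Y₂)` are glued into one pair along the
orthogonal decomposition given by `S` and `A`. -/
theorem mul_glue {R ι κ α β : Type*} [Ring R] [Fintype ι] [Fintype κ] [Fintype α] [Fintype β]
    [DecidableEq κ] [DecidableEq α] [DecidableEq β] {S : Matrix κ α R} {S' : Matrix α κ R}
    {A : Matrix κ β R} {A' : Matrix β κ R} {X₁ : Matrix ι α R} {Y₁ : Matrix α ι R}
    {X₂ : Matrix ι β R} {Y₂ : Matrix β ι R} (h11 : Y₁ * X₁ = 1) (h22 : Y₂ * X₂ = 1)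
    (h12 : Y₁ * X₂ = 0) (h21 : Y₂ * X₁ = 0) (hSS : S' * S = 1) (hAA : A' * A = 1)
    (hSA : S' * A = 0) (hAS : A' * S = 0) (hone : S * S' + A * A' = 1) :
    (S * Y₁ + A * Y₂) * (X₁ * S' + X₂ * A') = 1 ∧
      (X₁ * S' + X₂ * A') * (S * Y₁ + A * Y₂) = X₁ * Y₁ + X₂ * Y₂ := by
  constructor
  · rw [← hone]
    simp only [Matrix.mul_add, Matrix.add_mul, Matrix.mul_assoc]
    rw [← Matrix.mul_assoc Y₁, ← Matrix.mul_assoc Y₁, ← Matrix.mul_assoc Y₂,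
      ← Matrix.mul_assoc Y₂, h11, h12, h21, h22]
    simp
  · simp only [Matrix.mul_add, Matrix.add_mul, Matrix.mul_assoc]
    rw [← Matrix.mul_assoc S', ← Matrix.mul_assoc S', ← Matrix.mul_assoc A',
      ← Matrix.mul_assoc A', hSS, hAA, hSA, hAS]
    simp

/-- Products a_i b_l form a covariant vector for t_1 ⊗ t_{m+1}. S^* and A^* split it into its
V_{m+2} and V_m components, which U and W, twisted by `flipMat`, send into the images of P_{m+2} and
Q_m. The factors (-q)^k and the reversed indices are the entries of `flipMat`. -/
theorem exists_product_equiv (m : ℕ) :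
    ∃ Φ : BalTensor (OS4 q) (E q 1) (E q (m + 1)) ≃ₗ[(OS4 q)ᵐᵒᵖ]
        projModule q (P q (m + 2) + Q q m),
      ∀ (a : E q 1) (b : E q (m + 1)) (J : Fin (m + 2) → Fin 4),
        (Φ (BalTensor.tmul (OS4 q) a b)).1 J =
          ∑ k : Fin (m + 3), (-q.c) ^ k.1 • (U q (m + 2) J k * symPart q a.1 b.1 k.rev) +
          ∑ k : Fin (m + 1), (-q.c) ^ k.1 • (W q m J k * asymPart q a.1 b.1 k.rev) := by
  let S := symMat q (m + 1)
  let A := asymMat q (m + 1)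
  let X₁ := U q (m + 2) * emb (OS7 q) (flipMat q (m + 2))
  let X₂ := W q m * emb (OS7 q) (flipMat q m)
  let Y₁ := emb (OS7 q) (flipInv q (m + 2)) * (U q (m + 2))ᴴ
  let Y₂ := emb (OS7 q) (flipInv q m) * (W q m)ᴴ
  have hS : S.conjTranspose.transpose = S := by
    rw [symMat_conjTranspose, transpose_transpose]
  have hA : A.conjTranspose.transpose = A := by
    rw [asymMat_conjTranspose, transpose_transpose]
  have h11 : Y₁ * X₁ = 1 := flipInv_conjTranspose_mul_flipMat q (U_isometry q (m + 2))
  have h22 : Y₂ * X₂ = 1 := flipInv_conjTranspose_mul_flipMat q (W_isometry q m)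
  have h12 : Y₁ * X₂ = 0 := by
    simp only [Y₁, X₂]
    rw [Matrix.mul_assoc, ← Matrix.mul_assoc _ᴴ, U_conjTranspose_mul_W, Matrix.zero_mul,
      Matrix.mul_zero]
  have h21 : Y₂ * X₁ = 0 := by
    simp only [Y₂, X₁]
    rw [Matrix.mul_assoc, ← Matrix.mul_assoc _ᴴ, W_conjTranspose_mul_U, Matrix.zero_mul,
      Matrix.mul_zero]
  have hSS : emb (OS7 q) S.conjTranspose * emb (OS7 q) S = 1 := by
    rw [← emb_mul, (symMat_isometry q _).1, emb_one]
  have hAA : emb (OS7 q) A.conjTranspose * emb (OS7 q) A = 1 := by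
    rw [← emb_mul, (symMat_isometry q _).2.1, emb_one]
  have hSA : emb (OS7 q) S.conjTranspose * emb (OS7 q) A = 0 := by
    rw [← emb_mul, (symMat_isometry q _).2.2, emb_zero]
  have hAS : emb (OS7 q) A.conjTranspose * emb (OS7 q) S = 0 := by
    rw [← emb_mul, ← conjTranspose_conjTranspose S, ← conjTranspose_mul,
      (symMat_isometry q _).2.2, conjTranspose_zero, emb_zero]
  have hone : emb (OS7 q) S * emb (OS7 q) S.conjTranspose +
      emb (OS7 q) A * emb (OS7 q) A.conjTranspose = 1 := by
    rw [← emb_mul, ← emb_mul, ← emb_add, symMat_add_asymMat, emb_one]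
  let Z := X₁ * emb (OS7 q) S.conjTranspose + X₂ * emb (OS7 q) A.conjTranspose
  let Z' := emb (OS7 q) S * Y₁ + emb (OS7 q) A * Y₂
  obtain ⟨hZ'Z, hZZ'⟩ := mul_glue h11 h22 h12 h21 hSS hAA hSA hAS hone
  have e1 : X₁ * Y₁ = P q (m + 2) := mul_flipMat_mul_flipInv q _
  have e2 : X₂ * Y₂ = Q q m := mul_flipMat_mul_flipInv q _
  rw [e1, e2] at hZZ'
  have hT1 : kron (tmat q 1) (tmat q (m + 1)) = kron (OSU2.t₁ q) (tmat q (m + 1)) := by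
    rw [tmat_one]
  have hZ : ∀ c, Cov q (kron (tmat q 1) (tmat q (m + 1))) c → ∀ J, (Z *ᵥ c) J ∈ OS4 q := by
    intro c hc J
    rw [hT1] at hc
    have hsplit : (Z *ᵥ c) J = (X₁ *ᵥ (emb (OS7 q) S.conjTranspose *ᵥ c)) J +
        (X₂ *ᵥ (emb (OS7 q) A.conjTranspose *ᵥ c)) J := by
      rw [mulVec_mulVec, mulVec_mulVec, ← Pi.add_apply, ← add_mulVec]
    have hc₁ : Cov q (tmat q (m + 2)) (emb (OS7 q) S.conjTranspose *ᵥ c) :=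
      hc.emb_mulVec (by rw [hS]; exact kron_mul_symMat q (m + 1))
    have hc₂ : Cov q (tmat q m) (emb (OS7 q) A.conjTranspose *ᵥ c) :=
      hc.emb_mulVec (by rw [hA]; exact kron_mul_asymMat' q m)
    rw [hsplit]
    exact add_mem (dot_flipMat_mem q (cov_U q (m + 2)) hc₁ J)
      (dot_flipMat_mem q (cov_W q m) hc₂ J)
  have hZ' : ∀ J, Cov q (kron (tmat q 1) (tmat q (m + 1))) (fun k => Z' k J) := by
    intro J
    rw [hT1]
    refine Cov.add ?_ ?_
    · refine Cov.emb_mulVec ?_ (cov_flipInv_mul_conjTranspose q (cov_U q (m + 2)) J)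
      rw [← symMat_conjTranspose, emb_conjTranspose]
      exact (symMat_mul_kron q (m + 1)).symm
    · refine Cov.emb_mulVec ?_ (cov_flipInv_mul_conjTranspose q (cov_W q m) J)
      rw [← asymMat_conjTranspose, emb_conjTranspose]
      exact (asymMat_mul_kron q m).symm
  -- Dual bases of E_1 are u composed with `flipMat` and `flipInv` composed with u^*; the rows of
  -- the former are covariant for the conjugate of t_1 by `flipMat`.
  obtain ⟨Φ, hΦ⟩ := exists_balTensor_equiv (T := tmat q 1) (R := tmat q (m + 1))
    (flipInv_conjTranspose_mul_flipMat q (U_isometry q 1)) (flip_contragredient q 1)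
    (fun I => Cov.mul_emb (by
      rw [← Matrix.mul_assoc, ← Matrix.mul_assoc, ← emb_mul, flipMat_mul_flipInv, emb_one,
        Matrix.one_mul]) (cov_U q 1 I))
    (cov_flipInv_mul_conjTranspose q (cov_U q 1)) hZ'Z hZ hZ' hZZ'.symm
  refine ⟨Φ, fun a b J => ?_⟩
  rw [hΦ]
  simp only [symPart_eq, asymPart_eq]
  rw [← mul_flipMat_mulVec, ← mul_flipMat_mulVec, mulVec_mulVec, mulVec_mulVec]
  exact congrFun (add_mulVec _ _ _) J

end QS4
end

noncomputable section

/-! ## Trace class operators -/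

section TraceClass

open InnerProductSpace

variable {𝓗 : Type*} [NormedAddCommGroup 𝓗] [InnerProductSpace ℂ 𝓗] {ι : Type*}
  (e : HilbertBasis ι ℂ 𝓗)

theorem IsTraceClass.zero : IsTraceClass (0 : 𝓗 →L[ℂ] 𝓗) :=
  ⟨0, 0, by simp, fun v => by simp⟩

/-- Cauchy–Schwarz followed by Bessel's inequality for each vector. -/
theorem sum_norm_inner_mul_le (y z : 𝓗) (s : Finset ι) :
    ∑ i ∈ s, ‖inner ℂ y (e i) * inner ℂ (e i) z‖ ≤ ‖y‖ * ‖z‖ := by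
  have hb : ∀ x : 𝓗, ∑ i ∈ s, ‖inner ℂ (e i) x‖ ^ 2 ≤ ‖x‖ ^ 2 := fun x =>
    e.orthonormal.sum_inner_products_le x
  have h := Finset.sum_mul_sq_le_sq_mul_sq s (fun i => ‖inner ℂ (e i) y‖)
    (fun i => ‖inner ℂ (e i) z‖)
  have h2 : ∑ i ∈ s, ‖inner ℂ y (e i) * inner ℂ (e i) z‖ =
      ∑ i ∈ s, ‖inner ℂ (e i) y‖ * ‖inner ℂ (e i) z‖ :=
    Finset.sum_congr rfl fun i _ => by rw [norm_mul, norm_inner_symm]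
  rw [h2]
  refine abs_le_of_sq_le_sq' ?_ (by positivity) |>.2
  calc _ ≤ _ := h
    _ ≤ ‖y‖ ^ 2 * ‖z‖ ^ 2 := mul_le_mul (hb y) (hb z) (Finset.sum_nonneg fun i _ => by positivity)
        (by positivity)
    _ = _ := by ring

/-- The trace of an operator in a Hilbert basis. -/
def opTrace (T : 𝓗 →L[ℂ] 𝓗) : ℂ := ∑' i, inner ℂ (e i) (T (e i))

theorem opTrace_smul (c : ℂ) (T : 𝓗 →L[ℂ] 𝓗) : opTrace e (c • T) = c * opTrace e T := by
  simp only [opTrace, smul_apply, inner_smul_right, tsum_mul_left]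

theorem opTrace_zero : opTrace e (0 : 𝓗 →L[ℂ] 𝓗) = 0 := by
  simp [opTrace]

/-- The double series of ⟨y_k, e_i⟩⟨e_i, z_k⟩ converges absolutely. Summing over i first gives ⟨y_k,
z_k⟩ by Parseval, summing over k first gives ⟨e_i, T e_i⟩. -/
theorem hasSum_trace_of_hasSum_rankOne {T : 𝓗 →L[ℂ] 𝓗} {y z : ℕ → 𝓗}
    (hs : Summable (fun k => ‖y k‖ * ‖z k‖)) (h : HasSum (fun k => rankOne ℂ (z k) (y k)) T) :
    HasSum (fun i => inner ℂ (e i) (T (e i))) (∑' k, inner ℂ (y k) (z k)) := by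
  have hprod : Summable fun p : ℕ × ι => inner ℂ (y p.1) (e p.2) * inner ℂ (e p.2) (z p.1) := by
    refine Summable.of_norm ((summable_prod_of_nonneg fun _ => norm_nonneg _).2 ⟨fun k => ?_, ?_⟩)
    · exact summable_of_sum_le (fun _ => norm_nonneg _) (sum_norm_inner_mul_le e (y k) (z k))
    · exact Summable.of_nonneg_of_le (fun k => tsum_nonneg fun _ => norm_nonneg _)
        (fun k => tsum_le_of_sum_le' (by positivity) (sum_norm_inner_mul_le e (y k) (z k))) hs
  have h1 : HasSum (fun p : ℕ × ι => inner ℂ (y p.1) (e p.2) * inner ℂ (e p.2) (z p.1))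
      (∑' k, inner ℂ (y k) (z k)) := by
    have h2 := hprod.hasSum.prod_fiberwise fun k => e.hasSum_inner_mul_inner (y k) (z k)
    rw [h2.tsum_eq]
    exact hprod.hasSum
  have h3 := (Equiv.prodComm ι ℕ).hasSum_iff.2 h1
  refine h3.prod_fiberwise fun i => ?_
  have h4 := (innerSL ℂ (e i)).hasSum ((ContinuousLinearMap.apply ℂ 𝓗 (e i)).hasSum h)
  simpa [inner_smul_right] using h4

variable {e} [CompleteSpace 𝓗]

/-- The rank-one terms have norm ‖y_k‖‖z_k‖, so the series converges in operator norm, not only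
pointwise; it can then be multiplied by bounded operators and adjoined termwise. -/
theorem isTraceClass_iff {T : 𝓗 →L[ℂ] 𝓗} : IsTraceClass T ↔ ∃ y z : ℕ → 𝓗,
    Summable (fun k => ‖y k‖ * ‖z k‖) ∧ HasSum (fun k => rankOne ℂ (z k) (y k)) T := by
  constructor
  · rintro ⟨y, z, hs, h⟩
    refine ⟨y, z, hs, ?_⟩
    have hs' : Summable (fun k => rankOne ℂ (z k) (y k)) := by
      refine Summable.of_norm ?_
      simpa only [norm_rankOne, mul_comm] using hs
    have hT : ∑' k, rankOne ℂ (z k) (y k) = T := by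
      ext v
      exact ((ContinuousLinearMap.apply ℂ 𝓗 v).hasSum hs'.hasSum).unique (h v)
    exact hT ▸ hs'.hasSum
  · rintro ⟨y, z, hs, h⟩
    refine ⟨y, z, hs, fun v => ?_⟩
    have := (ContinuousLinearMap.apply ℂ 𝓗 v).hasSum h
    simpa only [ContinuousLinearMap.apply_apply, rankOne_apply] using this

theorem isTraceClass_of_equiv {κ : Type*} (e : ℕ ≃ κ) {T : 𝓗 →L[ℂ] 𝓗} (y z : κ → 𝓗)
    (hs : Summable (fun k => ‖y k‖ * ‖z k‖)) (h : HasSum (fun k => rankOne ℂ (z k) (y k)) T) :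
    IsTraceClass T := by
  have h1 := (Equiv.hasSum_iff e).2 h
  have h2 := (Equiv.summable_iff e).2 hs
  exact isTraceClass_iff.2 ⟨fun n => y (e n), fun n => z (e n), h2, h1⟩

theorem IsTraceClass.add {S T : 𝓗 →L[ℂ] 𝓗} (hS : IsTraceClass S) (hT : IsTraceClass T) :
    IsTraceClass (S + T) := by
  obtain ⟨y, z, hs, h⟩ := isTraceClass_iff.1 hS
  obtain ⟨y', z', hs', h'⟩ := isTraceClass_iff.1 hT
  refine isTraceClass_of_equiv Equiv.natSumNatEquivNat.symm (Sum.elim y y') (Sum.elim z z') ?_ ?_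
  · exact Summable.sum (f := fun k => ‖Sum.elim y y' k‖ * ‖Sum.elim z z' k‖) hs hs'
  · exact HasSum.sum (f := fun k => rankOne ℂ (Sum.elim z z' k) (Sum.elim y y' k)) h h'

theorem IsTraceClass.mul_left {T : 𝓗 →L[ℂ] 𝓗} (hT : IsTraceClass T) (S : 𝓗 →L[ℂ] 𝓗) :
    IsTraceClass (S * T) := by
  obtain ⟨y, z, hs, h⟩ := isTraceClass_iff.1 hT
  refine isTraceClass_iff.2 ⟨y, fun k => S (z k), ?_, ?_⟩
  · refine Summable.of_nonneg_of_le (fun k => by positivity) (fun k => ?_) (hs.mul_left ‖S‖)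
    calc ‖y k‖ * ‖S (z k)‖ ≤ ‖y k‖ * (‖S‖ * ‖z k‖) := by gcongr; exact S.le_opNorm _
      _ = _ := by ring
  · have := h.mul_left S
    simpa only [ContinuousLinearMap.mul_def, comp_rankOne] using this

theorem IsTraceClass.mul_right {T : 𝓗 →L[ℂ] 𝓗} (hT : IsTraceClass T) (S : 𝓗 →L[ℂ] 𝓗) :
    IsTraceClass (T * S) := by
  obtain ⟨y, z, hs, h⟩ := isTraceClass_iff.1 hT
  refine isTraceClass_iff.2 ⟨fun k => ContinuousLinearMap.adjoint S (y k), z, ?_, ?_⟩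
  · refine Summable.of_nonneg_of_le (fun k => by positivity) (fun k => ?_)
      (hs.mul_left ‖ContinuousLinearMap.adjoint S‖)
    calc ‖ContinuousLinearMap.adjoint S (y k)‖ * ‖z k‖ ≤
          (‖ContinuousLinearMap.adjoint S‖ * ‖y k‖) * ‖z k‖ := by
          gcongr; exact ContinuousLinearMap.le_opNorm _ _
      _ = _ := by ring
  · have := h.mul_right S
    simpa only [ContinuousLinearMap.mul_def, rankOne_comp] using this

theorem IsTraceClass.star {T : 𝓗 →L[ℂ] 𝓗} (hT : IsTraceClass T) : IsTraceClass (star T) := by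
  obtain ⟨y, z, hs, h⟩ := isTraceClass_iff.1 hT
  refine isTraceClass_iff.2 ⟨z, y, by simpa only [mul_comm] using hs, ?_⟩
  have := h.star
  simpa only [ContinuousLinearMap.star_eq_adjoint, adjoint_rankOne] using this

variable (𝓗) in
/-- The ideal of trace class operators. -/
def traceClassIdeal : Ideal (𝓗 →L[ℂ] 𝓗) where
  carrier := {T | IsTraceClass T}
  add_mem' := IsTraceClass.add
  zero_mem' := IsTraceClass.zero
  smul_mem' S _ hT := hT.mul_left S

instance : (traceClassIdeal 𝓗).IsTwoSided where
  mul_mem_of_left S hT := IsTraceClass.mul_right hT S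

variable (e)

theorem IsTraceClass.hasSum_opTrace {T : 𝓗 →L[ℂ] 𝓗} (hT : IsTraceClass T) :
    HasSum (fun i => inner ℂ (e i) (T (e i))) (opTrace e T) := by
  obtain ⟨y, z, hs, h⟩ := isTraceClass_iff.1 hT
  exact (hasSum_trace_of_hasSum_rankOne e hs h).summable.hasSum

theorem IsTraceClass.hasTrace {T : 𝓗 →L[ℂ] 𝓗} (hT : IsTraceClass T) {t : ℂ}
    (ht : opTrace e T = t) : HasTrace e T t :=
  ⟨hT, ht ▸ hT.hasSum_opTrace e⟩

theorem opTrace_add {S T : 𝓗 →L[ℂ] 𝓗} (hS : IsTraceClass S) (hT : IsTraceClass T) :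
    opTrace e (S + T) = opTrace e S + opTrace e T := by
  have := (hS.hasSum_opTrace e).add (hT.hasSum_opTrace e)
  simp only [← inner_add_right] at this
  exact this.tsum_eq

theorem opTrace_sum {κ : Type*} (s : Finset κ) {T : κ → 𝓗 →L[ℂ] 𝓗}
    (hT : ∀ k, IsTraceClass (T k)) : opTrace e (∑ k ∈ s, T k) = ∑ k ∈ s, opTrace e (T k) := by
  classical
  induction s using Finset.induction_on with
  | empty => simp [opTrace_zero]
  | insert a s ha ih =>
    rw [Finset.sum_insert ha, Finset.sum_insert ha, ← ih]
    exact opTrace_add e (hT a) ((traceClassIdeal 𝓗).sum_mem fun k _ => hT k)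

/-- For T = ∑ ⟨y_k, ·⟩ z_k the two traces are ∑ ⟨S^* y_k, z_k⟩ and ∑ ⟨y_k, S z_k⟩. -/
theorem opTrace_mul_comm {T : 𝓗 →L[ℂ] 𝓗} (hT : IsTraceClass T) (S : 𝓗 →L[ℂ] 𝓗) :
    opTrace e (T * S) = opTrace e (S * T) := by
  obtain ⟨y, z, hs, h⟩ := isTraceClass_iff.1 hT
  have h1 : HasSum (fun k => rankOne ℂ (z k) (ContinuousLinearMap.adjoint S (y k))) (T * S) := by
    simpa only [ContinuousLinearMap.mul_def, rankOne_comp] using h.mul_right S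
  have h2 : HasSum (fun k => rankOne ℂ (S (z k)) (y k)) (S * T) := by
    simpa only [ContinuousLinearMap.mul_def, comp_rankOne] using h.mul_left S
  have hs1 : Summable (fun k => ‖ContinuousLinearMap.adjoint S (y k)‖ * ‖z k‖) := by
    refine Summable.of_nonneg_of_le (fun k => by positivity) (fun k => ?_)
      (hs.mul_left ‖ContinuousLinearMap.adjoint S‖)
    rw [← mul_assoc]
    gcongr
    exact ContinuousLinearMap.le_opNorm _ _
  have hs2 : Summable (fun k => ‖y k‖ * ‖S (z k)‖) := by
    refine Summable.of_nonneg_of_le (fun k => by positivity) (fun k => ?_) (hs.mul_left ‖S‖)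
    rw [mul_left_comm]
    gcongr
    exact ContinuousLinearMap.le_opNorm _ _
  rw [opTrace, opTrace, (hasSum_trace_of_hasSum_rankOne e hs1 h1).tsum_eq,
    (hasSum_trace_of_hasSum_rankOne e hs2 h2).tsum_eq]
  simp only [ContinuousLinearMap.adjoint_inner_left]

end TraceClass
end

noncomputable section

/-! ## Homomorphisms out of algebras given by generators and relations -/

namespace StarAlg

variable {ι : Type} {r : FreeStar ι → FreeStar ι → Prop}

theorem algHom_ext {D : Type*} [Ring D] [Algebra ℂ D] {F G : StarAlg r →ₐ[ℂ] D}
    (h : ∀ i, F (gen i) = G (gen i)) (h' : ∀ i, F (star (gen i)) = G (star (gen i))) : F = G := by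
  refine AlgHom.ext fun a => ?_
  obtain ⟨a, rfl⟩ := mk_surjective a
  induction a using FreeStar.induct with
  | h1 c => rw [AlgHom.commutes, AlgHom.commutes, AlgHom.commutes]
  | h2 s =>
    cases s with
    | inl i => exact h i
    | inr i =>
      have : mk (r := r) (FreeStar.sym (Sum.inr i)) = star (gen i) := by
        rw [← mk_gen, ← mk_star, FreeStar.gen, FreeStar.star_sym]; rfl
      rw [this, h']
  | h3 a b ha hb => rw [map_mul, map_mul, map_mul, ha, hb]
  | h4 a b ha hb => rw [map_add, map_add, map_add, ha, hb]

/-- No involution is put on the quotient; stability of `I` under the involution takes care of the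
adjoint relations. -/
theorem exists_lift_quotient {C : Type*} [Ring C] [Algebra ℂ C] [StarRing C] [StarModule ℂ C]
    (I : Ideal C) [I.IsTwoSided] (hI : ∀ a ∈ I, star a ∈ I) (f : ι → C)
    (h : ∀ a b, r a b → FreeStar.lift f a - FreeStar.lift f b ∈ I) :
    ∃ g : StarAlg r →ₐ[ℂ] C ⧸ I, ∀ i, g (gen i) = Ideal.Quotient.mkₐ ℂ I (f i) ∧
      g (star (gen i)) = Ideal.Quotient.mkₐ ℂ I (star (f i)) := by
  let F : FreeStar ι →ₐ[ℂ] C ⧸ I := (Ideal.Quotient.mkₐ ℂ I).comp (FreeStar.lift f).toAlgHom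
  have hF : ∀ ⦃a b⦄, (r a b ∨ r (star a) (star b)) → F a = F b := by
    rintro a b (hab | hab)
    · exact Ideal.Quotient.eq.2 (h a b hab)
    · have := hI _ (h _ _ hab)
      rw [map_star, map_star, ← star_sub, star_star] at this
      exact Ideal.Quotient.eq.2 this
  let g : StarAlg r →ₐ[ℂ] C ⧸ I := RingQuot.liftAlgHom ℂ ⟨F, hF⟩
  have hg : ∀ a, g (mk a) = F a := fun a => RingQuot.liftAlgHom_mkAlgHom_apply ℂ F hF a
  refine ⟨g, fun i => ⟨?_, ?_⟩⟩
  · rw [← mk_gen, hg]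
    exact congrArg _ (FreeStar.lift_gen f i)
  · rw [← mk_gen, ← mk_star, hg]
    change Ideal.Quotient.mkₐ ℂ I (FreeStar.lift f (star _)) = _
    rw [map_star, FreeStar.lift_gen]

end StarAlg

/-! ### The quotient of `O(S^7_q)` by `x_1`, `x_2`: the fibre `O(SU_q(2))` over `ε` -/

namespace OS7

variable (q : QParam)

theorem coaction_x (i : Fin 4) : coaction q (x q i) = coactGen q i := StarAlg.lift_gen _ _ i

theorem counit_x (i : Fin 4) : counit q (x q i) = if i = 3 then 1 else 0 :=
  StarAlg.lift_gen _ _ i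

theorem counit_star_x (i : Fin 4) : counit q (star (x q i)) = if i = 3 then 1 else 0 := by
  rw [map_star, counit_x]
  split_ifs <;> simp

/-- The homomorphism `(ε ⊗ id) δ` to `O(SU_q(2))`. -/
def toSU2 : OS7 q →ₐ[ℂ] OSU2 q :=
  (Algebra.TensorProduct.lid ℂ (OSU2 q)).toAlgHom.comp
    ((Algebra.TensorProduct.map (counit q).toAlgHom (AlgHom.id ℂ (OSU2 q))).comp
      (coaction q).toAlgHom)

/-- The map `ε ⊗ id`. -/
def counitTensor : OS7 q ⊗[ℂ] OSU2 q →ₐ[ℂ] OSU2 q :=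
  (Algebra.TensorProduct.lid ℂ (OSU2 q)).toAlgHom.comp
    (Algebra.TensorProduct.map (counit q).toAlgHom (AlgHom.id ℂ (OSU2 q)))

theorem counitTensor_tmul (a : OS7 q) (h : OSU2 q) :
    counitTensor q (a ⊗ₜ h) = counit q a • h := by
  simp [counitTensor]

theorem toSU2_apply (a : OS7 q) : toSU2 q a = counitTensor q (coaction q a) := rfl

theorem toSU2_of_mem {b : OS7 q} (hb : b ∈ OS4 q) :
    toSU2 q b = algebraMap ℂ (OSU2 q) (counit q b) := by
  rw [toSU2_apply, mem_OS4.1 hb, counitTensor_tmul, Algebra.algebraMap_eq_smul_one]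

theorem toSU2_x (i : Fin 4) : toSU2 q (x q i) = ![0, 0, -OSU2.γ q, star (OSU2.α q)] i := by
  rw [toSU2_apply, coaction_x]
  fin_cases i <;> simp [coactGen, counitTensor_tmul, counit_x]

theorem toSU2_star_x (i : Fin 4) :
    toSU2 q (star (x q i)) = ![0, 0, -star (OSU2.γ q), OSU2.α q] i := by
  rw [toSU2_apply, map_star, coaction_x]
  fin_cases i <;> simp [coactGen, counitTensor_tmul, counit_star_x]

/-- Once x_1 and x_2 vanish, x_4^* and -x_3 satisfy the relations of α and γ, so `toSU2` can be
undone modulo `I`. Hence the class of an element modulo `I` depends only on its image in O(SU_q(2)).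
-/
theorem exists_section (I : Ideal (OS7 q)) [I.IsTwoSided] (hI : ∀ a ∈ I, star a ∈ I)
    (h0 : x q 0 ∈ I) (h1 : x q 1 ∈ I) :
    ∃ g : OSU2 q →ₐ[ℂ] OS7 q ⧸ I, g.comp (toSU2 q) = Ideal.Quotient.mkₐ ℂ I := by
  have e0 : Ideal.Quotient.mkₐ ℂ I (x q 0) = 0 := Ideal.Quotient.eq_zero_iff_mem.2 h0
  have e1 : Ideal.Quotient.mkₐ ℂ I (x q 1) = 0 := Ideal.Quotient.eq_zero_iff_mem.2 h1
  have e0' : Ideal.Quotient.mkₐ ℂ I (star (x q 0)) = 0 :=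
    Ideal.Quotient.eq_zero_iff_mem.2 (hI _ h0)
  have e1' : Ideal.Quotient.mkₐ ℂ I (star (x q 1)) = 0 :=
    Ideal.Quotient.eq_zero_iff_mem.2 (hI _ h1)
  have r34' : star (x q 3) * star (x q 2) = q.c • (star (x q 2) * star (x q 3)) := by
    simpa using congrArg star (r34 q)
  have k1 := congrArg (Ideal.Quotient.mkₐ ℂ I) r34'
  have k2 := congrArg (Ideal.Quotient.mkₐ ℂ I) (r34 q)
  have k3 := congrArg (Ideal.Quotient.mkₐ ℂ I) (s34 q)
  have k4 := congrArg (Ideal.Quotient.mkₐ ℂ I) (s43 q)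
  have k5 := congrArg (Ideal.Quotient.mkₐ ℂ I) (s33 q)
  have k6 := congrArg (Ideal.Quotient.mkₐ ℂ I) (sphere q)
  have k7 := congrArg (Ideal.Quotient.mkₐ ℂ I) (sphere' q)
  simp only [map_mul, map_add, map_sub, map_smul, map_one, e0, e1, e0', e1', mul_zero, zero_mul,
    smul_zero, sub_zero, add_zero, zero_add] at k1 k2 k3 k4 k5 k6 k7
  obtain ⟨g, hg⟩ := StarAlg.exists_lift_quotient (r := SUq2.Rel q) I hI
    ![star (x q 3), -x q 2] (by
      intro a b hab
      rw [← Ideal.Quotient.eq]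
      change Ideal.Quotient.mkₐ ℂ I _ = Ideal.Quotient.mkₐ ℂ I _
      cases hab with
      | mul_star i j =>
        fin_cases i <;> fin_cases j <;>
          simp [Matrix.mul_apply, Fin.sum_univ_two, SUq2.fund, SUq2.freeFund, map_star,
            smul_smul, -Ideal.Quotient.mkₐ_eq_mk]
        all_goals
          simp only [k1, k2, k3, k4, k5, k6, k7]
          module
      | star_mul i j =>
        fin_cases i <;> fin_cases j <;>
          simp [Matrix.mul_apply, Fin.sum_univ_two, SUq2.fund, SUq2.freeFund, map_star,
            smul_smul, -Ideal.Quotient.mkₐ_eq_mk]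
        all_goals
          simp only [k1, k2, k3, k4, k5, k6, k7]
          module)
  refine ⟨g, StarAlg.algHom_ext (fun i => ?_) fun i => ?_⟩
  · change g (toSU2 q (x q i)) = Ideal.Quotient.mkₐ ℂ I (x q i)
    rw [toSU2_x]
    have ha := (hg 0).2
    have hc := (hg 1).1
    change g (star (OSU2.α q)) = _ at ha
    change g (OSU2.γ q) = _ at hc
    fin_cases i
    · simp [e0, -Ideal.Quotient.mkₐ_eq_mk]
    · simp [e1, -Ideal.Quotient.mkₐ_eq_mk]
    · simp [hc, -Ideal.Quotient.mkₐ_eq_mk]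
    · simp [ha, -Ideal.Quotient.mkₐ_eq_mk]
  · change g (toSU2 q (star (x q i))) = Ideal.Quotient.mkₐ ℂ I (star (x q i))
    rw [toSU2_star_x]
    have ha := (hg 0).1
    have hc := (hg 1).2
    change g (OSU2.α q) = _ at ha
    change g (star (OSU2.γ q)) = _ at hc
    fin_cases i
    · simp [e0', -Ideal.Quotient.mkₐ_eq_mk]
    · simp [e1', -Ideal.Quotient.mkₐ_eq_mk]
    · simp [hc, -Ideal.Quotient.mkₐ_eq_mk]
    · simp [ha, -Ideal.Quotient.mkₐ_eq_mk]

end OS7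
end

noncomputable section

/-! ## The trace on the quantum 4-sphere -/

/-- Expand v in the basis: T v = ∑ ⟨e_i, v⟩ T e_i. -/
theorem isTraceClass_of_summable_norm {𝓗 : Type*} [NormedAddCommGroup 𝓗]
    [InnerProductSpace ℂ 𝓗] {ι : Type*} (e : HilbertBasis ι ℂ 𝓗) (f : ℕ ≃ ι) {T : 𝓗 →L[ℂ] 𝓗}
    (h : Summable fun i => ‖T (e i)‖) : IsTraceClass T := by
  refine ⟨fun n => e (f n), fun n => T (e (f n)), ?_, fun v => ?_⟩
  · simpa only [e.orthonormal.1, one_mul, Function.comp_def] using (Equiv.summable_iff f).2 h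
  · have := ((Equiv.hasSum_iff f).2 (e.hasSum_repr v)).mapL T
    simpa only [Function.comp_def, map_smul, e.repr_apply_apply] using this

namespace QS4

open OS7 Matrix

variable (q : QParam)

theorem summable_pow_weight : Summable fun k : ℕ × ℕ => (q : ℝ) ^ (k.1 + 2 * k.2) := by
  have h1 := summable_geometric_of_lt_one q.2.1.le q.2.2
  have h2 := summable_geometric_of_lt_one (pow_nonneg q.2.1.le 2)
    (pow_lt_one₀ q.2.1.le q.2.2 two_ne_zero)
  have := h1.mul_of_nonneg h2 (fun k => pow_nonneg q.2.1.le k)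
    (fun k => pow_nonneg (pow_nonneg q.2.1.le 2) k)
  simpa only [pow_add, pow_mul] using this

theorem hasSum_sq_pow_weight : HasSum (fun k : ℕ × ℕ => ((q : ℝ) ^ (k.1 + 2 * k.2)) ^ 2)
    ((1 - (q : ℝ) ^ 2)⁻¹ * (1 - (q : ℝ) ^ 4)⁻¹) := by
  have hq := q.2.1.le
  have h1 := hasSum_geometric_of_lt_one (pow_nonneg hq 2) (pow_lt_one₀ hq q.2.2 two_ne_zero)
  have h2 := hasSum_geometric_of_lt_one (pow_nonneg hq 4) (pow_lt_one₀ hq q.2.2 four_ne_zero)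
  have hs := h1.summable.mul_of_nonneg h2.summable (fun k => pow_nonneg (pow_nonneg hq 2) k)
    (fun k => pow_nonneg (pow_nonneg hq 4) k)
  have h3 : (fun k : ℕ × ℕ => ((q : ℝ) ^ (k.1 + 2 * k.2)) ^ 2) =
      fun k => ((q : ℝ) ^ 2) ^ k.1 * ((q : ℝ) ^ 4) ^ k.2 := by
    funext k
    ring
  rw [h3]
  exact h1.mul h2 hs

/-- The operator `π(b) - ε(b)`. -/
def fredholmDiff (π : OS7 q →⋆ₐ[ℂ] (L2 →L[ℂ] L2)) (b : OS7 q) : L2 →L[ℂ] L2 :=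
  π b - counit q b • 1

/-- The trace of `π(b) - ε(b)`. -/
def chTrace (π : OS7 q →⋆ₐ[ℂ] (L2 →L[ℂ] L2)) (b : OS7 q) : ℂ :=
  opTrace ketBasis (fredholmDiff q π b)

variable {q} {π : OS7 q →⋆ₐ[ℂ] (L2 →L[ℂ] L2)}

theorem pi_x1_ketBasis (hπ : IsRepPi q π) (k : ℕ × ℕ) :
    π (x q 1) (ketBasis k) = q.c ^ (k.1 + 2 * k.2) • ketBasis k := by
  rw [← Prod.mk.eta (p := k), ketBasis_apply, hπ.x2]

theorem isTraceClass_pi_x1 (hπ : IsRepPi q π) : IsTraceClass (π (x q 1)) := by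
  refine isTraceClass_of_summable_norm ketBasis Nat.pairEquiv.symm ?_
  refine (summable_pow_weight q).congr fun k => ?_
  rw [pi_x1_ketBasis hπ, norm_smul, ketBasis.orthonormal.1, mul_one, norm_pow, QParam.c,
    Complex.norm_real, Real.norm_of_nonneg q.2.1.le]

/-- The elements that π sends to trace class operators form a *-stable two-sided ideal containing
x_1 and x_2. Modulo it, `exists_section` makes b depend only on `toSU2 q b`, which for coinvariant b
is the scalar ε(b). -/
theorem isTraceClass_fredholmDiff (hπ : IsRepPi q π) {b : OS7 q} (hb : b ∈ OS4 q) :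
    IsTraceClass (fredholmDiff q π b) := by
  let I : Ideal (OS7 q) := (traceClassIdeal L2).comap π
  have hI : ∀ a, a ∈ I ↔ IsTraceClass (π a) := fun a => Iff.rfl
  obtain ⟨g, hg⟩ := exists_section q I
    (fun a ha => by rw [hI, map_star]; exact IsTraceClass.star ha)
    (by rw [hI, hπ.x1]; exact .zero) ((hI _).2 (isTraceClass_pi_x1 hπ))
  have h : Ideal.Quotient.mkₐ ℂ I b = Ideal.Quotient.mkₐ ℂ I (algebraMap ℂ _ (counit q b)) := by
    rw [← hg, AlgHom.comp_apply, toSU2_of_mem q hb, AlgHom.commutes, AlgHom.commutes]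
  have h2 := (hI _).1 (Ideal.Quotient.eq.1 h)
  rwa [map_sub, AlgHomClass.commutes, Algebra.algebraMap_eq_smul_one] at h2

theorem chTrace_add (hπ : IsRepPi q π) {a b : OS7 q} (ha : a ∈ OS4 q) (hb : b ∈ OS4 q) :
    chTrace q π (a + b) = chTrace q π a + chTrace q π b := by
  rw [chTrace, chTrace, chTrace, ← opTrace_add ketBasis (isTraceClass_fredholmDiff hπ ha)
    (isTraceClass_fredholmDiff hπ hb)]
  congr 1
  simp only [fredholmDiff, map_add, add_smul]
  abel

theorem fredholmDiff_sum {ι : Type*} (s : Finset ι) (f : ι → OS7 q) :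
    fredholmDiff q π (∑ i ∈ s, f i) = ∑ i ∈ s, fredholmDiff q π (f i) := by
  simp only [fredholmDiff, map_sum, Finset.sum_smul, Finset.sum_sub_distrib]

theorem chTrace_sum (hπ : IsRepPi q π) {ι : Type*} (s : Finset ι) {f : ι → OS7 q} (hf : ∀ i, f i ∈ OS4 q) :
    chTrace q π (∑ i ∈ s, f i) = ∑ i ∈ s, chTrace q π (f i) := by
  rw [chTrace, fredholmDiff_sum, opTrace_sum]
  · rfl
  · exact fun i => isTraceClass_fredholmDiff hπ (hf i)

/-- With D = π - ε one has D(ab) = D(a)π(b) + ε(a)D(b) and D(ba) = π(b)D(a) + ε(a)D(b), and D(a) is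
of trace class. -/
theorem chTrace_mul_comm (hπ : IsRepPi q π) {a b : OS7 q} (ha : a ∈ OS4 q) (hb : b ∈ OS4 q) :
    chTrace q π (a * b) = chTrace q π (b * a) := by
  have ta := isTraceClass_fredholmDiff hπ ha
  have tb := isTraceClass_fredholmDiff hπ hb
  have h1 : fredholmDiff q π (a * b) =
      fredholmDiff q π a * π b + counit q a • fredholmDiff q π b := by
    simp only [fredholmDiff, map_mul, sub_mul, smul_sub, smul_smul, smul_mul_assoc, one_mul]
    abel
  have h2 : fredholmDiff q π (b * a) =
      π b * fredholmDiff q π a + counit q a • fredholmDiff q π b := by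
    simp only [fredholmDiff, map_mul, mul_sub, smul_sub, smul_smul, mul_smul_comm, mul_one,
      mul_comm (counit q a)]
    abel
  have tb' : IsTraceClass (counit q a • fredholmDiff q π b) := by
    simpa using tb.mul_left (counit q a • 1)
  rw [chTrace, chTrace, h1, h2, opTrace_add _ (ta.mul_right _) tb',
    opTrace_add _ (ta.mul_left _) tb', opTrace_mul_comm _ ta]

theorem chTrace_trace_mul_comm (hπ : IsRepPi q π) {ι κ : Type*} [Fintype ι] [Fintype κ] {V : Matrix ι κ (OS7 q)}
    {V' : Matrix κ ι (OS7 q)} (hV : ∀ i k, V i k ∈ OS4 q) (hV' : ∀ k i, V' k i ∈ OS4 q) :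
    chTrace q π (V * V').trace = chTrace q π (V' * V).trace := by
  simp only [Matrix.trace, Matrix.diag_apply, Matrix.mul_apply]
  rw [chTrace_sum hπ, chTrace_sum hπ]
  · simp only [chTrace_sum hπ _ fun _ => mul_mem (hV _ _) (hV' _ _),
      chTrace_sum hπ _ fun _ => mul_mem (hV' _ _) (hV _ _)]
    rw [Finset.sum_comm]
    exact Finset.sum_congr rfl fun k _ => Finset.sum_congr rfl fun i _ =>
      chTrace_mul_comm hπ (hV _ _) (hV' _ _)
  · exact fun k => sum_mem fun i _ => mul_mem (hV' _ _) (hV _ _)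
  · exact fun k => sum_mem fun i _ => mul_mem (hV _ _) (hV' _ _)

/-! ### The Chern number by a two-step recursion -/

variable (q) in
theorem sum_star_u_mul_u : ∑ j, ∑ i, star (u q j i) * u q j i = 2 := by
  have h := congrArg Matrix.trace (u_conjTranspose_mul q)
  rw [Matrix.trace_one, Fintype.card_fin, Nat.cast_ofNat] at h
  rw [← h, Finset.sum_comm]
  rfl

variable (q) in
theorem trace_u_mul : (u q * (u q)ᴴ).trace = ∑ j, ∑ i, u q j i * star (u q j i) := rfl

variable (q) in
theorem counit_trace_u : counit q (u q * (u q)ᴴ).trace = 2 := by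
  have h := congrArg (counit q) (sum_star_u_mul_u q)
  rw [map_ofNat] at h
  rw [trace_u_mul, ← h]
  simp only [map_sum, map_mul, mul_comm]

variable (q) in
theorem trace_u_mem : (u q * (u q)ᴴ).trace ∈ OS4 q :=
  sum_mem fun j _ => Cov.mul_conjTranspose_mem (OSU2.t₁_mul_conjTranspose q) (cov_u q) (cov_u q) j j

/-- Replacing π(b) by D(b) + ε(b), D = π - ε, splits off ε(b) D(Tr uu^*). In the remaining sum D(b)
is of trace class, so π(u_j^i)^* may be cycled to the front, where ∑ u^*u = 2. The entries of u are
not coinvariant, so traciality on B alone would not suffice. -/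
theorem chTrace_sandwich (hπ : IsRepPi q π) {b : OS7 q} (hb : b ∈ OS4 q) :
    chTrace q π (∑ j, ∑ i, u q j i * b * star (u q j i)) =
      2 * chTrace q π b + counit q b * chTrace q π (u q * (u q)ᴴ).trace := by
  have tb := isTraceClass_fredholmDiff hπ hb
  have h1 : fredholmDiff q π (∑ j, ∑ i, u q j i * b * star (u q j i)) =
      (∑ j, ∑ i, π (u q j i) * fredholmDiff q π b * π (star (u q j i))) +
        counit q b • fredholmDiff q π (u q * (u q)ᴴ).trace := by
    simp only [trace_u_mul, fredholmDiff_sum, Finset.smul_sum, ← Finset.sum_add_distrib]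
    refine Finset.sum_congr rfl fun j _ => Finset.sum_congr rfl fun i _ => ?_
    simp only [fredholmDiff, map_mul, mul_sub, sub_mul, smul_sub, smul_smul, smul_mul_assoc,
      mul_smul_comm, mul_one]
    rw [mul_comm (counit q b), mul_right_comm]
    abel
  have t1 : ∀ j i, IsTraceClass (π (u q j i) * fredholmDiff q π b * π (star (u q j i))) :=
    fun j i => (tb.mul_left _).mul_right _
  have t2 : ∀ j i, IsTraceClass (π (star (u q j i)) * (π (u q j i) * fredholmDiff q π b)) :=
    fun j i => (tb.mul_left _).mul_left _
  have tN := isTraceClass_fredholmDiff hπ (trace_u_mem q)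
  have tN' : IsTraceClass (counit q b • fredholmDiff q π (u q * (u q)ᴴ).trace) := by
    simpa using tN.mul_left (counit q b • 1)
  have ts : ∀ j, IsTraceClass (∑ i, π (u q j i) * fredholmDiff q π b * π (star (u q j i))) :=
    fun j => (traceClassIdeal L2).sum_mem fun i _ => t1 j i
  have ts2 : ∀ j, IsTraceClass (∑ i, π (star (u q j i)) * (π (u q j i) * fredholmDiff q π b)) :=
    fun j => (traceClassIdeal L2).sum_mem fun i _ => t2 j i
  have h2 : opTrace ketBasis
      (∑ j, ∑ i, π (u q j i) * fredholmDiff q π b * π (star (u q j i))) =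
        opTrace ketBasis ((2 : ℂ) • fredholmDiff q π b) := by
    have : (2 : ℂ) • fredholmDiff q π b =
        ∑ j, ∑ i, π (star (u q j i)) * (π (u q j i) * fredholmDiff q π b) := by
      have h := congrArg π (sum_star_u_mul_u q)
      simp only [map_sum, map_mul, map_ofNat] at h
      simp only [← mul_assoc, ← Finset.sum_mul, h]
      rw [two_smul, two_mul]
    rw [this, opTrace_sum _ _ ts, opTrace_sum _ _ ts2]
    refine Finset.sum_congr rfl fun j _ => ?_
    rw [opTrace_sum _ _ (t1 j), opTrace_sum _ _ (t2 j)]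
    exact Finset.sum_congr rfl fun i _ => opTrace_mul_comm _ (tb.mul_left _) _
  rw [chTrace, h1, opTrace_add _ ((traceClassIdeal L2).sum_mem fun j _ => ts j) tN', h2,
    opTrace_smul, opTrace_smul]
  rfl

/-- The relations give Tr uu^* = 2 - (1 - q^2)(1 - q^4) x_2^*x_2 plus a multiple of x_1x_1^*, which
π kills. The trace of π(x_2^*x_2) is the double geometric series with sum 1/((1 - q^2)(1 - q^4)). -/
theorem chTrace_trace_u (hπ : IsRepPi q π) : chTrace q π (u q * (u q)ᴴ).trace = -1 := by
  have h0 : π (star (x q 0)) = 0 := by rw [map_star, hπ.x1, star_zero]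
  have hN : (u q * (u q)ᴴ).trace = 2 +
      (q.c ^ 4 - q.c ^ 2 + q.c ^ 6 - q.c ^ 8) • (x q 0 * star (x q 0)) -
        ((1 - q.c ^ 2) * (1 - q.c ^ 4)) • (star (x q 1) * x q 1) := by
    rw [trace_u_mul, ← one_add_one_eq_two (R := OS7 q)]
    simp [u, Fin.sum_univ_four, smul_smul, s22, s11, sphere, sphere', -RCLike.star_def]
    match_scalars <;> ring
  have h1 : fredholmDiff q π (u q * (u q)ᴴ).trace =
      (-((1 - q.c ^ 2) * (1 - q.c ^ 4))) • π (star (x q 1) * x q 1) := by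
    rw [fredholmDiff, counit_trace_u, hN]
    simp only [map_add, map_sub, map_mul, map_smul, map_ofNat, h0, mul_zero, smul_zero, add_zero,
      neg_smul]
    rw [two_smul, one_add_one_eq_two]
    abel
  have h2 : opTrace ketBasis (π (star (x q 1) * x q 1)) =
      (((1 - (q : ℝ) ^ 2)⁻¹ * (1 - (q : ℝ) ^ 4)⁻¹ : ℝ) : ℂ) := by
    refine HasSum.tsum_eq ?_
    convert Complex.hasSum_ofReal.2 (hasSum_sq_pow_weight q) using 2 with k
    rw [map_mul, map_star, ContinuousLinearMap.star_eq_adjoint, mul_apply_eq_comp,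
      ContinuousLinearMap.adjoint_inner_right, inner_self_eq_norm_sq_to_K, pi_x1_ketBasis hπ,
      norm_smul, ketBasis.orthonormal.1, mul_one, norm_pow, QParam.c,
      Complex.norm_real, Real.norm_of_nonneg q.2.1.le]
    push_cast
    rfl
  have h3 : (1 - q.c ^ 2) ≠ 0 := by
    have := (pow_lt_one₀ q.2.1.le q.2.2 two_ne_zero).ne'
    rw [QParam.c, sub_ne_zero]
    exact_mod_cast this
  have h4 : (1 - q.c ^ 4) ≠ 0 := by
    have := (pow_lt_one₀ q.2.1.le q.2.2 four_ne_zero).ne'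
    rw [QParam.c, sub_ne_zero]
    exact_mod_cast this
  rw [chTrace, h1, opTrace_smul, h2]
  push_cast
  change _ * ((1 - q.c ^ 2)⁻¹ * (1 - q.c ^ 4)⁻¹) = _
  field_simp

variable (q) in
theorem trace_Uprod_mul (n : ℕ) : (Uprod q n * (Uprod q n)ᴴ).trace =
    ∑ j, ∑ i, u q j i * (P q n).trace * star (u q j i) := by
  simp only [Matrix.trace, Matrix.diag_apply, Matrix.mul_apply, Matrix.conjTranspose_apply,
    Uprod_apply, P, Fintype.sum_prod_type, star_mul]
  rw [← (Fin.consEquiv fun _ : Fin (n + 1) => Fin 4).sum_comp, Fintype.sum_prod_type]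
  refine Finset.sum_congr rfl fun j _ => ?_
  rw [Finset.sum_comm]
  refine Finset.sum_congr rfl fun i _ => ?_
  simp only [Finset.mul_sum, Finset.sum_mul, mul_assoc]
  rfl

variable (q) in
theorem trace_P_mem (n : ℕ) : (P q n).trace ∈ OS4 q := sum_mem fun I _ => P_apply_mem q n I I

variable (q) in
-- The character has commutative values, so Tr UU^* may be replaced by Tr U^*U, the trace of an
-- identity matrix.
theorem counit_trace_P (n : ℕ) : counit q (P q n).trace = n + 1 := by
  have h := congrArg (fun M => counit q M.trace) (U_isometry q n)
  simp only [Matrix.trace_one, Fintype.card_fin, map_natCast, Nat.cast_add, Nat.cast_one, map_add, map_one] at h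
  rw [← h]
  simp only [P, Matrix.trace, Matrix.diag_apply, Matrix.mul_apply, map_sum, map_mul,
    Matrix.conjTranspose_apply]
  rw [Finset.sum_comm]
  simp only [mul_comm]

/-- Q_m and P_m are equivalent projections over B: the partial isometry W U^* has coinvariant
entries because the rows of U_m and W_m transform under the same t_m. -/
theorem chTrace_trace_Q (hπ : IsRepPi q π) (m : ℕ) :
    chTrace q π (Q q m).trace = chTrace q π (P q m).trace := by
  have hT := map_star_unitary (tmat_mul_conjTranspose q m)
  have h := chTrace_trace_mul_comm hπ (V := W q m * (U q m)ᴴ) (V' := U q m * (W q m)ᴴ)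
    (fun I J => Cov.dot_mem hT (cov_W q m I) (cov_U q m J).star)
    (fun I J => Cov.dot_mem hT (cov_U q m I) (cov_W q m J).star)
  have h1 : W q m * (U q m)ᴴ * (U q m * (W q m)ᴴ) = Q q m := by
    rw [Matrix.mul_assoc, ← Matrix.mul_assoc (U q m)ᴴ, U_isometry, Matrix.one_mul, Q]
  have h2 : U q m * (W q m)ᴴ * (W q m * (U q m)ᴴ) = P q m := by
    rw [Matrix.mul_assoc, ← Matrix.mul_assoc (W q m)ᴴ, W_isometry, Matrix.one_mul, P]
  rwa [h1, h2] at h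

/-- The trace of `P_add_Q`, evaluated by `chTrace_sandwich` at b = Tr P_{m+1}; the term m + 2 is
ε(b). -/
theorem chTrace_trace_P_add_two (hπ : IsRepPi q π) (m : ℕ) :
    chTrace q π (P q (m + 2)).trace = 2 * chTrace q π (P q (m + 1)).trace - (m + 2) -
      chTrace q π (P q m).trace := by
  have h := congrArg (fun M => chTrace q π M.trace) (P_add_Q q m)
  have hQ : (Q q m).trace ∈ OS4 q := sum_mem fun I _ =>
    Cov.mul_conjTranspose_mem (tmat_mul_conjTranspose q m) (cov_W q m) (cov_W q m) I I
  simp only [trace_Uprod_mul, Matrix.trace_add] at h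
  rw [chTrace_add hπ (trace_P_mem q _) hQ, chTrace_trace_Q hπ,
    chTrace_sandwich hπ (trace_P_mem q _), chTrace_trace_u hπ, counit_trace_P] at h
  push_cast at h
  linear_combination h

theorem chTrace_trace_P_zero (π : OS7 q →⋆ₐ[ℂ] (L2 →L[ℂ] L2)) : chTrace q π (P q 0).trace = 0 := by
  have : (P q 0).trace = 1 := by
    simp [P, Matrix.trace, Matrix.mul_apply, U, Ucol]
  rw [this, chTrace, fredholmDiff, map_one, map_one, one_smul, sub_self, opTrace_zero]

variable (q) in
theorem trace_P_one : (P q 1).trace = (u q * (u q)ᴴ).trace := by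
  simp only [P, Matrix.trace, Matrix.diag_apply, Matrix.mul_apply, Matrix.conjTranspose_apply]
  rw [← (Equiv.funUnique (Fin 1) (Fin 4)).symm.sum_comp]
  refine Finset.sum_congr rfl fun j _ => Finset.sum_congr rfl fun i _ => ?_
  rw [U_one]
  rfl

theorem chTrace_trace_P (hπ : IsRepPi q π) (n : ℕ) :
    chTrace q π (P q n).trace = -((n : ℂ) * (n + 1) * (n + 2) / 6) := by
  induction n using Nat.twoStepInduction with
  | zero => simp [chTrace_trace_P_zero]
  | one => rw [trace_P_one, chTrace_trace_u hπ]; norm_num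
  | more n h1 h2 =>
    rw [chTrace_trace_P_add_two hπ, h1, h2]
    push_cast
    ring

theorem hasCh1_P (hπ : IsRepPi q π) (n : ℕ) :
    HasCh1 q π (P q n) (-((n : ℂ) * (n + 1) * (n + 2) / 6)) :=
  (isTraceClass_fredholmDiff hπ (trace_P_mem q n)).hasTrace ketBasis (chTrace_trace_P hπ n)

end QS4
end

noncomputable section

/-! ## The representation on `ℓ²(ℕ²)` -/

section WeightedShift

variable (w : ℕ × ℕ → ℂ) (σ : ℕ × ℕ → ℕ × ℕ)

/-- Drop the indices where `w` vanishes; on the others `σ` is injective, so the sum is part of the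
norm series of `f`. -/
theorem sum_norm_weighted_le (hw : ∀ k, ‖w k‖ ≤ 1)
    (hσ : ∀ k l, w k ≠ 0 → w l ≠ 0 → σ k = σ l → k = l) (f : L2) (s : Finset (ℕ × ℕ)) :
    ∑ k ∈ s, ‖w k * f (σ k)‖ ^ (2 : ENNReal).toReal ≤ ‖f‖ ^ (2 : ENNReal).toReal := by
  classical
  have h2 : 0 < (2 : ENNReal).toReal := by norm_num
  calc ∑ k ∈ s, ‖w k * f (σ k)‖ ^ (2 : ENNReal).toReal
      = ∑ k ∈ s with w k ≠ 0, ‖w k * f (σ k)‖ ^ (2 : ENNReal).toReal := by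
        refine (Finset.sum_filter_of_ne (p := fun k => w k ≠ 0) fun k _ hk hwk => hk ?_).symm
        rw [hwk, zero_mul, norm_zero, Real.zero_rpow h2.ne']
    _ ≤ ∑ k ∈ s with w k ≠ 0, ‖f (σ k)‖ ^ (2 : ENNReal).toReal := by
        refine Finset.sum_le_sum fun k _ => Real.rpow_le_rpow (norm_nonneg _) ?_ h2.le
        rw [norm_mul]
        exact mul_le_of_le_one_left (norm_nonneg _) (hw k)
    _ = ∑ l ∈ (s.filter fun k => w k ≠ 0).image σ, ‖f l‖ ^ (2 : ENNReal).toReal := by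
        rw [Finset.sum_image]
        intro k hk l hl h
        exact hσ k l (Finset.mem_filter.1 hk).2 (Finset.mem_filter.1 hl).2 h
    _ ≤ _ := lp.sum_rpow_le_norm_rpow h2 f _

/-- The operator `f ↦ (k ↦ w k * f (σ k))`, where `|w| ≤ 1` and `σ` is injective on the support
of `w`. -/
def weightedShift (hw : ∀ k, ‖w k‖ ≤ 1)
    (hσ : ∀ k l, w k ≠ 0 → w l ≠ 0 → σ k = σ l → k = l) : L2 →L[ℂ] L2 :=
  LinearMap.mkContinuous
    { toFun := fun f => ⟨fun k => w k * f (σ k), memℓp_gen' (sum_norm_weighted_le w σ hw hσ f)⟩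
      map_add' := fun f g => lp.ext (funext fun k => mul_add _ _ _)
      map_smul' := fun c f => lp.ext (funext fun k => mul_left_comm _ _ _) } 1
    fun f => by
      rw [one_mul]
      exact lp.norm_le_of_forall_sum_le (by norm_num) (norm_nonneg f)
        (sum_norm_weighted_le w σ hw hσ f)

variable {w σ} {hw : ∀ k, ‖w k‖ ≤ 1} {hσ : ∀ k l, w k ≠ 0 → w l ≠ 0 → σ k = σ l → k = l}

theorem weightedShift_apply (f : L2) (k : ℕ × ℕ) :
    weightedShift w σ hw hσ f k = w k * f (σ k) := rfl

theorem ket_apply (a b : ℕ) (k : ℕ × ℕ) : ket a b k = if k = (a, b) then 1 else 0 := by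
  rw [ket, lp.single_apply, Pi.single_apply]

theorem inner_ket (a b : ℕ) (f : L2) : inner ℂ (ket a b) f = f (a, b) := by
  rw [← ketBasis_apply, ← HilbertBasis.repr_apply_apply]
  rfl

/-- The hypothesis compares matrix coefficients in the canonical basis, whose span is dense. -/
theorem star_weightedShift {w' : ℕ × ℕ → ℂ} {σ' : ℕ × ℕ → ℕ × ℕ} {hw' : ∀ k, ‖w' k‖ ≤ 1}
    {hσ' : ∀ k l, w' k ≠ 0 → w' l ≠ 0 → σ' k = σ' l → k = l}
    (h : ∀ k l, star (w k * if σ k = l then 1 else 0) = w' l * if σ' l = k then 1 else 0) :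
    star (weightedShift w σ hw hσ) = weightedShift w' σ' hw' hσ' := by
  have hb : ∀ l : ℕ × ℕ, star (weightedShift w σ hw hσ) (ketBasis l) =
      weightedShift w' σ' hw' hσ' (ketBasis l) := by
    rintro ⟨a, b⟩
    refine lp.ext (funext fun k => ?_)
    rw [ketBasis_apply, weightedShift_apply, ket_apply, ← h, ← Prod.mk.eta (p := k), ← inner_ket,
      ContinuousLinearMap.star_eq_adjoint, ContinuousLinearMap.adjoint_inner_right,
      ← inner_conj_symm, inner_ket, weightedShift_apply, ket_apply]
    rfl
  refine ContinuousLinearMap.ext_on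
    (Submodule.dense_iff_topologicalClosure_eq_top.2 ketBasis.dense_span) ?_
  rintro _ ⟨l, rfl⟩
  exact hb l

end WeightedShift

namespace QS4

variable (q : QParam)

/-- The weight `(1 - q^m)^{1/2}`. -/
def rootWeight (m : ℕ) : ℂ := ((Real.sqrt (1 - (q : ℝ) ^ m) : ℝ) : ℂ)

/-- This makes the truncated subtractions in `opX3` and `opX4` harmless: at index 0 the weight
vanishes, so the index maps are injective on the support of the weights. -/
theorem rootWeight_zero : rootWeight q 0 = 0 := by simp [rootWeight]

theorem rootWeight_mul_self (m : ℕ) : rootWeight q m * rootWeight q m = 1 - q.c ^ m := by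
  rw [rootWeight, ← Complex.ofReal_mul,
    Real.mul_self_sqrt (sub_nonneg.2 (pow_le_one₀ q.2.1.le q.2.2.le)), QParam.c]
  push_cast
  rfl

theorem star_rootWeight (m : ℕ) : star (rootWeight q m) = rootWeight q m := Complex.conj_ofReal _

theorem norm_rootWeight_le (m : ℕ) : ‖rootWeight q m‖ ≤ 1 := by
  rw [rootWeight, Complex.norm_real, Real.norm_of_nonneg (Real.sqrt_nonneg _)]
  exact Real.sqrt_le_one.2 (sub_le_self _ (pow_nonneg q.2.1.le m))

theorem norm_pow_le (m : ℕ) : ‖q.c ^ m‖ ≤ 1 := by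
  rw [norm_pow, QParam.c, Complex.norm_real, Real.norm_of_nonneg q.2.1.le]
  exact pow_le_one₀ q.2.1.le q.2.2.le

theorem norm_pow_mul_rootWeight_le (m l : ℕ) : ‖q.c ^ m * rootWeight q l‖ ≤ 1 := by
  rw [norm_mul]
  exact mul_le_one₀ (norm_pow_le q m) (norm_nonneg _) (norm_rootWeight_le q l)

/-- The operator `π(x₂)`. -/
def opX2 : L2 →L[ℂ] L2 :=
  weightedShift (fun k => q.c ^ (k.1 + 2 * k.2)) id (fun _ => norm_pow_le q _)
    (fun _ _ _ _ h => h)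

/-- The operator `π(x₃)`. -/
def opX3 : L2 →L[ℂ] L2 :=
  weightedShift (fun k => q.c ^ k.1 * rootWeight q (4 * k.2)) (fun k => (k.1, k.2 - 1))
    (fun k => norm_pow_mul_rootWeight_le q _ _) (by
      rintro ⟨a, _ | b⟩ ⟨a', _ | b'⟩ <;> simp [rootWeight_zero])

/-- The adjoint of `π(x₃)`. -/
def opY3 : L2 →L[ℂ] L2 :=
  weightedShift (fun k => q.c ^ k.1 * rootWeight q (4 * (k.2 + 1))) (fun k => (k.1, k.2 + 1))
    (fun k => norm_pow_mul_rootWeight_le q _ _) (by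
      rintro ⟨a, b⟩ ⟨a', b'⟩
      simp)

/-- The operator `π(x₄)`. -/
def opX4 : L2 →L[ℂ] L2 :=
  weightedShift (fun k => rootWeight q (2 * k.1)) (fun k => (k.1 - 1, k.2))
    (fun k => norm_rootWeight_le q _) (by
      rintro ⟨_ | a, b⟩ ⟨_ | a', b'⟩ <;> simp [rootWeight_zero])

/-- The adjoint of `π(x₄)`. -/
def opY4 : L2 →L[ℂ] L2 :=
  weightedShift (fun k => rootWeight q (2 * (k.1 + 1))) (fun k => (k.1 + 1, k.2))
    (fun k => norm_rootWeight_le q _) (by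
      rintro ⟨a, b⟩ ⟨a', b'⟩
      simp)

theorem star_opX2 : star (opX2 q) = opX2 q :=
  star_weightedShift fun k l => by
    rcases eq_or_ne k l with rfl | h
    · simp [-RCLike.star_def]
    · simp [h, h.symm]

theorem star_opX3 : star (opX3 q) = opY3 q :=
  star_weightedShift (by
    rintro ⟨a, _ | b⟩ ⟨a', b'⟩
    · simp [rootWeight_zero]
    · simp only [Nat.add_sub_cancel, Prod.mk.injEq, Nat.add_right_cancel_iff]
      by_cases h : a = a' ∧ b = b'
      · obtain ⟨rfl, rfl⟩ := h
        simp [star_rootWeight, -RCLike.star_def]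
      · have h' : ¬ (a' = a ∧ b' = b) := fun h2 => h ⟨h2.1.symm, h2.2.symm⟩
        simp [h, h'])

theorem star_opX4 : star (opX4 q) = opY4 q :=
  star_weightedShift (by
    rintro ⟨_ | a, b⟩ ⟨a', b'⟩
    · simp [rootWeight_zero]
    · simp only [Nat.add_sub_cancel, Prod.mk.injEq, Nat.add_right_cancel_iff]
      by_cases h : a = a' ∧ b = b'
      · obtain ⟨rfl, rfl⟩ := h
        simp [star_rootWeight, -RCLike.star_def]
      · have h' : ¬ (a' = a ∧ b' = b) := fun h2 => h ⟨h2.1.symm, h2.2.symm⟩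
        simp [h, h'])

variable {q}

theorem opX2_apply (f : L2) (a b : ℕ) : opX2 q f (a, b) = q.c ^ (a + 2 * b) * f (a, b) := rfl

theorem opX3_apply_zero (f : L2) (a : ℕ) : opX3 q f (a, 0) = 0 := by
  change q.c ^ a * rootWeight q (4 * 0) * _ = 0
  rw [mul_zero, rootWeight_zero, mul_zero, zero_mul]

theorem opX3_apply_succ (f : L2) (a b : ℕ) :
    opX3 q f (a, b + 1) = q.c ^ a * rootWeight q (4 * (b + 1)) * f (a, b) := rfl

theorem opY3_apply (f : L2) (a b : ℕ) :
    opY3 q f (a, b) = q.c ^ a * rootWeight q (4 * (b + 1)) * f (a, b + 1) := rfl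

theorem opX4_apply_zero (f : L2) (b : ℕ) : opX4 q f (0, b) = 0 := by
  change rootWeight q (2 * 0) * _ = 0
  rw [mul_zero, rootWeight_zero, zero_mul]

theorem opX4_apply_succ (f : L2) (a b : ℕ) :
    opX4 q f (a + 1, b) = rootWeight q (2 * (a + 1)) * f (a, b) := rfl

theorem opY4_apply (f : L2) (a b : ℕ) :
    opY4 q f (a, b) = rootWeight q (2 * (a + 1)) * f (a + 1, b) := rfl

theorem clm_ext {S T : L2 →L[ℂ] L2} (h : ∀ f a b, S f (a, b) = T f (a, b)) : S = T :=
  ContinuousLinearMap.ext fun f => lp.ext (funext fun k => h f k.1 k.2)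

variable (q)

/-- The representation `π`. -/
def repPi : OS7 q →⋆ₐ[ℂ] (L2 →L[ℂ] L2) :=
  StarAlg.lift ![0, opX2 q, opX3 q, opX4 q] (by
    intro x y h
    cases h <;>
      simp [map_star, star_opX2, star_opX3, star_opX4, -RCLike.star_def]
    all_goals
      refine clm_ext fun f a b => ?_
      -- Each relation is checked on coordinates, separating index 0 from successors; square roots
      -- are eliminated through their squares.
      have hA := fun m => (sq (rootWeight q m)).trans (rootWeight_mul_self q m)
      rcases a with _ | a <;> rcases b with _ | b <;>
        simp only [add_apply, smul_apply,
          lp.coeFn_add, lp.coeFn_smul, Pi.add_apply, Pi.smul_apply,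
          smul_eq_mul, mul_apply_eq_comp, one_apply_eq_self,
          opX2_apply, opX3_apply_zero, opX3_apply_succ, opX4_apply_zero, opX4_apply_succ,
          opY3_apply, opY4_apply, mul_zero, add_zero, zero_add]
    all_goals first | (ring_nf; done) | (ring_nf; simp only [hA]; ring_nf; done))

theorem isRepPi_repPi : IsRepPi q (repPi q) := by
  have hx : ∀ i, repPi q (OS7.x q i) = ![0, opX2 q, opX3 q, opX4 q] i :=
    fun i => StarAlg.lift_gen _ _ i
  refine ⟨hx 0, fun a b => ?_, fun a b => ?_, fun a b => ?_⟩
  · rw [hx 1]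
    refine lp.ext (funext fun ⟨c, d⟩ => ?_)
    change q.c ^ (c + 2 * d) * ket a b (c, d) = q.c ^ (a + 2 * b) * ket a b (c, d)
    simp only [ket_apply]
    split_ifs with h
    · obtain ⟨rfl, rfl⟩ := Prod.mk.injEq .. ▸ h
      rfl
    · simp
  · rw [hx 2]
    refine lp.ext (funext fun ⟨c, d⟩ => ?_)
    change opX3 q (ket a b) (c, d) = q.c ^ a * rootWeight q (4 * (b + 1)) * ket a (b + 1) (c, d)
    rcases d with _ | d
    · simp [opX3_apply_zero, ket_apply]
    · simp only [opX3_apply_succ, ket_apply, Prod.mk.injEq, Nat.add_right_cancel_iff]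
      split_ifs with h
      · rw [h.1, h.2]
      · simp
  · rw [hx 3]
    refine lp.ext (funext fun ⟨c, d⟩ => ?_)
    change opX4 q (ket a b) (c, d) = rootWeight q (2 * (a + 1)) * ket (a + 1) b (c, d)
    rcases c with _ | c
    · simp [opX4_apply_zero, ket_apply]
    · simp only [opX4_apply_succ, ket_apply, Prod.mk.injEq, Nat.add_right_cancel_iff]
      split_ifs with h
      · rw [h.1]
      · simp

end QS4

end

/-- In the first part `n = m + 1` runs over the integers `n ≥ 1`. -/
theorem proposition5p8 (q : QParam) :
    (∀ m : ℕ,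
      -- `P_{n+1} + Q_{n-1}` is a projection over `O(S^4_q)`
      (∀ I J, (P q (m + 2) + Q q m) I J ∈ OS4 q) ∧
      IsStarProjection (P q (m + 2) + Q q m) ∧
      -- it coincides with the tensor-product projection
      P q (m + 2) + Q q m = Uprod q (m + 1) * (Uprod q (m + 1)).conjTranspose ∧
      (P q (m + 2) + Q q m).submatrix consIdx consIdx =
        (tensorProj (P q (m + 1)) (OS7.u q) (OS7.u q).conjTranspose).submatrix
          Prod.swap Prod.swap ∧
      (∃ Ψ : BalTensor (OS4 q) (Edual q (m + 1)) (Edual q 1) ≃ₗ[(OS4 q)ᵐᵒᵖ]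
          projModule q (P q (m + 2) + Q q m),
        ∀ (b : Edual q (m + 1)) (a : Edual q 1) (j : Fin 4 × (Fin (m + 1) → Fin 4)),
          (Ψ (BalTensor.tmul (OS4 q) b a)).1 (consIdx j) =
            ∑ i, ∑ k, OS7.u q j.1 i * U q (m + 1) j.2 k * b.1 k * a.1 i) ∧
      -- explicit isomorphism of right modules with `E_1 ⊗ E_n`
      (∃ Φ : BalTensor (OS4 q) (E q 1) (E q (m + 1)) ≃ₗ[(OS4 q)ᵐᵒᵖ]
          projModule q (P q (m + 2) + Q q m),
        ∀ (a : E q 1) (b : E q (m + 1)) (J : Fin (m + 2) → Fin 4),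
          (Φ (BalTensor.tmul (OS4 q) a b)).1 J =
            ∑ k : Fin (m + 3), (-q.c) ^ k.1 • (U q (m + 2) J k * symPart q a.1 b.1 k.rev) +
            ∑ k : Fin (m + 1), (-q.c) ^ k.1 • (W q m J k * asymPart q a.1 b.1 k.rev))) ∧
    -- `P_n` is a projection over `O(S^4_q)` for the module `E_n`
    (∀ n : ℕ, 1 ≤ n →
      (∀ I J, P q n I J ∈ OS4 q) ∧
      IsStarProjection (P q n) ∧
      Nonempty (projModule q (P q n) ≃ₗ[(OS4 q)ᵐᵒᵖ] E q n)) ∧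
    -- the Chern number of `E_n`
    (∃ π, IsRepPi q π) ∧
    (∀ π, IsRepPi q π → ∀ n : ℕ, 1 ≤ n →
      HasCh1 q π (P q n) (-((n : ℂ) * (n + 1) * (n + 2) / 6))) := by
  refine ⟨fun m => ⟨fun I J => ?_, ?_, P_add_Q q m, submatrix_P_add_Q q m, exists_dual_equiv q m,
    exists_product_equiv q m⟩, fun n _ => ⟨P_apply_mem q n,
      isStarProjection_mul_conjTranspose (U_isometry q n), ⟨projModuleEquivE q n⟩⟩,
    ⟨repPi q, isRepPi_repPi q⟩, fun π hπ n _ => hasCh1_P hπ n⟩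
  · rw [P_add_Q]
    exact Uprod_mul_conjTranspose_mem q (m + 1) I J
  · rw [P_add_Q]
    exact isStarProjection_mul_conjTranspose (Uprod_isometry q (m + 1))
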